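/- **Conventions.** Let $T$ be a complete first-order theory in a language $L$, and put $|T| = |L| + \aleph_0$. All variables $x, y$ denote finite tuples. A formula $\varphi(x;y)$ *has SOP$_1$* if, in a model of $T$, there are tuples $(a_\eta)_{\eta \in 2^{<\omega}}$ such that $\{\varphi(x;a_{\eta|k}) : k<\omega\}$ is consistent for every $\eta \in 2^\omega$, and $\{\varphi(x;a_\nu), \varphi(x;a_{\eta\frown\langle 1\rangle})\}$ is inconsistent whenever $\eta\in 2^{<\omega}$ and $\nu \unrhd \eta\frown\langle 0\rangle$. $T$ is *NSOP$_1$* if no formula has SOP$_1$. Let $\mathbb{M}$ be a sufficiently saturated (monster) model of $T$; all sets of parameters and all models considered are small subsets, respectively elementary submodels, of $\mathbb{M}$. A global type $q \in S(\mathbb{M})$ is *$A$-invariant* if $\varphi(y;e)\in q \iff \varphi(y;e')\in q$ whenever $e \equiv_A e'$; a *Morley sequence* in $q$ over $A$ is a sequence $(b_i)_{i<\omega}$ with $b_i \models q|_{A b_{<i}}$ for all $i$. A formula $\varphi(x;b)$ *Kim-divides* over $A$ if there are an $A$-invariant global type $q \supseteq \mathrm{tp}(b/A)$ and a Morley sequence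 $(b_i)_{i<\omega}$ in $q$ over $A$ with $\{\varphi(x;b_i): i<\omega\}$ inconsistent. It *Kim-forks* over $A$ if it implies a finite disjunction of formulas (with parameters in $\mathbb{M}$) each of which Kim-divides over $A$. A type *Kim-forks* over $A$ if it implies a formula that Kim-forks over $A$. **Theorem.** (A) Suppose $T$ is NSOP$_1$. Then for every model $M \models T$ and every type $p \in S(M)$ in finitely many variables there is an elementary submodel $M' \preceq M$ with $|M'| \le 2^{|T|}$ such that $p$ does not Kim-fork over $M'$. (B) The following are equivalent. 1. For some cardinal $\kappa > |T|$ there is no sequence $\langle N_i, \varphi_i(x,y_i), c_i : i<\kappa\rangle$ such that $\langle N_i : i<\kappa\rangle$ is an increasing continuous sequence of models of $T$ of size $<\kappa$, each $\varphi_i(x,y_i)$ is a formula over $N_i$, $c_i \in N_{i+1}$, each $\varphi_i(x,c_i)$ Kim-forks over $N_i$, and $\{\varphi_i(x,c_i) : i<\kappa\}$ is consistent. 2. $T$ is NSOP$_1$. -/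

import Mathlib

universe u v w w'

open FirstOrder Cardinal

namespace KimIndependence

open FirstOrder.Language

section Types

variable {L : FirstOrder.Language.{u, v}}

/-- `|T|` for a theory `T` in the language `L`: the usual convention `|T| = |L| + ℵ₀`. -/
noncomputable def theoryCard (_T : L.Theory) : Cardinal.{max u v} :=
  max ℵ₀ L.card

variable {M : Type w} [L.Structure M] {α γ : Type}

/-- The formula `φ(x; e)` with parameters in `M`, obtained from the formula `φ(x; z)` by plugging
in the tuple `e` for `z`. -/
noncomputable def plug (φ : L.Formula (α ⊕ γ)) (e : γ → M) : L[[M]].Formula α :=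
  BoundedFormula.constantsVarsEquiv.symm (φ.relabel (Sum.elim Sum.inr (Sum.inl ∘ e)))

/-- `φ(x; e) ∈ q`, where `q` is a complete type over the structure `M`, i.e. a complete type of the
theory of `M` with all elements of `M` named. -/
def Has (q : (L.elementaryDiagram M).CompleteType α) (φ : L.Formula (α ⊕ γ)) (e : γ → M) : Prop :=
  Formula.equivSentence (plug φ e) ∈ q

end Types

section Saturation

variable (L : FirstOrder.Language.{u, v}) (U : Type w) [L.Structure U]

/-- `U` is `μ`-saturated: over any set `A` of fewer than `μ` parameters, every finitely satisfiable
set of formulas in finitely many variables is realized in `U`. -/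
def IsSaturated (μ : Cardinal.{w}) : Prop :=
  ∀ A : Set U, #A < μ → ∀ (n : ℕ) (Γ : Set (L[[A]].Formula (Fin n))),
    (∀ s : Finset (L[[A]].Formula (Fin n)), (s : Set (L[[A]].Formula (Fin n))) ⊆ Γ →
      ∃ a : Fin n → U, ∀ φ ∈ s, φ.Realize a) →
    ∃ a : Fin n → U, ∀ φ ∈ Γ, φ.Realize a

end Saturation

section Kim

/- In this section `U` plays the role of the monster model. The notions have their usual meaning
over a base `A` when `U` is `|A|⁺`-saturated. -/

variable {L : FirstOrder.Language.{u, v}} {U : Type w} [L.Structure U]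

/-- `b ≡_A b'`. -/
def EquivOver (A : Set U) {γ : Type} (b b' : γ → U) : Prop :=
  ∀ (k : ℕ) (φ : L.Formula (γ ⊕ Fin k)) (a : Fin k → U), (∀ i, a i ∈ A) →
    (φ.Realize (Sum.elim b a) ↔ φ.Realize (Sum.elim b' a))

/-- The global type `q` is `A`-invariant. -/
def IsInvariant (A : Set U) {β : Type} (q : (L.elementaryDiagram U).CompleteType β) : Prop :=
  ∀ (k : ℕ) (φ : L.Formula (β ⊕ Fin k)) (e e' : Fin k → U), EquivOver (L := L) A e e' →
    (Has q φ e ↔ Has q φ e')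

/-- `b ⊨ q|_C`; equivalently, `q` extends `tp(b/C)`. -/
def RealizesOver (C : Set U) {β : Type} (q : (L.elementaryDiagram U).CompleteType β)
    (b : β → U) : Prop :=
  ∀ (k : ℕ) (φ : L.Formula (β ⊕ Fin k)) (e : Fin k → U), (∀ i, e i ∈ C) →
    (Has q φ e ↔ φ.Realize (Sum.elim b e))

/-- `(b i)_{i < ω}` is a Morley sequence in `q` over `A`: `b i ⊨ q|_{A ∪ b_{<i}}` for all `i`. -/
def IsMorley (A : Set U) {β : Type} (q : (L.elementaryDiagram U).CompleteType β)
    (b : ℕ → β → U) : Prop :=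
  ∀ i, RealizesOver (A ∪ ⋃ j < i, Set.range (b j)) q (b i)

/-- The family of conditions `P i` on a tuple `x` (each given by a formula with parameters in `U`)
is consistent, i.e. finitely satisfiable in `U`. -/
def Consistent {ι : Type w'} {n : ℕ} (P : ι → (Fin n → U) → Prop) : Prop :=
  ∀ s : Finset ι, ∃ x : Fin n → U, ∀ i ∈ s, P i x

/-- `φ(x; y)` `q`-divides over `A`. -/
def QDivides (A : Set U) {n : ℕ} {β : Type} (φ : L.Formula (Fin n ⊕ β))
    (q : (L.elementaryDiagram U).CompleteType β) : Prop :=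
  ∃ b : ℕ → β → U, IsMorley A q b ∧ ¬ Consistent fun i x => φ.Realize (Sum.elim x (b i))

/-- `φ(x; b)` Kim-divides over `A`: `φ(x; y)` `q`-divides over `A` for some global `A`-invariant
type `q ⊇ tp(b/A)`. -/
def KimDivides (A : Set U) {n : ℕ} {β : Type} (φ : L.Formula (Fin n ⊕ β)) (b : β → U) : Prop :=
  ∃ q : (L.elementaryDiagram U).CompleteType β,
    IsInvariant A q ∧ RealizesOver A q b ∧ QDivides A φ q

/-- `φ(x; b)` Kim-forks over `A`: it implies a finite disjunction of formulas that Kim-divide over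
`A`. -/
def KimForks (A : Set U) {n : ℕ} {β : Type} (φ : L.Formula (Fin n ⊕ β)) (b : β → U) : Prop :=
  ∃ (k : ℕ) (m : Fin k → ℕ) (ψ : ∀ i, L.Formula (Fin n ⊕ Fin (m i))) (c : ∀ i, Fin (m i) → U),
    (∀ x : Fin n → U, φ.Realize (Sum.elim x b) → ∃ i, (ψ i).Realize (Sum.elim x (c i))) ∧
      ∀ i, KimDivides A (ψ i) (c i)

/-- The complete type `p ∈ S_n(M)`, for `M` an elementary submodel of `U`, Kim-forks over `A`: it
implies a formula `φ(x; b)` which Kim-forks over `A`. As `p` is closed under conjunction,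
`p ⊢ φ(x; b)` means that some `θ(x; m) ∈ p` implies `φ(x; b)`. -/
def TypeKimForks (A : Set U) {M : L.ElementarySubstructure U} {n : ℕ}
    (p : (L.elementaryDiagram M).CompleteType (Fin n)) : Prop :=
  ∃ (k : ℕ) (θ : L.Formula (Fin n ⊕ Fin k)) (m : Fin k → M)
    (l : ℕ) (φ : L.Formula (Fin n ⊕ Fin l)) (b : Fin l → U),
    Has p θ m ∧
    (∀ x : Fin n → U, θ.Realize (Sum.elim x fun i => (m i : U)) → φ.Realize (Sum.elim x b)) ∧
    KimForks A φ b

/-- In `U` there is a consistent Kim-forking chain of length `κ`: an increasing continuous sequence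
`(N i)_{i < κ}` of models of size `< κ`, formulas `φ i (x, y_i)` over `N i` (the parameters from
`N i` are displayed as the tuple `d i`) and tuples `c i ∈ N (i + 1)`, such that `φ i (x, c i)`
Kim-forks over `N i` and `{φ i (x, c i) : i < κ}` is consistent. -/
def HasKimForkingChain (L : FirstOrder.Language.{u, v}) (U : Type w) [L.Structure U]
    (κ : Cardinal.{w}) : Prop :=
  ∃ (n : ℕ) (N : Ordinal.{w} → L.ElementarySubstructure U) (m k : Ordinal.{w} → ℕ)
    (φ : ∀ i, L.Formula (Fin n ⊕ (Fin (m i) ⊕ Fin (k i))))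
    (c : ∀ i, Fin (m i) → U) (d : ∀ i, Fin (k i) → U),
    (∀ i j, i ≤ j → j < κ.ord → N i ≤ N j) ∧
    (∀ i < κ.ord, Order.IsSuccLimit i → (N i : Set U) = ⋃ j < i, (N j : Set U)) ∧
    (∀ i < κ.ord, #(N i) < κ) ∧
    (∀ i < κ.ord, ∀ t, d i t ∈ N i) ∧
    (∀ i < κ.ord, ∀ t, c i t ∈ N (i + 1)) ∧
    (∀ i < κ.ord, KimForks (N i : Set U) (φ i) (Sum.elim (c i) (d i))) ∧
    Consistent fun (i : Set.Iio κ.ord) (x : Fin n → U) =>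
      (φ i).Realize (Sum.elim x (Sum.elim (c i) (d i)))

end Kim

section SOP

variable {L : FirstOrder.Language.{u, v}}

/-- The formula `φ(x; y)` has SOP₁, witnessed by a tree of tuples `(a η)_{η ∈ 2^{<ω}}` in the
structure `N`. Nodes are lists of Booleans (root first), `0` being `false` and `1` being `true`. -/
def FormulaSOP1 (N : Type w) [L.Structure N] {n m : ℕ} (φ : L.Formula (Fin n ⊕ Fin m)) : Prop :=
  ∃ a : List Bool → Fin m → N,
    (∀ η : ℕ → Bool, Consistent fun (k : ℕ) (x : Fin n → N) =>
      φ.Realize (Sum.elim x (a ((List.range k).map η)))) ∧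
    ∀ η ν : List Bool, (η ++ [false]) <+: ν →
      ¬ ∃ x : Fin n → N, φ.Realize (Sum.elim x (a ν)) ∧
        φ.Realize (Sum.elim x (a (η ++ [true])))

/-- `T` has SOP₁: some formula has SOP₁ in a model of `T`. -/
def SOP1 (T : L.Theory) : Prop :=
  ∃ (N : Theory.ModelType.{u, v, max u v} T) (n m : ℕ) (φ : L.Formula (Fin n ⊕ Fin m)),
    FormulaSOP1 N φ

/-- `T` is NSOP₁. -/
def NSOP1 (T : L.Theory) : Prop := ¬ SOP1 T

end SOP

end KimIndependence

/-!
Kim's lemma for NSOP₁ theories: a formula `φ(x; b)` dividing along the Morley sequences of one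
global `A`-invariant extension of `tp(b/A)` divides along those of any other one. Otherwise a
sequence realizing the two types in alternation yields arrays of arbitrary finite length, and
conjugating their final segments over the initial ones produces SOP₁ trees.

Now let `(N i, φ i, c i)` be a consistent Kim-forking chain of regular length `κ > |T|`. Pressing
down gives `δ < κ` such that `tp(c δ / N δ)` is finitely satisfiable in the set of those `c j`,
`j < δ`, with `φ j = φ δ`. By Kim's lemma the Morley sequences of the resulting coheir witness
that `φ δ (x, c δ)` Kim-forks, so the instances of `φ δ` at these `c j` are inconsistent, a
contradiction. If a type over `M` Kim-forks over every submodel of size at most `|T|`, such a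
chain of length `|T|⁺` is obtained from Skolem hulls, which gives part (A).

Conversely, an SOP₁ tree in a structure with Skolem functions yields, along any linear order,
columns of two tuples each, such that all tuples from a column on have the same type over the
previous columns, the instances of `φ` at the first entries are consistent and those at the second
entries are pairwise inconsistent. Over the Skolem hull of the columns before a limit position `i`,
the limit of the types of the previous second entries is an invariant extension of the type of the
first entry at `i`, and it witnesses that this instance of `φ` Kim-divides.
-/

namespace KimIndependence

open FirstOrder.Language

section Formulas

variable {L : FirstOrder.Language.{u, v}}

open Classical in
/-- The parameter variables (those of type `δ`) occurring in `φ`. -/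
noncomputable def support {γ δ : Type*} (φ : L.Formula (γ ⊕ δ)) : Finset δ :=
  φ.freeVarFinset.toRight

/-- An enumeration of the parameter variables occurring in `φ`. -/
noncomputable def supportMap {γ δ : Type*} (φ : L.Formula (γ ⊕ δ)) : Fin (support φ).card → δ :=
  fun i => ((support φ).equivFin.symm i : δ)

open Classical in
/-- The formula `φ` with its parameter variables renamed to an initial segment of `ℕ`. It reduces
statements about parameters indexed by an arbitrary type to the notions of the statement, where
parameters are indexed by some `Fin k`. -/
noncomputable def supportFormula {γ δ : Type*} (φ : L.Formula (γ ⊕ δ)) :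
    L.Formula (γ ⊕ Fin (support φ).card) :=
  φ.restrictFreeVar fun x =>
    match x with
    | ⟨Sum.inl c, _⟩ => Sum.inl c
    | ⟨Sum.inr d, h⟩ => Sum.inr ((support φ).equivFin ⟨d, Finset.mem_toRight.2 h⟩)

theorem realize_supportFormula {γ δ N : Type*} [L.Structure N] (φ : L.Formula (γ ⊕ δ)) (b : γ → N)
    (a : δ → N) :
    (supportFormula φ).Realize (Sum.elim b (a ∘ supportMap φ)) ↔ φ.Realize (Sum.elim b a) := by
  classical
  refine BoundedFormula.realize_restrictFreeVar (Sum.elim b a) ?_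
  rintro ⟨c | d, h⟩ <;> simp [supportMap]

/-- The tuple obtained by joining the tuples of the family `b`. -/
def joint {ι U : Type*} {γ : ι → Type*} (b : ∀ i, γ i → U) : (Σ i, γ i) → U :=
  fun p => b p.1 p.2

/-- The formula `∃ x, ⋀ i, φ i (x; y i)` in the joint variables `y`. -/
noncomputable def commonSolution {ι β : Type*} [Finite ι] [Finite β] {γ : ι → Type*}
    (φ : ∀ i, L.Formula (β ⊕ γ i)) : L.Formula (Σ i, γ i) :=
  (Formula.iInf fun i => (φ i).relabel (Sum.elim Sum.inr fun t => Sum.inl ⟨i, t⟩)).iExs β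

theorem realize_commonSolution {N ι β : Type*} [L.Structure N] [Finite ι] [Finite β]
    {γ : ι → Type*} (φ : ∀ i, L.Formula (β ⊕ γ i)) (e : ∀ i, γ i → N) :
    (commonSolution φ).Realize (joint e) ↔
      ∃ x : β → N, ∀ i, (φ i).Realize (Sum.elim x (e i)) := by
  simp only [commonSolution, Formula.realize_iExs, Formula.realize_iInf, Formula.realize_relabel,
    Sum.comp_elim, Sum.elim_comp_inr]
  rfl

theorem exists_realize_of_finite {α : Type w'} (Γ : Set (L.Formula α))
    (h : ∀ s : Finset (L.Formula α), (s : Set (L.Formula α)) ⊆ Γ →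
      ∃ (N : Type w) (_ : L.Structure N) (_ : Nonempty N) (v : α → N), ∀ φ ∈ s, φ.Realize v) :
    ∃ (N : Type (max u v w')) (_ : L.Structure N) (_ : Nonempty N) (v : α → N),
      ∀ φ ∈ Γ, φ.Realize v := by
  classical
  have hsat : Theory.IsSatisfiable (Formula.equivSentence '' Γ : L[[α]].Theory) := by
    rw [Theory.isSatisfiable_iff_isFinitelySatisfiable]
    intro t ht
    obtain ⟨s, hs, rfl⟩ := Finset.subset_set_image_iff.1 ht
    obtain ⟨N, _, _, v, hv⟩ := h s hs
    let := constantsOn.structure v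
    have : N ⊨ ((s.image Formula.equivSentence : Finset _) : L[[α]].Theory) := by
      rw [Theory.model_iff]
      intro φ hφ
      obtain ⟨ψ, hψ, rfl⟩ := Finset.mem_image.1 (Finset.mem_coe.1 hφ)
      rw [Formula.realize_equivSentence]
      exact hv ψ hψ
    exact Theory.Model.isSatisfiable N
  obtain ⟨N⟩ := hsat
  let : L.Structure N := (L.lhomWithConstants α).reduct N
  have : (L.lhomWithConstants α).IsExpansionOn N := LHom.isExpansionOn_reduct _ _
  refine ⟨N, inferInstance, inferInstance, fun a => (L.con a : N), fun φ hφ => ?_⟩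
  rw [← Formula.realize_equivSentence]
  exact N.is_model.realize_of_mem _ ⟨φ, hφ, rfl⟩

theorem realize_relabel_sentence {N α : Type*} [L.Structure N] (σ : L.Sentence) (v : α → N) :
    (Formula.relabel Empty.elim σ).Realize v ↔ N ⊨ σ := by
  rw [Formula.realize_relabel, Subsingleton.elim (v ∘ _) default]
  rfl

theorem exists_model_of_finite {α : Type w'} (T : L.Theory) (Γ : Set (L.Formula α))
    (h : ∀ s : Finset (L.Formula α), (s : Set (L.Formula α)) ⊆ Γ →
      ∃ (N : Type w) (_ : L.Structure N) (_ : Nonempty N) (v : α → N),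
        N ⊨ T ∧ ∀ φ ∈ s, φ.Realize v) :
    ∃ (N : Type (max u v w')) (_ : L.Structure N) (_ : Nonempty N) (v : α → N),
      N ⊨ T ∧ ∀ φ ∈ Γ, φ.Realize v := by
  classical
  obtain ⟨N, _, _, v, hv⟩ := exists_realize_of_finite
    (Γ ∪ (Formula.relabel Empty.elim : L.Sentence → L.Formula α) '' T) (by
      intro s hs
      obtain ⟨N, _, _, v, hT, hv⟩ := h (s.filter (· ∈ Γ)) fun φ hφ => (Finset.mem_filter.1 hφ).2
      refine ⟨N, inferInstance, inferInstance, v, fun φ hφ => ?_⟩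
      rcases hs hφ with hΓ | ⟨σ, hσ, rfl⟩
      · exact hv φ (Finset.mem_filter.2 ⟨hφ, hΓ⟩)
      · exact (realize_relabel_sentence σ v).2 (T.realize_sentence_of_mem hσ))
  exact ⟨N, inferInstance, inferInstance, v,
    ⟨fun σ hσ => (realize_relabel_sentence σ v).1 (hv _ (Or.inr ⟨σ, hσ, rfl⟩))⟩,
    fun φ hφ => hv φ (Or.inl hφ)⟩

end Formulas

section EquivOver

variable {L : FirstOrder.Language.{u, v}} {U : Type w} [L.Structure U] {A B : Set U}
  {β γ δ : Type}

theorem EquivOver.refl (A : Set U) (a : γ → U) : EquivOver (L := L) A a a :=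
  fun _ _ _ _ => Iff.rfl

theorem EquivOver.symm {a b : γ → U} (h : EquivOver (L := L) A a b) : EquivOver (L := L) A b a :=
  fun k φ d hd => (h k φ d hd).symm

theorem EquivOver.trans {a b c : γ → U} (h : EquivOver (L := L) A a b)
    (h' : EquivOver (L := L) A b c) : EquivOver (L := L) A a c :=
  fun k φ d hd => (h k φ d hd).trans (h' k φ d hd)

theorem EquivOver.mono {a b : γ → U} (h : EquivOver (L := L) B a b) (hAB : A ⊆ B) :
    EquivOver (L := L) A a b :=
  fun k φ d hd => h k φ d fun i => hAB (hd i)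

theorem EquivOver.realize_iff {δ : Type*} {a a' : γ → U} (h : EquivOver (L := L) A a a')
    (φ : L.Formula (γ ⊕ δ)) {d : δ → U} (hd : ∀ i, d i ∈ A) :
    φ.Realize (Sum.elim a d) ↔ φ.Realize (Sum.elim a' d) := by
  rw [← realize_supportFormula, ← realize_supportFormula φ]
  exact h _ _ _ fun i => hd _

theorem EquivOver.realize_iff' {a a' : γ → U} (h : EquivOver (L := L) A a a')
    (φ : L.Formula γ) : φ.Realize a ↔ φ.Realize a' := by
  have := h.realize_iff (φ.relabel Sum.inl) (d := Empty.elim) fun i => i.elim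
  simpa only [Formula.realize_relabel, Sum.elim_comp_inl] using this

theorem EquivOver.of_forall {a a' : γ → U} (h : EquivOver (L := L) A a a') {b b' : δ → U}
    (hb : ∀ i, (∃ j, b i = a j ∧ b' i = a' j) ∨ (b i = b' i ∧ b i ∈ A)) :
    EquivOver (L := L) A b b' := by
  have hs : ∀ i, ∃ s : γ ⊕ A,
      b i = Sum.elim a Subtype.val s ∧ b' i = Sum.elim a' Subtype.val s := by
    intro i
    rcases hb i with ⟨j, hj⟩ | ⟨h1, h2⟩
    · exact ⟨Sum.inl j, hj⟩
    · exact ⟨Sum.inr ⟨b i, h2⟩, rfl, h1.symm⟩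
  choose s hs hs' using hs
  intro k φ d hd
  let f : δ ⊕ Fin k → γ ⊕ A := Sum.elim s fun i => Sum.inr ⟨d i, hd i⟩
  have h1 : Sum.elim b d = Sum.elim a Subtype.val ∘ f := by
    ext (i | i)
    exacts [hs i, rfl]
  have h2 : Sum.elim b' d = Sum.elim a' Subtype.val ∘ f := by
    ext (i | i)
    exacts [hs' i, rfl]
  rw [h1, h2, ← Formula.realize_relabel, ← Formula.realize_relabel]
  exact h.realize_iff _ fun i => i.2

theorem EquivOver.comp {a a' : γ → U} (h : EquivOver (L := L) A a a') (f : δ → γ) :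
    EquivOver (L := L) A (a ∘ f) (a' ∘ f) :=
  h.of_forall fun i => Or.inl ⟨f i, rfl, rfl⟩

theorem EquivOver.union_range {a a' : γ → U} {d : δ → U}
    (h : EquivOver (L := L) A (Sum.elim a d) (Sum.elim a' d)) :
    EquivOver (L := L) (A ∪ Set.range d) a a' := by
  intro k φ e he
  have hs : ∀ i, ∃ s : δ ⊕ A, e i = Sum.elim d Subtype.val s := by
    intro i
    rcases he i with hi | ⟨j, hj⟩
    · exact ⟨Sum.inr ⟨e i, hi⟩, rfl⟩
    · exact ⟨Sum.inl j, hj.symm⟩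
  choose s hs using hs
  let f : γ ⊕ Fin k → (γ ⊕ δ) ⊕ A :=
    Sum.elim (Sum.inl ∘ Sum.inl) fun i => (Equiv.sumAssoc γ δ A).symm (Sum.inr (s i))
  have hf : ∀ a : γ → U, Sum.elim a e = Sum.elim (Sum.elim a d) Subtype.val ∘ f := by
    intro a
    ext (i | i)
    · rfl
    · rw [Sum.elim_inr, hs i, Function.comp_apply]
      cases hsi : s i <;> simp [f, hsi]
  rw [hf, hf, ← Formula.realize_relabel, ← Formula.realize_relabel]
  exact h.realize_iff _ fun i => i.2

theorem EquivOver.exists_solution {ι : Type} [Finite ι] [Finite β] {γ : ι → Type}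
    {e e' : ∀ i, γ i → U} (h : EquivOver (L := L) A (joint e) (joint e'))
    (φ : ∀ i, L.Formula (β ⊕ γ i)) (he : ∃ x : β → U, ∀ i, (φ i).Realize (Sum.elim x (e i))) :
    ∃ x : β → U, ∀ i, (φ i).Realize (Sum.elim x (e' i)) := by
  rw [← realize_commonSolution] at he ⊢
  exact (h.realize_iff' _).1 he

end EquivOver

section Saturated

variable {L : FirstOrder.Language.{u, v}} {U : Type w} [L.Structure U] {μ : Cardinal.{w}}

theorem IsSaturated.mono {μ' : Cardinal.{w}} (hU : IsSaturated L U μ) (h : μ' ≤ μ) :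
    IsSaturated L U μ' :=
  fun A hA => hU A (hA.trans_le h)

theorem IsSaturated.exists_realize (hU : IsSaturated L U μ) {β : Type} [Finite β] {ι : Type*}
    {A : Set U} (hA : #A < μ) {γ : ι → Type*} (φ : ∀ i, L.Formula (β ⊕ γ i))
    (e : ∀ i, γ i → U) (he : ∀ i t, e i t ∈ A)
    (hfin : ∀ (m : ℕ) (f : Fin m → ι), ∃ b : β → U, ∀ j, (φ (f j)).Realize (Sum.elim b (e (f j)))) :
    ∃ b : β → U, ∀ i, (φ i).Realize (Sum.elim b (e i)) := by
  classical
  obtain ⟨n, ⟨ε⟩⟩ := Finite.exists_equiv_fin β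
  let χ : ι → L[[A]].Formula (Fin n) := fun i =>
    BoundedFormula.constantsVarsEquiv.symm
      ((φ i).relabel (Sum.elim (Sum.inr ∘ ε) (Sum.inl ∘ fun t => (⟨e i t, he i t⟩ : A))))
  have hχ : ∀ i (a : Fin n → U), (χ i).Realize a ↔ (φ i).Realize (Sum.elim (a ∘ ε) (e i)) := by
    intro i a
    rw [Formula.Realize, ← BoundedFormula.realize_constantsVarsEquiv, Equiv.apply_symm_apply,
      ← Formula.Realize, Formula.realize_relabel, Sum.comp_elim, ← Function.comp_assoc,
      Sum.elim_comp_inr]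
    rfl
  obtain ⟨a, ha⟩ := hU A hA n (Set.range χ) (by
    intro s hs
    rw [← Set.image_univ] at hs
    obtain ⟨t, -, rfl⟩ := Finset.subset_set_image_iff.1 hs
    obtain ⟨b, hb⟩ := hfin t.card fun j => t.equivFin.symm j
    refine ⟨b ∘ ε.symm, fun ψ hψ => ?_⟩
    obtain ⟨i, hi, rfl⟩ := Finset.mem_image.1 hψ
    have := hb (t.equivFin ⟨i, hi⟩)
    rw [Equiv.symm_apply_apply] at this
    rwa [hχ, Function.comp_assoc, Equiv.symm_comp_self])
  exact ⟨a ∘ ε, fun i => (hχ i a).1 (ha _ ⟨i, rfl⟩)⟩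

theorem mk_union_lt_of_finite {α : Type w} {μ : Cardinal.{w}} (hμ : ℵ₀ ≤ μ) {A B : Set α}
    (hA : #A < μ) (hB : B.Finite) : #(A ∪ B : Set α) < μ :=
  (Cardinal.mk_union_le A B).trans_lt
    (Cardinal.add_lt_of_lt hμ hA ((Cardinal.lt_aleph0_iff_set_finite.2 hB).trans_le hμ))

theorem EquivOver.exists_extend (hU : IsSaturated L U μ) (hμ : ℵ₀ ≤ μ) {A : Set U} (hA : #A < μ)
    {γ δ : Type} [Finite γ] [Finite δ] {a a' : γ → U} (h : EquivOver (L := L) A a a')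
    (t : δ → U) : ∃ t' : δ → U, EquivOver (L := L) A (Sum.elim a t) (Sum.elim a' t') := by
  let e : (γ → U) → ∀ p : Σ k, L.Formula ((γ ⊕ δ) ⊕ Fin k) × (Fin k → A), γ ⊕ Fin p.1 → U :=
    fun c p => Sum.elim c fun i => p.2.2 i
  let ψ : ∀ p : Σ k, L.Formula ((γ ⊕ δ) ⊕ Fin k) × (Fin k → A), L.Formula (δ ⊕ (γ ⊕ Fin p.1)) :=
    fun p => p.2.1.relabel
      (Sum.elim (Sum.elim (Sum.inr ∘ Sum.inl) Sum.inl) (Sum.inr ∘ Sum.inr))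
  have hψ : ∀ c s p, (ψ p).Realize (Sum.elim s (e c p)) ↔
      p.2.1.Realize (Sum.elim (Sum.elim c s) fun i => (p.2.2 i : U)) := by
    intro c s p
    simp only [ψ, e, Formula.realize_relabel, Sum.comp_elim, ← Function.comp_assoc,
      Sum.elim_comp_inr, Sum.elim_comp_inl]
  obtain ⟨t', ht'⟩ := hU.exists_realize (β := δ) (A := A ∪ Set.range a')
    (mk_union_lt_of_finite hμ hA (Set.finite_range a'))
    (ι := {p // (ψ p).Realize (Sum.elim t (e a p))}) (fun p => ψ p) (fun p => e a' p)
    (fun p => Sum.rec (fun i => Or.inr ⟨i, rfl⟩) fun i => Or.inl (p.1.2.2 i).2) (by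
      intro m f
      have hf : EquivOver (L := L) A (joint fun j => e a (f j)) (joint fun j => e a' (f j)) :=
        h.of_forall fun
          | ⟨_, Sum.inl i⟩ => Or.inl ⟨i, rfl, rfl⟩
          | ⟨j, Sum.inr i⟩ => Or.inr ⟨rfl, ((f j).1.2.2 i).2⟩
      exact hf.exists_solution (fun j => ψ (f j)) ⟨t, fun j => (f j).2⟩)
  have himp : ∀ k (φ : L.Formula ((γ ⊕ δ) ⊕ Fin k)) (d : Fin k → U), (∀ i, d i ∈ A) →
      φ.Realize (Sum.elim (Sum.elim a t) d) → φ.Realize (Sum.elim (Sum.elim a' t') d) := by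
    intro k φ d hd hφ
    let p : Σ k, L.Formula ((γ ⊕ δ) ⊕ Fin k) × (Fin k → A) := ⟨k, φ, fun i => ⟨d i, hd i⟩⟩
    exact (hψ a' t' p).1 (ht' ⟨p, (hψ a t p).2 hφ⟩)
  exact ⟨t', fun k φ d hd =>
    ⟨himp k φ d hd, fun h' => of_not_not fun hn => himp k φ.not d hd hn h'⟩⟩

end Saturated

section GlobalTypes

variable {L : FirstOrder.Language.{u, v}} {U : Type w}

theorem realize_plug {N : Type*} [L.Structure N] [L[[U]].Structure N]
    [(L.lhomWithConstants U).IsExpansionOn N] {α γ : Type} (φ : L.Formula (α ⊕ γ)) (e : γ → U)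
    (v : α → N) :
    (plug φ e).Realize v ↔ φ.Realize (Sum.elim v fun i => (L.con (e i) : N)) := by
  rw [plug, Formula.Realize, ← BoundedFormula.realize_constantsVarsEquiv, Equiv.apply_symm_apply,
    ← Formula.Realize, Formula.realize_relabel, Sum.comp_elim, Sum.elim_comp_inr]
  rfl

variable [L.Structure U] {β : Type}

theorem exists_realization (q : (L.elementaryDiagram U).CompleteType β) :
    ∃ (N : Type (max u v w)) (_ : L.Structure N) (g : U ↪ₑ[L] N) (v : β → N),
      ∀ {γ : Type} (φ : L.Formula (β ⊕ γ)) (e : γ → U),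
        Has q φ e ↔ φ.Realize (Sum.elim v (g ∘ e)) := by
  obtain ⟨N, v, rfl⟩ := (L.elementaryDiagram U).exists_modelType_is_realized_in q
  let : L.Structure N := (L.lhomWithConstants U).reduct N
  have : (L.lhomWithConstants U).IsExpansionOn N := LHom.isExpansionOn_reduct _ _
  refine ⟨N, inferInstance, ElementaryEmbedding.ofModelsElementaryDiagram L U N, v,
    fun φ e => ?_⟩
  rw [Has, Theory.CompleteType.formula_mem_typeOf, realize_plug]
  rfl

variable {q : (L.elementaryDiagram U).CompleteType β}

theorem has_not {γ : Type} (φ : L.Formula (β ⊕ γ)) (e : γ → U) : Has q φ.not e ↔ ¬Has q φ e := by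
  obtain ⟨N, _, g, v, h⟩ := exists_realization q
  rw [h, h, Formula.realize_not]

theorem has_supportFormula {γ : Type} (φ : L.Formula (β ⊕ γ)) (e : γ → U) :
    Has q (supportFormula φ) (e ∘ supportMap φ) ↔ Has q φ e := by
  obtain ⟨N, _, g, v, h⟩ := exists_realization q
  rw [h, h, ← realize_supportFormula φ]
  rfl

theorem exists_realize_of_has [Finite β] {ι : Type} [Finite ι] {γ : ι → Type}
    {φ : ∀ i, L.Formula (β ⊕ γ i)} {e : ∀ i, γ i → U} (h : ∀ i, Has q (φ i) (e i)) :
    ∃ b : β → U, ∀ i, (φ i).Realize (Sum.elim b (e i)) := by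
  obtain ⟨N, _, g, v, hq⟩ := exists_realization q
  have hN : (commonSolution φ).Realize (g ∘ joint e) :=
    (realize_commonSolution φ fun i => g ∘ e i).2 ⟨v, fun i => (hq _ _).1 (h i)⟩
  rwa [g.map_formula, realize_commonSolution] at hN

variable [Nonempty U]

theorem exists_has_iff_eventually (D : Ultrafilter (β → U)) :
    ∃ q : (L.elementaryDiagram U).CompleteType β, ∀ {γ : Type} (φ : L.Formula (β ⊕ γ)) (e : γ → U),
      Has q φ e ↔ ∀ᶠ b in D, φ.Realize (Sum.elim b e) := by
  let N := (D : Filter (β → U)).Product fun _ => U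
  let str : L[[U]].Structure N := Ultraproduct.structure
  have hN : N ⊨ L.elementaryDiagram U := by
    rw [Theory.model_iff]
    intro φ hφ
    exact (Ultraproduct.sentence_realize φ).2 (Filter.Eventually.of_forall fun _ => hφ)
  have : Nonempty N := Ultraproduct.Product.instNonempty
  let v : β → N := fun j => ((fun b => b j : (β → U) → U) : N)
  refine ⟨(L.elementaryDiagram U).typeOf v, fun φ e => ?_⟩
  rw [Has, Theory.CompleteType.formula_mem_typeOf]
  refine (Ultraproduct.realize_formula_cast (plug φ e) (fun j (b : β → U) => b j)).trans ?_
  exact Filter.eventually_congr (Filter.Eventually.of_forall fun b => realize_plug φ e b)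

/-- The limit of the types of `b` over `U` as `b` tends along the ultrafilter `D`. Those of the
ultrafilters concentrating on tuples from `A` are the global types finitely satisfiable in `A`. -/
noncomputable def limitType (L : FirstOrder.Language.{u, v}) [L.Structure U]
    (D : Ultrafilter (β → U)) : (L.elementaryDiagram U).CompleteType β :=
  (exists_has_iff_eventually D).choose

theorem has_limitType (D : Ultrafilter (β → U)) {γ : Type} (φ : L.Formula (β ⊕ γ)) (e : γ → U) :
    Has (limitType L D) φ e ↔ ∀ᶠ b in D, φ.Realize (Sum.elim b e) :=
  (exists_has_iff_eventually D).choose_spec φ e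

end GlobalTypes

section RealizesOver

variable {L : FirstOrder.Language.{u, v}} {U : Type w} [L.Structure U] {β : Type}
  {q : (L.elementaryDiagram U).CompleteType β} {A C : Set U}

theorem RealizesOver.mono {b : β → U} (h : RealizesOver C q b) (hA : A ⊆ C) :
    RealizesOver A q b :=
  fun k φ e he => h k φ e fun i => hA (he i)

theorem RealizesOver.equivOver {b b' : β → U} (h : RealizesOver A q b)
    (h' : RealizesOver A q b') : EquivOver (L := L) A b b' :=
  fun k φ e he => (h k φ e he).symm.trans (h' k φ e he)

theorem RealizesOver.has_iff {b : β → U} (h : RealizesOver C q b) {γ : Type}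
    (φ : L.Formula (β ⊕ γ)) {e : γ → U} (he : ∀ i, e i ∈ C) :
    Has q φ e ↔ φ.Realize (Sum.elim b e) := by
  rw [← has_supportFormula, ← realize_supportFormula]
  exact h _ _ _ fun i => he _

theorem IsInvariant.has_iff (hq : IsInvariant A q) {γ : Type} (φ : L.Formula (β ⊕ γ))
    {e e' : γ → U} (h : EquivOver (L := L) A e e') : Has q φ e ↔ Has q φ e' := by
  rw [← has_supportFormula, ← has_supportFormula φ]
  exact hq _ _ _ _ (h.comp _)

theorem EquivOver.sumElim_of_realizesOver (hq : IsInvariant A q) {γ : Type} {a a' : γ → U}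
    (h : EquivOver (L := L) A a a') {b b' : β → U} (hb : RealizesOver (A ∪ Set.range a) q b)
    (hb' : RealizesOver (A ∪ Set.range a') q b') :
    EquivOver (L := L) A (Sum.elim a b) (Sum.elim a' b') := by
  intro k φ d hd
  let ψ : L.Formula (β ⊕ (γ ⊕ Fin k)) :=
    φ.relabel (Sum.elim (Sum.elim (Sum.inr ∘ Sum.inl) Sum.inl) (Sum.inr ∘ Sum.inr))
  have hψ : ∀ (b : β → U) (a : γ → U),
      ψ.Realize (Sum.elim b (Sum.elim a d)) ↔ φ.Realize (Sum.elim (Sum.elim a b) d) := by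
    intro b a
    simp only [ψ, Formula.realize_relabel, Sum.comp_elim, ← Function.comp_assoc,
      Sum.elim_comp_inr, Sum.elim_comp_inl]
  have had : EquivOver (L := L) A (Sum.elim a d) (Sum.elim a' d) :=
    h.of_forall (Sum.rec (fun i => Or.inl ⟨i, rfl, rfl⟩) fun i => Or.inr ⟨rfl, hd i⟩)
  rw [← hψ, ← hψ, ← hb.has_iff ψ (Sum.rec (fun i => Or.inr ⟨i, rfl⟩) fun i => Or.inl (hd i)),
    ← hb'.has_iff ψ (Sum.rec (fun i => Or.inr ⟨i, rfl⟩) fun i => Or.inl (hd i))]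
  exact hq.has_iff ψ had

theorem exists_realizesOver [Finite β] {μ : Cardinal.{w}} (hU : IsSaturated L U μ) (hC : #C < μ)
    (q : (L.elementaryDiagram U).CompleteType β) : ∃ b, RealizesOver C q b := by
  obtain ⟨b, hb⟩ := hU.exists_realize (β := β) hC
    (ι := {p : Σ k : ℕ, L.Formula (β ⊕ Fin k) × (Fin k → C) //
      Has q p.2.1 fun i => (p.2.2 i : U)})
    (γ := fun p => Fin p.1.1) (fun p => p.1.2.1) (fun p i => (p.1.2.2 i : U))
    (fun p i => (p.1.2.2 i).2) fun m f => exists_realize_of_has fun j => (f j).2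
  have himp : ∀ (k : ℕ) (φ : L.Formula (β ⊕ Fin k)) (e : Fin k → U), (∀ i, e i ∈ C) →
      Has q φ e → φ.Realize (Sum.elim b e) :=
    fun k φ e he h => hb ⟨⟨k, φ, fun i => ⟨e i, he i⟩⟩, h⟩
  exact ⟨b, fun k φ e he => ⟨himp k φ e he, fun h => of_not_not fun hn =>
    himp k φ.not e he ((has_not φ e).2 hn) h⟩⟩

end RealizesOver

section RealizesAlong

variable {L : FirstOrder.Language.{u, v}} {U : Type w} [L.Structure U] {β : Type} {A : Set U}

/-- Each term of the family `b`, indexed by a linear order, realizes the corresponding global type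
over `A` and the previous terms. Morley sequences over `A` are the case of a constant family of
types along `ℕ`. -/
def RealizesAlong {ι : Type*} [LT ι] (A : Set U)
    (ρ : ι → (L.elementaryDiagram U).CompleteType β) (b : ι → β → U) : Prop :=
  ∀ i, RealizesOver (A ∪ ⋃ j < i, Set.range (b j)) (ρ i) (b i)

theorem RealizesAlong.mono {ι : Type*} [LT ι] {C : Set U}
    {ρ : ι → (L.elementaryDiagram U).CompleteType β} {b : ι → β → U} (h : RealizesAlong C ρ b)
    (hA : A ⊆ C) : RealizesAlong A ρ b :=
  fun i => (h i).mono (Set.union_subset_union_left _ hA)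

theorem RealizesAlong.comp {ι κ : Type*} [Preorder ι] [Preorder κ]
    {ρ : ι → (L.elementaryDiagram U).CompleteType β} {b : ι → β → U} (h : RealizesAlong A ρ b)
    {f : κ → ι} (hf : StrictMono f) : RealizesAlong A (ρ ∘ f) (b ∘ f) := by
  intro i
  refine (h (f i)).mono (Set.union_subset_union_right _ (Set.iUnion₂_subset fun j hj => ?_))
  exact Set.subset_biUnion_of_mem (u := fun j => Set.range (b j)) (hf hj)

theorem RealizesAlong.comp_union_range {ι κ : Type*} [Preorder ι] [Preorder κ]
    {ρ : ι → (L.elementaryDiagram U).CompleteType β} {b : ι → β → U} (h : RealizesAlong A ρ b)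
    {f : κ → ι} (hf : StrictMono f) {j : ι} (hj : ∀ i, j < f i) :
    RealizesAlong (A ∪ Set.range (b j)) (ρ ∘ f) (b ∘ f) := by
  intro i
  refine (h (f i)).mono (Set.union_subset (Set.union_subset_union_right _ ?_)
    (Set.subset_union_of_subset_right (Set.iUnion₂_subset fun k hk => ?_) _))
  · exact Set.subset_biUnion_of_mem (u := fun j => Set.range (b j)) (hj i)
  · exact Set.subset_biUnion_of_mem (u := fun j => Set.range (b j)) (hf hk)

theorem RealizesAlong.equivOver {ι : Type} [LinearOrder ι] [Finite ι]
    {ρ : ι → (L.elementaryDiagram U).CompleteType β} (hρ : ∀ i, IsInvariant A (ρ i)) {γ : Type}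
    {a a' : γ → U} (ha : EquivOver (L := L) A a a') {b b' : ι → β → U}
    (hb : RealizesAlong (A ∪ Set.range a) ρ b) (hb' : RealizesAlong (A ∪ Set.range a') ρ b') :
    EquivOver (L := L) A (Sum.elim a (joint b)) (Sum.elim a' (joint b')) := by
  have := Fintype.ofFinite ι
  suffices h : ∀ s : Finset ι, EquivOver (L := L) A (Sum.elim a (joint fun i : s => b i))
      (Sum.elim a' (joint fun i : s => b' i)) from
    (h Finset.univ).of_forall fun
      | Sum.inl i => Or.inl ⟨Sum.inl i, rfl, rfl⟩
      | Sum.inr ⟨i, t⟩ => Or.inl ⟨Sum.inr ⟨⟨i, Finset.mem_univ i⟩, t⟩, rfl, rfl⟩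
  intro s
  induction s using Finset.induction_on_max with
  | empty => exact ha.of_forall fun
      | Sum.inl i => Or.inl ⟨i, rfl, rfl⟩
      | Sum.inr p => absurd p.1.2 (Finset.notMem_empty _)
  | insert i s hs ih =>
    have hsub : ∀ (a : γ → U) (b : ι → β → U), A ∪ Set.range (Sum.elim a (joint fun j : s => b j)) ⊆
        A ∪ Set.range a ∪ ⋃ j < i, Set.range (b j) := by
      rintro a b x (hx | ⟨j | ⟨j, t⟩, rfl⟩)
      · exact Or.inl (Or.inl hx)
      · exact Or.inl (Or.inr ⟨j, rfl⟩)
      · exact Or.inr (Set.mem_iUnion₂.2 ⟨j, hs j j.2, t, rfl⟩)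
    refine (ih.sumElim_of_realizesOver (hρ i) ((hb i).mono (hsub a b))
      ((hb' i).mono (hsub a' b'))).of_forall ?_
    rintro (j | ⟨⟨j, hj⟩, t⟩)
    · exact Or.inl ⟨Sum.inl (Sum.inl j), rfl, rfl⟩
    · rcases Finset.mem_insert.1 hj with rfl | hj
      · exact Or.inl ⟨Sum.inr t, rfl, rfl⟩
      · exact Or.inl ⟨Sum.inl (Sum.inr ⟨⟨j, hj⟩, t⟩), rfl, rfl⟩

theorem RealizesAlong.equivOver_of_lt {ι : Type} [LinearOrder ι]
    {ρ : ι → (L.elementaryDiagram U).CompleteType β} (hρ : ∀ i, IsInvariant A (ρ i))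
    {b : ι → β → U} (hb : RealizesAlong A ρ b) {i i' : ι} (h : EquivOver (L := L) A (b i) (b i'))
    (s : Set ι) [Finite s] (hs : ∀ t ∈ s, i < t ∧ i' < t) :
    EquivOver (L := L) (A ∪ ⋃ t ∈ s, Set.range (b t)) (b i) (b i') := by
  have hmono : StrictMono (Subtype.val : s → ι) := fun _ _ h => h
  refine (RealizesAlong.equivOver (fun t : s => hρ t) h
    (hb.comp_union_range hmono fun t => (hs t t.2).1)
    (hb.comp_union_range hmono fun t => (hs t t.2).2)).union_range.mono
      (Set.union_subset_union_right _ (Set.iUnion₂_subset fun t ht => ?_))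
  rintro _ ⟨j, rfl⟩
  exact ⟨⟨⟨t, ht⟩, j⟩, rfl⟩

theorem exists_realizesAlong [Finite β] {μ : Cardinal.{w}} (hU : IsSaturated L U μ)
    (hμ : ℵ₀ ≤ μ) (hA : #A < μ) (ρ : ℕ → (L.elementaryDiagram U).CompleteType β) :
    ∃ b : ℕ → β → U, RealizesAlong A ρ b := by
  have hex : ∀ i (c : ∀ j < i, β → U),
      ∃ b, RealizesOver (A ∪ ⋃ j, ⋃ h : j < i, Set.range (c j h)) (ρ i) b := by
    intro i c
    refine exists_realizesOver hU (mk_union_lt_of_finite hμ hA ?_) _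
    exact (Set.finite_lt_nat i).biUnion' fun j hj => Set.finite_range _
  choose F hF using hex
  let b : ℕ → β → U := fun i => Nat.strongRec (fun i c => F i c) i
  have hb : ∀ i, b i = F i fun j _ => b j := by
    intro i
    simp only [b]
    rw [Nat.strongRec]
  exact ⟨b, fun i => by rw [hb i]; exact hF i fun j _ => b j⟩

end RealizesAlong

section Tree

variable {L : FirstOrder.Language.{u, v}} {U : Type w} [L.Structure U] {β : Type} {Z : Set U}
  {c : ℕ → Bool → β → U} {k : ℕ}

/-- The tuples `e η` form a tree of height `k` which copies the array `c` over `Z`: every branch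
looks like the row `c · false`, and when a node `η ⌢ 1` is joined to a branch through `η ⌢ 0` it
looks like the corresponding entry of the row `c · true`. The level of `c j` is `j + 1`; the value
of `e` at the root is irrelevant. -/
structure IsTreeOf (L : FirstOrder.Language.{u, v}) [L.Structure U] (Z : Set U)
    (c : ℕ → Bool → β → U) (k : ℕ) (e : List Bool → β → U) : Prop where
  branch : ∀ η : List Bool, η.length = k →
    EquivOver (L := L) Z (joint fun i : Fin k => e (η.take (i + 1)))
      (joint fun i : Fin k => c i false)
  fork : ∀ η ν : List Bool, ν.length = k → (η ++ [false]) <+: ν →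
    EquivOver (L := L) Z (Sum.elim (e (η ++ [true])) (joint fun i : Fin k => e (ν.take (i + 1))))
      (Sum.elim (c η.length true) (joint fun i : Fin k => c i false))

theorem IsTreeOf.congr {e e' : List Bool → β → U} (h : IsTreeOf L Z c k e)
    (he : ∀ η ≠ [], e η = e' η) : IsTreeOf L Z c k e' := by
  have htake : ∀ η : List Bool, η.length = k →
      (fun i : Fin k => e (η.take (i + 1))) = fun i : Fin k => e' (η.take (i + 1)) := by
    refine fun η hη => funext fun i => he _ (List.ne_nil_of_length_pos ?_)
    rw [List.length_take]
    omega
  refine ⟨fun η hη => ?_, fun η ν hν hην => ?_⟩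
  · exact htake η hη ▸ h.branch η hη
  · exact htake ν hν ▸ he (η ++ [true]) (by simp) ▸ h.fork η ν hν hην

theorem IsTreeOf.branch_of_root {e : List Bool → β → U}
    (h : IsTreeOf L (Z ∪ ⋃ b, Set.range (c 0 b)) (fun j => c (j + 1)) k e) (he : e [] = c 0 false)
    {η : List Bool} (hη : η.length = k) :
    EquivOver (L := L) (Z ∪ ⋃ b, Set.range (c 0 b)) (joint fun i : Fin (k + 1) => e (η.take i))
      (joint fun i : Fin (k + 1) => c i false) := by
  refine (h.branch η hη).of_forall ?_
  rintro ⟨i, t⟩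
  cases i using Fin.cases with
  | zero =>
    have ht : joint (fun i : Fin (k + 1) => e (η.take i)) ⟨0, t⟩ = c 0 false t := congrFun he t
    exact Or.inr ⟨ht, Or.inr (Set.mem_iUnion.2 ⟨false, t, ht.symm⟩)⟩
  | succ i => exact Or.inl ⟨⟨i, t⟩, rfl, rfl⟩

theorem IsTreeOf.fork_of_root {e : List Bool → β → U}
    (h : IsTreeOf L (Z ∪ ⋃ b, Set.range (c 0 b)) (fun j => c (j + 1)) k e) (he : e [] = c 0 false)
    {η ν : List Bool} (hν : ν.length = k) (hην : (η ++ [false]) <+: ν) :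
    EquivOver (L := L) Z
      (Sum.elim (e (η ++ [true])) (joint fun i : Fin (k + 1) => e (ν.take i)))
      (Sum.elim (c (η.length + 1) true) (joint fun i : Fin (k + 1) => c i false)) := by
  refine EquivOver.mono ((h.fork η ν hν hην).of_forall ?_) Set.subset_union_left
  rintro (t | ⟨i, t⟩)
  · exact Or.inl ⟨Sum.inl t, rfl, rfl⟩
  · cases i using Fin.cases with
    | zero =>
      have ht : joint (fun i : Fin (k + 1) => e (ν.take i)) ⟨0, t⟩ = c 0 false t := congrFun he t
      exact Or.inr ⟨ht, Or.inr (Set.mem_iUnion.2 ⟨false, t, ht.symm⟩)⟩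
    | succ i => exact Or.inl ⟨Sum.inr ⟨i, t⟩, rfl, rfl⟩

/-- The tree whose subtrees above the two successors of the root are `E false` and `E true`. -/
def graft (r : β → U) (E : Bool → List Bool → β → U) : List Bool → β → U
  | [] => r
  | b :: η => E b η

theorem IsTreeOf.graft {E : Bool → List Bool → β → U} (r : β → U)
    (h : IsTreeOf L (Z ∪ ⋃ b, Set.range (c 0 b)) (fun j => c (j + 1)) k (E false))
    (hE : ∀ b, E b [] = c 0 b)
    (hS : EquivOver (L := L) Z (joint fun η : {η : List Bool // η.length ≤ k} => E false η)
      (joint fun η : {η : List Bool // η.length ≤ k} => E true η)) :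
    IsTreeOf L Z c (k + 1) (graft r E) := by
  refine ⟨fun η hη => ?_, fun η ν hν hην => ?_⟩
  · obtain ⟨b, η, rfl⟩ := List.exists_cons_of_length_eq_add_one hη
    have hη' : η.length = k := by simpa using hη
    have hfalse := (h.branch_of_root (hE false) hη').mono Set.subset_union_left
    cases b
    · exact hfalse
    · refine EquivOver.trans (hS.symm.of_forall ?_) hfalse
      rintro ⟨i, t⟩
      exact Or.inl ⟨⟨⟨η.take i, by simp [hη']⟩, t⟩, rfl, rfl⟩
  · obtain ⟨b, ν, rfl⟩ := List.exists_cons_of_length_eq_add_one hν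
    have hν' : ν.length = k := by simpa using hν
    rcases η with _ | ⟨b', η⟩
    · obtain rfl : b = false := (List.cons_prefix_cons.1 hην).1.symm
      refine EquivOver.mono ((h.branch_of_root (hE false) hν').of_forall ?_)
        Set.subset_union_left
      rintro (t | p)
      · have ht : KimIndependence.graft r E [true] t = c 0 true t := congrFun (hE true) t
        exact Or.inr ⟨ht, Or.inr (Set.mem_iUnion.2 ⟨true, t, ht.symm⟩)⟩
      · exact Or.inl ⟨p, rfl, rfl⟩
    · obtain ⟨rfl, hην'⟩ : b' = b ∧ (η ++ [false]) <+: ν := List.cons_prefix_cons.1 hην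
      have hfalse := h.fork_of_root (hE false) hν' hην'
      have hlen : η.length + 1 ≤ k := by simpa [hν'] using hην'.length_le
      cases b'
      · exact hfalse
      · refine EquivOver.trans (hS.symm.of_forall ?_) hfalse
        rintro (t | ⟨i, t⟩)
        · exact Or.inl ⟨⟨⟨η ++ [true], by simpa using hlen⟩, t⟩, rfl, rfl⟩
        · exact Or.inl ⟨⟨⟨ν.take i, by simp [hν']⟩, t⟩, rfl, rfl⟩

theorem exists_isTreeOf {μ : Cardinal.{w}} (hU : IsSaturated L U μ) (hμ : ℵ₀ ≤ μ) [Finite β]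
    (hZ : #Z < μ)
    (hc : ∀ j < k, EquivOver (L := L) (Z ∪ ⋃ i < j, ⋃ b, Set.range (c i b)) (c j false)
      (c j true)) :
    ∃ e, IsTreeOf L Z c k e := by
  induction k generalizing Z c with
  | zero =>
    refine ⟨fun _ => c 0 false, fun η _ => ?_, fun η ν hν hην => ?_⟩
    · exact (EquivOver.refl Z (c 0 false)).of_forall fun p => p.1.elim0
    · simpa [hν] using hην.length_le
  | succ k ih =>
    have hZ' : #(Z ∪ ⋃ b, Set.range (c 0 b) : Set U) < μ :=
      mk_union_lt_of_finite hμ hZ (Set.finite_iUnion fun b => Set.finite_range _)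
    obtain ⟨e, he⟩ := ih (c := fun j => c (j + 1)) hZ' fun j hj => (hc (j + 1) (by omega)).mono (by
      rw [Set.union_assoc]
      refine Set.union_subset_union_right _ (Set.union_subset ?_ ?_)
      · exact Set.subset_biUnion_of_mem (u := fun i => ⋃ b, Set.range (c i b)) (Nat.succ_pos j)
      · exact Set.iUnion₂_subset fun i hi => Set.subset_biUnion_of_mem
          (u := fun i => ⋃ b, Set.range (c i b)) (Nat.succ_lt_succ hi))
    have hroot : EquivOver (L := L) Z (c 0 false) (c 0 true) :=
      (hc 0 (Nat.succ_pos k)).mono Set.subset_union_left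
    have : Finite {η : List Bool // η.length ≤ k} := (List.finite_length_le Bool k).to_subtype
    -- The subtree above `1` is a conjugate over `Z` of the one above `0`.
    obtain ⟨t, ht⟩ := hroot.exists_extend hU hμ hZ
      (joint fun η : {η : List Bool // η.length ≤ k} => e η)
    let E : Bool → List Bool → β → U := fun
      | b, [] => c 0 b
      | false, a :: η => e (a :: η)
      | true, a :: η => fun s => if h : (a :: η).length ≤ k then t ⟨⟨a :: η, h⟩, s⟩ else c 0 true s
    refine ⟨graft (c 0 false) E, IsTreeOf.graft _ (he.congr ?_) (fun b => by cases b <;> rfl)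
      (ht.of_forall ?_)⟩
    · rintro (_ | ⟨a, η⟩) hη
      exacts [absurd rfl hη, rfl]
    · rintro ⟨⟨_ | ⟨a, η⟩, hη⟩, s⟩
      · exact Or.inl ⟨Sum.inl s, rfl, rfl⟩
      · exact Or.inl ⟨Sum.inr ⟨⟨a :: η, hη⟩, s⟩, rfl, dif_pos hη⟩

end Tree

section SOP

variable {L : FirstOrder.Language.{u, v}} {β β' : Type}

/-- The tuples `a η` with `η` of length at most `K` witness SOP₁ for `φ` up to the level `K`. -/
def IsSOP1Tree {N : Type*} [L.Structure N] (φ : L.Formula (β' ⊕ β)) (K : ℕ)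
    (a : List Bool → β → N) : Prop :=
  (∀ η : List Bool, η.length ≤ K →
    ∃ x : β' → N, ∀ i : Fin (η.length + 1), φ.Realize (Sum.elim x (a (η.take i)))) ∧
  ∀ η ν : List Bool, ν.length ≤ K → (η ++ [false]) <+: ν →
    ¬∃ x : β' → N, φ.Realize (Sum.elim x (a ν)) ∧ φ.Realize (Sum.elim x (a (η ++ [true])))

theorem IsSOP1Tree.mono {N : Type*} [L.Structure N] {φ : L.Formula (β' ⊕ β)} {K K' : ℕ}
    {a : List Bool → β → N} (h : IsSOP1Tree φ K' a) (hK : K ≤ K') : IsSOP1Tree φ K a :=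
  ⟨fun η hη => h.1 η (hη.trans hK), fun η ν hν => h.2 η ν (hν.trans hK)⟩

/-- A formula saying that the tuples `a η` form an SOP₁ tree of height `K` for `φ`. -/
noncomputable def sop1TreeFormula [Finite β'] (φ : L.Formula (β' ⊕ β)) (K : ℕ) :
    L.Formula (Σ _ : List Bool, β) :=
  have : Finite {η : List Bool // η.length ≤ K} := (List.finite_length_le Bool K).to_subtype
  (Formula.iInf fun η : {η : List Bool // η.length ≤ K} =>
    (commonSolution fun _ : Fin (η.1.length + 1) => φ).relabel
      fun p => (⟨η.1.take p.1, p.2⟩ : Σ _ : List Bool, β)) ⊓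
  Formula.iInf fun p : {p : {η : List Bool // η.length ≤ K} × {η : List Bool // η.length ≤ K} //
      (p.1.1 ++ [false]) <+: p.2.1} =>
    (commonSolution fun _ : Bool => φ).not.relabel
      fun q => (⟨bif q.1 then p.1.2.1 else p.1.1.1 ++ [true], q.2⟩ : Σ _ : List Bool, β)

theorem realize_sop1TreeFormula {N : Type*} [L.Structure N] [Finite β'] (φ : L.Formula (β' ⊕ β))
    (K : ℕ) (a : List Bool → β → N) :
    (sop1TreeFormula φ K).Realize (joint a) ↔ IsSOP1Tree φ K a := by
  have hbranch : ∀ η : List Bool, (commonSolution fun _ : Fin (η.length + 1) => φ).Realize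
        (joint a ∘ fun p => (⟨η.take p.1, p.2⟩ : Σ _ : List Bool, β)) ↔
      ∃ x : β' → N, ∀ i : Fin (η.length + 1), φ.Realize (Sum.elim x (a (η.take i))) :=
    fun η => realize_commonSolution _ fun i : Fin (η.length + 1) => a (η.take i)
  have hpair : ∀ η ν : List Bool, (commonSolution fun _ : Bool => φ).Realize
        (joint a ∘ fun q => (⟨bif q.1 then ν else η ++ [true], q.2⟩ : Σ _ : List Bool, β)) ↔
      ∃ x : β' → N, φ.Realize (Sum.elim x (a ν)) ∧ φ.Realize (Sum.elim x (a (η ++ [true]))) := by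
    intro η ν
    refine (realize_commonSolution _ fun b : Bool => a (bif b then ν else η ++ [true])).trans ?_
    simp only [Bool.forall_bool, cond_true, cond_false, and_comm]
  simp only [sop1TreeFormula, Formula.realize_inf, Formula.realize_iInf, Formula.realize_relabel,
    Formula.realize_not, hbranch, hpair, IsSOP1Tree, Subtype.forall, Prod.forall]
  refine and_congr_right fun _ => ⟨fun h η ν hν hην => h η ?_ ν hν hην, fun h η _ ν hν hην =>
    h η ν hν hην⟩
  have := hην.length_le
  rw [List.length_append] at this
  omega

theorem formulaSOP1_of_isSOP1Tree {N : Type w} [L.Structure N] {n m : ℕ}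
    (φ : L.Formula (Fin n ⊕ β)) (ε : β ≃ Fin m) {a : List Bool → β → N}
    (h : ∀ K, IsSOP1Tree φ K a) : FormulaSOP1 N (φ.relabel (Sum.map id ε)) := by
  have hφ : ∀ x η, (φ.relabel (Sum.map id ε)).Realize (Sum.elim x (a η ∘ ε.symm)) ↔
      φ.Realize (Sum.elim x (a η)) := by
    intro x η
    rw [Formula.realize_relabel, Sum.elim_comp_map, Function.comp_id, Function.comp_assoc,
      Equiv.symm_comp_self, Function.comp_id]
  refine ⟨fun η => a η ∘ ε.symm, fun η s => ?_, fun η ν hην => ?_⟩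
  · let K := s.sup id
    obtain ⟨x, hx⟩ := (h K).1 ((List.range K).map η) (by simp)
    refine ⟨x, fun i hi => (hφ _ _).2 ?_⟩
    have hi' : i ≤ K := Finset.le_sup (f := id) hi
    have := hx ⟨i, by simpa using Nat.lt_succ_of_le hi'⟩
    rwa [← List.map_take, List.take_range, min_eq_left hi'] at this
  · simpa only [hφ] using (h ν.length).2 η ν le_rfl hην

theorem sop1_of_isSOP1Tree {U : Type w} [L.Structure U] [Nonempty U] {T : L.Theory} [hT : U ⊨ T]
    {n : ℕ} [Finite β] (φ : L.Formula (Fin n ⊕ β))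
    (h : ∀ K : ℕ, ∃ a : List Bool → β → U, IsSOP1Tree φ K a) : SOP1 T := by
  classical
  obtain ⟨N, _, _, v, _, hv⟩ := exists_model_of_finite T (Set.range (sop1TreeFormula φ)) (by
    intro s hs
    rw [← Set.image_univ] at hs
    obtain ⟨t, -, rfl⟩ := Finset.subset_set_image_iff.1 hs
    obtain ⟨a, ha⟩ := h (t.sup id)
    refine ⟨U, inferInstance, inferInstance, joint a, hT, fun χ hχ => ?_⟩
    obtain ⟨K, hK, rfl⟩ := Finset.mem_image.1 hχ
    exact (realize_sop1TreeFormula φ K a).2 (ha.mono (Finset.le_sup (f := id) hK)))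
  obtain ⟨m, ⟨ε⟩⟩ := Finite.exists_equiv_fin β
  exact ⟨Theory.ModelType.of T N, n, m, _, formulaSOP1_of_isSOP1Tree φ ε fun K =>
    (realize_sop1TreeFormula φ K fun η b => v ⟨η, b⟩).1 (hv _ ⟨K, rfl⟩)⟩

end SOP

section Arrays

variable {L : FirstOrder.Language.{u, v}} {U : Type w} [L.Structure U] {β σ : Type} {Z : Set U}
  {c : ℕ → Bool → β → U} {e : List Bool → β → U} {z : σ → β → U} {n k : ℕ}

theorem IsTreeOf.exists_branch_solution [Finite σ] (h : IsTreeOf L Z c k e)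
    (hz : ∀ s, Set.range (z s) ⊆ Z) (φ : L.Formula (Fin n ⊕ β))
    (hc : ∃ x : Fin n → U, (∀ s, φ.Realize (Sum.elim x (z s))) ∧
      ∀ j < k, φ.Realize (Sum.elim x (c j false))) {ξ : List Bool} (hξ : ξ.length = k) :
    ∃ x : Fin n → U, (∀ s, φ.Realize (Sum.elim x (z s))) ∧
      ∀ j < k, φ.Realize (Sum.elim x (e (ξ.take (j + 1)))) := by
  have hE : EquivOver (L := L) Z (joint (Sum.elim z fun i : Fin k => c i false))
      (joint (Sum.elim z fun i : Fin k => e (ξ.take (i + 1)))) := by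
    refine (h.branch ξ hξ).symm.of_forall ?_
    rintro ⟨s | i, t⟩
    exacts [Or.inr ⟨rfl, hz s ⟨t, rfl⟩⟩, Or.inl ⟨⟨i, t⟩, rfl, rfl⟩]
  obtain ⟨x, hx⟩ := hc
  obtain ⟨y, hy⟩ := hE.exists_solution (fun _ => φ) ⟨x, Sum.rec hx.1 fun i => hx.2 i i.2⟩
  exact ⟨y, fun s => hy (Sum.inl s), fun j hj => hy (Sum.inr ⟨j, hj⟩)⟩

theorem IsTreeOf.not_exists_fork_solution [Finite σ] (h : IsTreeOf L Z c k e)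
    (hz : ∀ s, Set.range (z s) ⊆ Z) (φ : L.Formula (Fin n ⊕ β)) {η ξ : List Bool}
    (hξ : ξ.length = k) (hη : (η ++ [false]) <+: ξ) {i l : ℕ} (hi : i + l ≤ k)
    (hc : ¬∃ x : Fin n → U, (∀ s, φ.Realize (Sum.elim x (z s))) ∧
      φ.Realize (Sum.elim x (c η.length true)) ∧
        ∀ t < l, φ.Realize (Sum.elim x (c (i + t) false))) :
    ¬∃ x : Fin n → U, (∀ s, φ.Realize (Sum.elim x (z s))) ∧
      φ.Realize (Sum.elim x (e (η ++ [true]))) ∧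
        ∀ t < l, φ.Realize (Sum.elim x (e (ξ.take (i + t + 1)))) := by
  have hE : EquivOver (L := L) Z
      (joint (Sum.elim z fun o : Option (Fin l) =>
        o.elim (e (η ++ [true])) fun t => e (ξ.take (i + t + 1))))
      (joint (Sum.elim z fun o : Option (Fin l) =>
        o.elim (c η.length true) fun t => c (i + t) false)) := by
    refine (h.fork η ξ hξ hη).of_forall ?_
    rintro ⟨s | _ | t, b⟩
    exacts [Or.inr ⟨rfl, hz s ⟨b, rfl⟩⟩, Or.inl ⟨Sum.inl b, rfl, rfl⟩,
      Or.inl ⟨Sum.inr ⟨⟨i + t, by omega⟩, b⟩, rfl, rfl⟩]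
  rintro ⟨x, h1, h2, h3⟩
  obtain ⟨y, hy⟩ := hE.exists_solution (fun _ => φ)
    ⟨x, Sum.rec h1 (Option.rec h2 fun t => h3 t t.2)⟩
  exact hc ⟨y, fun s => hy (Sum.inl s), hy (Sum.inr none), fun t ht => hy (Sum.inr (some ⟨t, ht⟩))⟩

/-- Spreads the letters of a word, leaving room for `l` letters `false` after each of them. -/
def spread (l : ℕ) (η : List Bool) : List Bool :=
  η.flatMap fun b => b :: List.replicate l false

theorem length_spread (l : ℕ) (η : List Bool) : (spread l η).length = (l + 1) * η.length := by
  simp [spread, List.length_flatMap, mul_comm]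

theorem spread_append (l : ℕ) (η ν : List Bool) :
    spread l (η ++ ν) = spread l η ++ spread l ν :=
  List.flatMap_append

theorem spread_append_singleton_prefix (l : ℕ) (η : List Bool) (b : Bool) :
    (spread l η ++ [b]) <+: spread l (η ++ [b]) := by
  rw [spread_append]
  exact (List.prefix_append_right_inj _).2 ⟨List.replicate l false, by simp [spread]⟩

theorem exists_spread_prefix (l : ℕ) {ν : List Bool} {K : ℕ} (hν : ν.length ≤ K) :
    ∃ ξ : List Bool, ξ.length = (l + 1) * K ∧ spread l ν <+: ξ := by
  refine ⟨_, ?_, List.prefix_append _ (List.replicate ((l + 1) * (K - ν.length)) false)⟩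
  rw [List.length_append, length_spread, List.length_replicate, ← mul_add, Nat.add_sub_cancel' hν]

/-- The block of `l + 1` successive entries of the tree `e` that starts where the last letter of
`0 ⌢ η` is read. -/
def block (e : List Bool → β → U) (l : ℕ) (η : List Bool) (t : Fin (l + 1)) : β → U :=
  e ((spread l (false :: η)).take ((l + 1) * η.length + t + 1))

theorem block_eq (e : List Bool → β → U) (l : ℕ) {η ξ : List Bool}
    (h : spread l (false :: η) <+: ξ) (t : Fin (l + 1)) :
    block e l η t = e (ξ.take ((l + 1) * η.length + t + 1)) := by
  obtain ⟨ζ, rfl⟩ := h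
  rw [block, List.take_append_of_le_length]
  rw [length_spread, List.length_cons, mul_add]
  omega

theorem block_append_true_zero (e : List Bool → β → U) (l : ℕ) (η : List Bool) :
    block e l (η ++ [true]) 0 = e (spread l (false :: η) ++ [true]) := by
  have h := spread_append_singleton_prefix l (false :: η) true
  rw [List.prefix_iff_eq_take.1 h]
  simp [block, length_spread]

/-- The formula `⋀ i, φ (x; y i)` in the joint variables `y`. -/
noncomputable def allInstances {β' : Type} (ι : Type) [Finite ι] (φ : L.Formula (β' ⊕ β)) :
    L.Formula (β' ⊕ Σ _ : ι, β) :=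
  Formula.iInf fun i : ι => φ.relabel (Sum.map id (Sigma.mk i))

theorem realize_allInstances {β' ι : Type} [Finite ι] (φ : L.Formula (β' ⊕ β)) (x : β' → U)
    (d : ι → β → U) :
    (allInstances ι φ).Realize (Sum.elim x (joint d)) ↔ ∀ i, φ.Realize (Sum.elim x (d i)) := by
  simp only [allInstances, Formula.realize_iInf, Formula.realize_relabel, Sum.elim_comp_map]
  rfl

theorem IsTreeOf.isSOP1Tree_block [Finite σ] {l K : ℕ} (h : IsTreeOf L Z c ((l + 1) * (K + 1)) e)
    (hz : ∀ s, Set.range (z s) ⊆ Z) (φ : L.Formula (Fin n ⊕ β))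
    (hcon : ∃ x : Fin n → U, (∀ s, φ.Realize (Sum.elim x (z s))) ∧
      ∀ j < (l + 1) * (K + 1), φ.Realize (Sum.elim x (c j false)))
    (hinc : ∀ j i, j ≤ i → i + l < (l + 1) * (K + 1) →
      ¬∃ x : Fin n → U, (∀ s, φ.Realize (Sum.elim x (z s))) ∧
        φ.Realize (Sum.elim x (c j true)) ∧ ∀ t < l, φ.Realize (Sum.elim x (c (i + t) false))) :
    IsSOP1Tree (allInstances (σ ⊕ Fin (l + 1)) φ) K
      fun η => joint (Sum.elim z (block e l η)) := by
  have hexp : ∀ i, (l + 1) * (i + 1) = (l + 1) * i + l + 1 := fun i => by ring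
  refine ⟨fun η hη => ?_, fun η ν hν hην => ?_⟩
  · obtain ⟨ξ, hξ, hηξ⟩ := exists_spread_prefix l (ν := false :: η) (Nat.succ_le_succ hη)
    obtain ⟨x, hxz, hx⟩ := h.exists_branch_solution hz φ hcon hξ
    refine ⟨x, fun i => (realize_allInstances _ _ _).2 (Sum.rec hxz fun t => ?_)⟩
    have hpre : spread l (false :: η.take i) <+: ξ := by
      refine List.IsPrefix.trans ?_ hηξ
      conv_rhs => rw [← List.take_append_drop i η, ← List.cons_append, spread_append]
      exact List.prefix_append _ _
    have hi : (l + 1) * ((η.take i).length + 1) ≤ (l + 1) * (K + 1) :=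
      Nat.mul_le_mul_left _ (Nat.succ_le_succ ((List.length_take_le' _ _).trans hη))
    rw [Sum.elim_inr, block_eq e l hpre]
    exact hx _ (by rw [hexp] at hi; omega)
  · obtain ⟨ξ, hξ, hνξ⟩ := exists_spread_prefix l (ν := false :: ν) (Nat.succ_le_succ hν)
    have hpre : (spread l (false :: η) ++ [false]) <+: ξ := by
      refine ((spread_append_singleton_prefix l (false :: η) false).trans ?_).trans hνξ
      obtain ⟨τ, rfl⟩ := hην
      rw [← List.cons_append, ← List.cons_append, spread_append l _ τ]
      exact List.prefix_append _ _
    have hlen : (l + 1) * (η.length + 1) ≤ (l + 1) * ν.length :=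
      Nat.mul_le_mul_left _ (by simpa using hην.length_le)
    have hK : (l + 1) * ν.length + l < (l + 1) * (K + 1) := by
      have := Nat.mul_le_mul_left (l + 1) (Nat.add_le_add_right hν 1)
      rw [hexp ν.length] at this
      omega
    rintro ⟨x, h1, h2⟩
    rw [realize_allInstances] at h1 h2
    refine h.not_exists_fork_solution hz φ hξ hpre hK.le (hinc _ _ ?_ hK)
      ⟨x, fun s => h1 (Sum.inl s), ?_, fun t ht => ?_⟩
    · rwa [length_spread]
    · rw [← block_append_true_zero e]
      exact h2 (Sum.inr 0)
    · rw [← block_eq e l hνξ ⟨t, ht.trans (Nat.lt_succ_self l)⟩]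
      exact h1 (Sum.inr ⟨t, ht.trans (Nat.lt_succ_self l)⟩)

theorem sop1_of_arrays [Nonempty U] {T : L.Theory} [U ⊨ T] {μ : Cardinal.{w}}
    (hU : IsSaturated L U μ) (hμ : ℵ₀ ≤ μ) [Finite β] [Finite σ] (φ : L.Formula (Fin n ⊕ β))
    (l : ℕ) (h : ∀ k : ℕ, ∃ (z : σ → β → U) (c : ℕ → Bool → β → U),
      (∀ j < k, EquivOver (L := L) ((⋃ s, Set.range (z s)) ∪ ⋃ i < j, ⋃ b, Set.range (c i b))
        (c j false) (c j true)) ∧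
      (∃ x : Fin n → U, (∀ s, φ.Realize (Sum.elim x (z s))) ∧
        ∀ j < k, φ.Realize (Sum.elim x (c j false))) ∧
      ∀ j i, j ≤ i → i + l < k →
        ¬∃ x : Fin n → U, (∀ s, φ.Realize (Sum.elim x (z s))) ∧
          φ.Realize (Sum.elim x (c j true)) ∧ ∀ t < l, φ.Realize (Sum.elim x (c (i + t) false))) :
    SOP1 T := by
  refine sop1_of_isSOP1Tree (U := U) (allInstances (σ ⊕ Fin (l + 1)) φ) fun K => ?_
  obtain ⟨z, c, hE, hcon, hinc⟩ := h ((l + 1) * (K + 1))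
  obtain ⟨e, he⟩ := exists_isTreeOf hU hμ ((Cardinal.lt_aleph0_iff_set_finite.2
    (Set.finite_iUnion fun s => Set.finite_range (z s))).trans_le hμ) hE
  exact ⟨_, he.isSOP1Tree_block (Set.subset_iUnion fun s => Set.range (z s)) φ hcon hinc⟩

end Arrays

section KimLemma

variable {L : FirstOrder.Language.{u, v}} {U : Type w} [L.Structure U] {β : Type} {A : Set U}
  {n : ℕ} {φ : L.Formula (Fin n ⊕ β)} {q r : (L.elementaryDiagram U).CompleteType β}

/-- The word `r ^ l q ^ m` in the two global types `r` and `q`. -/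
def word (r q : (L.elementaryDiagram U).CompleteType β) (l m : ℕ) :
    Fin l ⊕ₗ Fin m → (L.elementaryDiagram U).CompleteType β :=
  Sum.elim (fun _ => r) (fun _ => q) ∘ ofLex

/-- The instances of `φ` along any sequence realizing the word `r ^ l q ^ m` over `A` have a common
solution. -/
def SolvableAlong (A : Set U) (φ : L.Formula (Fin n ⊕ β))
    (r q : (L.elementaryDiagram U).CompleteType β) (l m : ℕ) : Prop :=
  ∀ b : Fin l ⊕ₗ Fin m → β → U, RealizesAlong A (word r q l m) b →
    ∃ x : Fin n → U, ∀ i, φ.Realize (Sum.elim x (b i))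

theorem strictMono_sumElim_ofLex {l m : ℕ} {f : Fin l → ℕ} {g : Fin m → ℕ} (hf : StrictMono f)
    (hg : StrictMono g) (hfg : ∀ i j, f i < g j) :
    StrictMono (Sum.elim f g ∘ ofLex : Fin l ⊕ₗ Fin m → ℕ) := by
  rintro _ _ (h | h | h)
  exacts [hf h, hg h, hfg _ _]

/-- By invariance, a single sequence realizing the word decides whether `φ` is solvable along it. -/
theorem solvableAlong_iff (hr : IsInvariant A r) (hq : IsInvariant A q) {l m : ℕ}
    {ρ : ℕ → (L.elementaryDiagram U).CompleteType β} {v : ℕ → β → U} (hv : RealizesAlong A ρ v)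
    {f : Fin l → ℕ} {g : Fin m → ℕ} (hf : StrictMono f) (hg : StrictMono g)
    (hfg : ∀ i j, f i < g j) (hρf : ∀ i, ρ (f i) = r) (hρg : ∀ j, ρ (g j) = q) :
    SolvableAlong A φ r q l m ↔ ∃ x : Fin n → U,
      (∀ i, φ.Realize (Sum.elim x (v (f i)))) ∧ ∀ j, φ.Realize (Sum.elim x (v (g j))) := by
  have hword : ρ ∘ Sum.elim f g ∘ ofLex = word r q l m := by
    ext1 (i | j)
    exacts [hρf i, hρg j]
  have hvw : RealizesAlong A (word r q l m) (v ∘ Sum.elim f g ∘ ofLex) :=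
    hword ▸ hv.comp (strictMono_sumElim_ofLex hf hg hfg)
  have hinv : ∀ i, IsInvariant A (word r q l m i) := Sum.rec (fun _ => hr) fun _ => hq
  constructor
  · intro h
    obtain ⟨x, hx⟩ := h _ hvw
    exact ⟨x, fun i => hx (Sum.inl i), fun j => hx (Sum.inr j)⟩
  · rintro ⟨x, hxf, hxg⟩ b hb
    have hE := RealizesAlong.equivOver hinv (EquivOver.refl (L := L) A (Empty.elim : Empty → U))
      (hvw.mono (by simp [Set.range_eq_empty])) (hb.mono (by simp [Set.range_eq_empty]))
    exact (hE.comp Sum.inr).exists_solution (e := v ∘ Sum.elim f g ∘ ofLex) (fun _ => φ)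
      ⟨x, Sum.rec hxf hxg⟩

theorem IsMorley.consistent_iff (hr : IsInvariant A r) (hq : IsInvariant A q) {b : ℕ → β → U}
    (hb : IsMorley A q b) :
    (Consistent fun i x => φ.Realize (Sum.elim x (b i))) ↔ ∀ m, SolvableAlong A φ r q 0 m := by
  have hiff : ∀ m, SolvableAlong A φ r q 0 m ↔ _ := fun m =>
    solvableAlong_iff hr hq (ρ := fun _ => q) hb (Subsingleton.strictMono Fin.elim0)
      Fin.val_strictMono Fin.rec0 Fin.rec0 fun _ => rfl
  simp only [hiff]
  constructor
  · intro h m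
    obtain ⟨x, hx⟩ := h (Finset.range m)
    exact ⟨x, Fin.rec0, fun i => hx i (Finset.mem_range.2 i.2)⟩
  · intro h s
    obtain ⟨x, -, hx⟩ := h (s.sup id + 1)
    exact ⟨x, fun i hi => hx ⟨i, Nat.lt_succ_of_le (Finset.le_sup (f := id) hi)⟩⟩

theorem QDivides.not_consistent (hq : IsInvariant A q) (h : QDivides A φ q) {b : ℕ → β → U}
    (hb : IsMorley A q b) : ¬Consistent fun i x => φ.Realize (Sum.elim x (b i)) := by
  obtain ⟨b', hb', hcon⟩ := h
  rwa [hb.consistent_iff hq hq, ← hb'.consistent_iff hq hq]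

/-- The global types `r` and `q`, in alternation. -/
noncomputable def alternate (r q : (L.elementaryDiagram U).CompleteType β) (i : ℕ) :
    (L.elementaryDiagram U).CompleteType β :=
  open Classical in if Even i then r else q

theorem alternate_two_mul (i : ℕ) : alternate r q (2 * i) = r :=
  if_pos (even_two_mul i)

theorem alternate_two_mul_add_one (i : ℕ) : alternate r q (2 * i + 1) = q :=
  if_neg (Nat.not_even_two_mul_add_one i)

theorem forall_alternate {P : (L.elementaryDiagram U).CompleteType β → Prop} (hr : P r) (hq : P q)
    (i : ℕ) : P (alternate r q i) := by
  rw [alternate]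
  split_ifs <;> assumption

theorem solvableAlong_of_alternate (hr : IsInvariant A r) (hq : IsInvariant A q) {v : ℕ → β → U}
    (hv : RealizesAlong A (alternate r q) v) {i j k l m : ℕ} (hij : i + l ≤ j + 1) (hjk : j < k)
    {x : Fin n → U} (hxi : ∀ s < l, φ.Realize (Sum.elim x (v (2 * (i + s)))))
    (hxj : φ.Realize (Sum.elim x (v (2 * j + 1))))
    (hxk : ∀ t : Fin m, φ.Realize (Sum.elim x (v (2 * (k + t) + 1)))) :
    SolvableAlong A φ r q l (m + 1) := by
  let f : Fin l → ℕ := fun s => 2 * (i + s)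
  let g : Fin (m + 1) → ℕ := fun t => 2 * (Fin.cases j (fun t => k + t) t : ℕ) + 1
  have hf : StrictMono f := fun s s' h => by simp only [f]; omega
  have hg : StrictMono g := by
    intro s t h
    induction s using Fin.cases <;> induction t using Fin.cases <;>
      simp only [g, Fin.cases_zero, Fin.cases_succ, Fin.lt_def, Fin.val_zero, Fin.val_succ]
        at h ⊢ <;> omega
  have hfg : ∀ s t, f s < g t := fun s => Fin.cases (by simp only [f, g, Fin.cases_zero]; omega)
    fun t => by simp only [f, g, Fin.cases_succ]; omega
  exact (solvableAlong_iff hr hq hv hf hg hfg (fun s => alternate_two_mul _)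
    fun t => alternate_two_mul_add_one _).2 ⟨x, fun s => hxi s s.2, Fin.cases hxj hxk⟩

/-- The array used is `v (2 (k - 1 - j) + b)`, where `v` realizes `r` at even and `q` at odd places:
its column `j` is a pair of realizations of `r` and `q` with a common type over `A`, preserved over
the columns to its right. A subsequence picks one entry per column, so it realizes any prescribed
word. -/
theorem sop1_of_solvableAlong [Nonempty U] {T : L.Theory} [U ⊨ T] {μ : Cardinal.{w}}
    (hU : IsSaturated L U μ) (hμ : ℵ₀ ≤ μ) (hA : #A < μ) [Finite β]
    (hr : IsInvariant A r) (hq : IsInvariant A q) {b : β → U} (hrb : RealizesOver A r b)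
    (hqb : RealizesOver A q b) {l m : ℕ} (hm : ∀ k, SolvableAlong A φ r q k m)
    (hl : ¬SolvableAlong A φ r q l (m + 1)) : SOP1 T := by
  obtain ⟨v, hv⟩ := exists_realizesAlong hU hμ hA (alternate r q)
  have hvb : ∀ i, EquivOver (L := L) A (v i) b := fun i =>
    forall_alternate (P := fun p => ∀ c, RealizesOver A p c → EquivOver (L := L) A c b)
      (fun c hc => hc.equivOver hrb) (fun c hc => hc.equivOver hqb) i _
      ((hv i).mono Set.subset_union_left)
  refine sop1_of_arrays (U := U) hU hμ φ l fun k =>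
    ⟨fun t : Fin m => v (2 * (k + t) + 1), fun j b => v (2 * (k - 1 - j) + b.toNat),
      fun j hj => ?_, ?_, fun j i hji hik => ?_⟩
  · refine (hv.equivOver_of_lt (forall_alternate hr hq) ((hvb _).trans (hvb _).symm)
      (Set.Ico (2 * (k - j)) (2 * (k + m))) fun t ht => ?_).mono (Set.union_subset
        (Set.iUnion_subset fun t => ?_) (Set.iUnion₂_subset fun i hi => Set.iUnion_subset ?_))
    · have := ht.1
      simp only [Bool.toNat_false, Bool.toNat_true]
      omega
    · refine Set.subset_union_of_subset_right (Set.subset_biUnion_of_mem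
        (u := fun t => Set.range (v t)) (Set.mem_Ico.2 ⟨?_, ?_⟩)) _ <;> omega
    · intro b
      have := b.toNat_le
      refine Set.subset_union_of_subset_right (Set.subset_biUnion_of_mem
        (u := fun t => Set.range (v t)) (Set.mem_Ico.2 ⟨?_, ?_⟩)) _ <;> omega
  · obtain ⟨x, hx, hx'⟩ := (solvableAlong_iff hr hq hv (f := fun i : Fin k => 2 * (i : ℕ))
      (g := fun t : Fin m => 2 * (k + t) + 1) (fun i j h => by dsimp only; omega)
      (fun i j h => by dsimp only; omega) (fun i j => by omega)
      (fun i => alternate_two_mul _) fun t => alternate_two_mul_add_one _).1 (hm k)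
    exact ⟨x, hx', fun j hj => hx ⟨k - 1 - j, by omega⟩⟩
  · rintro ⟨x, hxz, hxj, hxi⟩
    refine hl (solvableAlong_of_alternate hr hq hv (i := k - i - l) (j := k - 1 - j) (by omega)
      (by omega) (fun s hs => ?_) hxj hxz)
    convert hxi (l - 1 - s) (by omega) using 4
    simp only [Bool.toNat_false]
    omega

/-- Kim's lemma for NSOP₁ theories. -/
theorem QDivides.of_nsop1 [Nonempty U] {T : L.Theory} [U ⊨ T] (hT : NSOP1 T) {μ : Cardinal.{w}}
    (hU : IsSaturated L U μ) (hμ : ℵ₀ ≤ μ) (hA : #A < μ) [Finite β]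
    (hq : IsInvariant A q) (hr : IsInvariant A r) {b : β → U} (hqb : RealizesOver A q b)
    (hrb : RealizesOver A r b) (h : QDivides A φ q) : QDivides A φ r := by
  by_contra hr_div
  have hzero : ∀ l, SolvableAlong A φ r q l 0 := by
    intro l
    obtain ⟨c, hc⟩ := exists_realizesAlong hU hμ hA fun _ => r
    obtain ⟨x, hx⟩ := not_not.1 (fun hcon => hr_div ⟨c, hc, hcon⟩) (Finset.range l)
    exact (solvableAlong_iff hr hq hc Fin.val_strictMono (Subsingleton.strictMono Fin.elim0)
      (fun _ => Fin.rec0) (fun _ => rfl) Fin.rec0).2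
      ⟨x, fun i => hx i (Finset.mem_range.2 i.2), Fin.rec0⟩
  obtain ⟨c, hc, hcon⟩ := h
  refine hcon ((hc.consistent_iff hr hq).2 fun m => ?_)
  suffices hall : ∀ l, SolvableAlong A φ r q l m from hall 0
  induction m with
  | zero => exact hzero
  | succ m ih =>
    intro l
    by_contra hl
    exact hT (sop1_of_solvableAlong hU hμ hA hr hq hrb hqb ih hl)

end KimLemma

section Coheir

variable {L : FirstOrder.Language.{u, v}} {U : Type w} [L.Structure U] {β δ : Type} {A C : Set U}

theorem EquivOver.forall_realize {γ : Type} [Finite β] {e e' : γ → U}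
    (h : EquivOver (L := L) A e e') {χ : L.Formula (β ⊕ γ)}
    (hχ : ∀ x : β → U, χ.Realize (Sum.elim x e)) (x : β → U) : χ.Realize (Sum.elim x e') := by
  by_contra hx
  have h' : EquivOver (L := L) A (joint fun _ : Unit => e') (joint fun _ : Unit => e) :=
    h.symm.comp fun p : Σ _ : Unit, γ => p.2
  obtain ⟨y, hy⟩ := h'.exists_solution (fun _ => χ.not) ⟨x, fun _ => hx⟩
  exact hy () (hχ y)

theorem EquivOver.exists_realize_of_imp [Finite β] {γ ι : Type} [Finite ι] {δ : ι → Type}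
    {φ : L.Formula (β ⊕ γ)} {ψ : ∀ i, L.Formula (β ⊕ δ i)} {b : γ → U} {c : ∀ i, δ i → U}
    (himp : ∀ x : β → U, φ.Realize (Sum.elim x b) → ∃ i, (ψ i).Realize (Sum.elim x (c i)))
    {w : γ ⊕ (Σ i, δ i) → U} (h : EquivOver (L := L) A (Sum.elim b (joint c)) w) {x : β → U}
    (hx : φ.Realize (Sum.elim x (w ∘ Sum.inl))) :
    ∃ i, (ψ i).Realize (Sum.elim x fun t => w (Sum.inr ⟨i, t⟩)) := by
  let χ : L.Formula (β ⊕ (γ ⊕ Σ i, δ i)) := (φ.relabel (Sum.map id Sum.inl)).imp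
    (Formula.iSup fun i => (ψ i).relabel (Sum.map id (Sum.inr ∘ Sigma.mk i)))
  have hχ : ∀ (w : γ ⊕ (Σ i, δ i) → U) x, χ.Realize (Sum.elim x w) ↔
      (φ.Realize (Sum.elim x (w ∘ Sum.inl)) →
        ∃ i, (ψ i).Realize (Sum.elim x fun t => w (Sum.inr ⟨i, t⟩))) := by
    intro w x
    simp only [χ, Formula.realize_imp, Formula.realize_iSup, Formula.realize_relabel,
      Sum.elim_comp_map, Function.comp_id]
    rfl
  exact (hχ w x).1 (h.forall_realize (fun x => (hχ _ x).2 (himp x)) x) hx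

theorem Consistent.exists_forall_realize {μ : Cardinal.{w}} (hU : IsSaturated L U μ) (hμ : ℵ₀ < μ)
    [Finite β] {n : ℕ} {φ : L.Formula (Fin n ⊕ β)} {b : ℕ → β → U}
    (h : Consistent fun i x => φ.Realize (Sum.elim x (b i))) :
    ∃ x, ∀ i, φ.Realize (Sum.elim x (b i)) := by
  classical
  refine hU.exists_realize (A := ⋃ i, Set.range (b i)) ?_ (fun _ => φ) b
    (fun i t => Set.mem_iUnion.2 ⟨i, t, rfl⟩) fun m f => ?_
  · exact (Cardinal.mk_le_aleph0_iff.2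
      (Set.countable_iUnion fun i => (Set.finite_range _).countable).to_subtype).trans_lt hμ
  · obtain ⟨x, hx⟩ := h (Finset.univ.image f)
    exact ⟨x, fun j => hx _ (Finset.mem_image_of_mem f (Finset.mem_univ j))⟩

variable [Nonempty U] {D : Ultrafilter (β → U)}

theorem isInvariant_limitType (hD : ∀ᶠ b : β → U in D, ∀ i, b i ∈ A) :
    IsInvariant A (limitType L D) := by
  intro k φ e e' h
  rw [has_limitType, has_limitType]
  refine Filter.eventually_congr (hD.mono fun b hb => ?_)
  have := h.realize_iff (φ.relabel Sum.swap) hb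
  simpa only [Formula.realize_relabel, Sum.elim_swap] using this

theorem RealizesOver.comp_limitType {b : β → U} (h : RealizesOver C (limitType L D) b)
    (f : δ → β) : RealizesOver C (limitType L (D.map (· ∘ f))) (b ∘ f) := by
  have hf : ∀ {k} (φ : L.Formula (δ ⊕ Fin k)) (b : β → U) (e : Fin k → U),
      (φ.relabel (Sum.map f id)).Realize (Sum.elim b e) ↔ φ.Realize (Sum.elim (b ∘ f) e) := by
    intro k φ b e
    rw [Formula.realize_relabel, Sum.elim_comp_map, Function.comp_id]
  intro k φ e he
  rw [has_limitType, Ultrafilter.coe_map, Filter.eventually_map, ← hf, ← h k _ e he, has_limitType]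
  simp only [hf]

theorem IsMorley.comp_limitType {b : ℕ → β → U} (h : IsMorley C (limitType L D) b) (f : δ → β) :
    IsMorley C (limitType L (D.map (· ∘ f))) fun i => b i ∘ f :=
  fun i => ((h i).mono (Set.union_subset_union_right _ (Set.iUnion₂_mono fun j _ =>
    Set.range_comp_subset_range f (b j)))).comp_limitType f

theorem RealizesOver.eventually_exists_extension {M : L.ElementarySubstructure U} {b : β → U}
    (hb : RealizesOver (M : Set U) (limitType L D) b) (hDM : ∀ᶠ b' : β → U in D, ∀ i, b' i ∈ M)
    [Finite δ] {d : δ → U} {γ : Type} {χ : L.Formula ((β ⊕ δ) ⊕ γ)} {a : γ → M}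
    (h : χ.Realize (Sum.elim (Sum.elim b d) fun t => (a t : U))) :
    ∀ᶠ b' in D, ∃ d' : δ → U, (∀ i, d' i ∈ M) ∧
      χ.Realize (Sum.elim (Sum.elim b' d') fun t => (a t : U)) := by
  let θ : L.Formula (β ⊕ γ) := (χ.relabel (Sum.elim (Sum.elim (Sum.inl ∘ Sum.inl) Sum.inr)
    (Sum.inl ∘ Sum.inr)) : L.Formula ((β ⊕ γ) ⊕ δ)).iExs δ
  have hθ : ∀ {N : Type w} [L.Structure N] (b : β → N) (a : γ → N),
      θ.Realize (Sum.elim b a) ↔ ∃ d : δ → N, χ.Realize (Sum.elim (Sum.elim b d) a) := by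
    intro N _ b a
    simp only [θ, Formula.realize_iExs, Formula.realize_relabel, Sum.comp_elim,
      ← Function.comp_assoc, Sum.elim_comp_inr, Sum.elim_comp_inl]
  have hbθ : θ.Realize (Sum.elim b fun t => (a t : U)) := (hθ _ _).2 ⟨d, h⟩
  rw [← hb.has_iff θ fun t => (a t).2, has_limitType] at hbθ
  filter_upwards [hbθ, hDM] with b' hb' hb'M
  have hM : θ.Realize (Sum.elim (fun i => (⟨b' i, hb'M i⟩ : M)) a) := by
    rw [← M.subtype.map_formula, Sum.comp_elim]
    exact hb'
  obtain ⟨d', hd'⟩ := (hθ _ _).1 hM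
  refine ⟨fun i => d' i, fun i => (d' i).2, ?_⟩
  rwa [← M.subtype.map_formula, Sum.comp_elim, Sum.comp_elim] at hd'

theorem realizesOver_limitType {b : β → U}
    (h : ∀ (k : ℕ) (χ : L.Formula (β ⊕ Fin k)) (e : Fin k → U), (∀ i, e i ∈ C) →
      χ.Realize (Sum.elim b e) → ∀ᶠ b' in D, χ.Realize (Sum.elim b' e)) :
    RealizesOver C (limitType L D) b := by
  intro k χ e he
  refine ⟨fun hχ => by_contra fun hn => ?_, fun hχ => (has_limitType D χ e).2 (h k χ e he hχ)⟩
  exact (has_not χ e).1 ((has_limitType D χ.not e).2 (h k χ.not e he hn)) hχ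

theorem exists_ultrafilter_le_realizesOver {F : Filter (β → U)} {b : β → U}
    (h : ∀ (k : ℕ) (χ : L.Formula (β ⊕ Fin k)) (e : Fin k → U), (∀ i, e i ∈ C) →
      χ.Realize (Sum.elim b e) → ∃ᶠ b' in F, χ.Realize (Sum.elim b' e)) :
    ∃ D : Ultrafilter (β → U), ↑D ≤ F ∧ RealizesOver C (limitType L D) b := by
  let Θ := {θ : L.Formula (β ⊕ C) // θ.Realize (Sum.elim b Subtype.val)}
  have : Nonempty Θ := ⟨⊤, Formula.realize_top.2 trivial⟩
  let G : Θ → Filter (β → U) := fun θ =>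
    F ⊓ Filter.principal {b' | θ.1.Realize (Sum.elim b' Subtype.val)}
  have hG : Directed (· ≥ ·) G := fun θ₁ θ₂ =>
    ⟨⟨θ₁.1 ⊓ θ₂.1, Formula.realize_inf.2 ⟨θ₁.2, θ₂.2⟩⟩,
      inf_le_inf_left _ (Filter.principal_mono.2 fun _ hb => (Formula.realize_inf.1 hb).1),
      inf_le_inf_left _ (Filter.principal_mono.2 fun _ hb => (Formula.realize_inf.1 hb).2)⟩
  have : (⨅ θ, G θ).NeBot := Filter.iInf_neBot_of_directed' hG fun θ => by
    refine Filter.frequently_iff_neBot.1 ?_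
    simp only [← realize_supportFormula θ.1]
    exact h _ _ _ (fun i => (supportMap θ.1 i).2) ((realize_supportFormula θ.1 _ _).2 θ.2)
  obtain ⟨D, hD⟩ := Ultrafilter.exists_le (⨅ θ, G θ)
  refine ⟨D, hD.trans ((iInf_le G (Classical.arbitrary Θ)).trans inf_le_left),
    realizesOver_limitType fun k χ e he hχ => ?_⟩
  let f : Fin k → C := fun i => ⟨e i, he i⟩
  have hf : ∀ b' : β → U, (χ.relabel (Sum.map id f)).Realize (Sum.elim b' Subtype.val) ↔
      χ.Realize (Sum.elim b' e) := by
    intro b'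
    rw [Formula.realize_relabel, Sum.elim_comp_map]
    rfl
  simp only [← hf]
  exact (hD.trans ((iInf_le G ⟨_, (hf b).2 hχ⟩).trans inf_le_right)) (Filter.mem_principal_self _)

theorem RealizesOver.exists_extension {M : L.ElementarySubstructure U} {b : β → U}
    (hb : RealizesOver (M : Set U) (limitType L D) b) (hDM : ∀ᶠ b' : β → U in D, ∀ i, b' i ∈ M)
    [Finite δ] (d : δ → U) :
    ∃ D' : Ultrafilter (β ⊕ δ → U), (∀ᶠ w : β ⊕ δ → U in D', ∀ i, w i ∈ M) ∧
      D'.map (· ∘ Sum.inl) = D ∧ RealizesOver (M : Set U) (limitType L D') (Sum.elim b d) := by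
  let F : Filter (β ⊕ δ → U) :=
    Filter.comap (· ∘ Sum.inl) (D : Filter (β → U)) ⊓ Filter.principal {w | ∀ i, w i ∈ M}
  suffices h : ∃ D' : Ultrafilter (β ⊕ δ → U), ↑D' ≤ F ∧
      RealizesOver (M : Set U) (limitType L D') (Sum.elim b d) by
    obtain ⟨D', hD', hbd⟩ := h
    exact ⟨D', (hD'.trans inf_le_right) (Filter.mem_principal_self _), Ultrafilter.coe_le_coe.1
      (Filter.map_le_iff_le_comap.2 (hD'.trans inf_le_left)), hbd⟩
  refine exists_ultrafilter_le_realizesOver fun k χ e he hχ => ?_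
  rw [Filter.frequently_inf_principal, Filter.frequently_comap]
  refine Filter.Eventually.frequently ?_
  filter_upwards [hb.eventually_exists_extension hDM (a := fun t => ⟨e t, he t⟩) hχ, hDM]
    with b' ⟨d', hd', h⟩ hb'
  exact ⟨Sum.elim b' d', Sum.elim_comp_inl _ _, Sum.rec hb' hd', h⟩

theorem IsMorley.exists_reflection (hD : ∀ᶠ b : β → U in D, ∀ i, b i ∈ A) {b : ℕ → β → U}
    (hb : IsMorley A (limitType L D) b) {X : Set (β → U)} (hX : X ∈ D) (N : ℕ) {γ : Type}
    (χ : L.Formula ((Σ _ : Fin N, β) ⊕ γ)) {a : γ → U} (ha : ∀ i, a i ∈ A)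
    (hχ : χ.Realize (Sum.elim (joint fun i : Fin N => b i) a)) :
    ∃ b' : Fin N → β → U, (∀ i, b' i ∈ X) ∧ χ.Realize (Sum.elim (joint b') a) := by
  induction N generalizing γ with
  | zero => exact ⟨fun i => b i, fun i => i.elim0, hχ⟩
  | succ N ih =>
    let f : (Σ _ : Fin (N + 1), β) ⊕ γ → β ⊕ ((Σ _ : Fin N, β) ⊕ γ) := Sum.elim
      (fun p => Fin.lastCases (Sum.inl p.2) (fun i => Sum.inr (Sum.inl ⟨i, p.2⟩)) p.1)
      (Sum.inr ∘ Sum.inr)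
    have hf : ∀ (c : Fin N → β → U) (y : β → U), (χ.relabel f).Realize
        (Sum.elim y (Sum.elim (joint c) a)) ↔ χ.Realize (Sum.elim (joint (Fin.snoc c y)) a) := by
      intro c y
      rw [Formula.realize_relabel]
      refine iff_of_eq (congrArg _ (funext ?_))
      rintro (⟨i, t⟩ | t)
      · induction i using Fin.lastCases <;> simp [f, joint]
      · rfl
    let g : β ⊕ ((Σ _ : Fin N, β) ⊕ γ) → (Σ _ : Fin N, β) ⊕ (β ⊕ γ) :=
      Sum.elim (Sum.inr ∘ Sum.inl) (Sum.elim Sum.inl (Sum.inr ∘ Sum.inr))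
    have hg : ∀ (c : Fin N → β → U) (y : β → U), ((χ.relabel f).relabel g).Realize
        (Sum.elim (joint c) (Sum.elim y a)) ↔ χ.Realize (Sum.elim (joint (Fin.snoc c y)) a) := by
      intro c y
      rw [Formula.realize_relabel, ← hf]
      simp only [g, Sum.comp_elim, ← Function.comp_assoc, Sum.elim_comp_inr, Sum.elim_comp_inl]
    have hbN : (fun i : Fin (N + 1) => b i) = Fin.snoc (fun i : Fin N => b i) (b N) := by
      ext i : 1
      induction i using Fin.lastCases <;> simp
    rw [hbN, ← hf, ← (hb N).has_iff _ (Sum.rec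
      (fun p => Or.inr (Set.mem_iUnion₂.2 ⟨p.1, p.1.2, p.2, rfl⟩)) fun i => Or.inl (ha i)),
      has_limitType] at hχ
    obtain ⟨y, hy, hyA, hyX⟩ := (hχ.and (hD.and hX)).exists
    obtain ⟨c, hcX, hc⟩ := ih _ (Sum.rec hyA ha) ((hg _ y).2 ((hf _ y).1 hy))
    exact ⟨Fin.snoc c y, Fin.lastCases (by rwa [Fin.snoc_last]) (by simpa using hcX), (hg c y).1 hc⟩

theorem IsMorley.consistent_of_mem (hD : ∀ᶠ b : β → U in D, ∀ i, b i ∈ A) {b : ℕ → β → U}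
    (hb : IsMorley A (limitType L D) b) {X : Set (β → U)} (hX : X ∈ D) {n : ℕ}
    {φ : L.Formula (Fin n ⊕ β)} (h : Consistent fun (b' : X) x => φ.Realize (Sum.elim x b'.1)) :
    Consistent fun i x => φ.Realize (Sum.elim x (b i)) := by
  classical
  intro s
  obtain ⟨N, hN⟩ := s.exists_nat_subset_range
  let χ := commonSolution fun _ : Fin N => φ
  suffices hχ : χ.Realize (joint fun i : Fin N => b i) by
    obtain ⟨x, hx⟩ := (realize_commonSolution _ _).1 hχ
    exact ⟨x, fun i hi => hx ⟨i, Finset.mem_range.1 (hN hi)⟩⟩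
  by_contra hχ
  obtain ⟨b', hb', hχ'⟩ := hb.exists_reflection hD hX N (χ.not.relabel Sum.inl)
    (a := Empty.elim) (fun i => i.elim) (by rwa [Formula.realize_relabel, Sum.elim_comp_inl])
  rw [Formula.realize_relabel, Sum.elim_comp_inl] at hχ'
  obtain ⟨x, hx⟩ := h (Finset.univ.image fun i => ⟨b' i, hb' i⟩)
  exact hχ' ((realize_commonSolution _ _).2
    ⟨x, fun i => hx _ (Finset.mem_image_of_mem _ (Finset.mem_univ i))⟩)

/-- Coheirs of `b` over `M` detect Kim-forking, because all invariant extensions of a type witness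
Kim-dividing when one of them does. -/
theorem KimForks.not_consistent {T : L.Theory} [U ⊨ T] (hT : NSOP1 T) {μ : Cardinal.{w}}
    (hU : IsSaturated L U μ) (hμ : ℵ₀ < μ) {M : L.ElementarySubstructure U} (hM : #M < μ)
    [Finite β] {n : ℕ} {φ : L.Formula (Fin n ⊕ β)} {b : β → U} (h : KimForks (M : Set U) φ b)
    (hDM : ∀ᶠ b' : β → U in D, ∀ i, b' i ∈ M) (hb : RealizesOver (M : Set U) (limitType L D) b)
    {X : Set (β → U)} (hX : X ∈ D) :
    ¬ Consistent fun (b' : X) x => φ.Realize (Sum.elim x b'.1) := by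
  classical
  intro hcon
  obtain ⟨k, m, ψ, c, himp, hdiv⟩ := h
  obtain ⟨D', hD'M, rfl, hbc⟩ := hb.exists_extension hDM (joint c)
  obtain ⟨y, hy⟩ := exists_realizesAlong hU hμ.le (A := (M : Set U)) hM fun _ => limitType L D'
  obtain ⟨x, hx⟩ := ((IsMorley.comp_limitType hy Sum.inl).consistent_of_mem hDM hX
    hcon).exists_forall_realize hU hμ
  have hψ : ∀ j, ∃ l, (ψ l).Realize (Sum.elim x fun t => y j (Sum.inr ⟨l, t⟩)) := fun j =>
    (hbc.equivOver ((hy j).mono Set.subset_union_left)).exists_realize_of_imp himp (hx j)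
  choose l hl using hψ
  obtain ⟨l₀, hl₀⟩ := Finite.exists_infinite_fiber l
  let τ := Nat.orderEmbeddingOfSet (l ⁻¹' {l₀})
  have hτ : ∀ i, l (τ i) = l₀ := fun i => (Nat.Subtype.ofNat (l ⁻¹' {l₀}) i).2
  have hyτ : IsMorley (M : Set U) (limitType L D') (y ∘ τ) := hy.comp τ.strictMono
  obtain ⟨q, hq, hqc, hqd⟩ := hdiv l₀
  have hinv : IsInvariant (M : Set U) (limitType L (D'.map (· ∘ fun t => Sum.inr ⟨l₀, t⟩))) :=
    isInvariant_limitType (hD'M.mono fun w hw t => hw _)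
  refine (hqd.of_nsop1 hT hU hμ.le hM hq hinv hqc (hbc.comp_limitType _)).not_consistent hinv
    (hyτ.comp_limitType _) fun s => ⟨x, fun i _ => ?_⟩
  have := hl (τ i)
  rwa [hτ i] at this

end Coheir

section Reflection

theorem exists_isSuccLimit_closed {κ : Cardinal.{w}} (hκ : κ.IsRegular) (hκ' : ℵ₀ < κ)
    {h : Ordinal.{w} → Ordinal.{w}} (hh : ∀ i < κ.ord, h i < κ.ord) :
    ∃ δ < κ.ord, Order.IsSuccLimit δ ∧ ∀ j < δ, ∃ i < δ, j ≤ i ∧ h i < δ := by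
  let f : Ordinal.{w} → Ordinal.{w} := fun i => max (Order.succ i) (h i)
  let δ := Ordinal.nfp f 0
  have hκlim : Order.IsSuccLimit κ.ord := isSuccLimit_ord hκ'.le
  have hlt : ∀ n, f^[n] 0 < δ := fun n => by
    have := Ordinal.iterate_le_nfp f 0 (n + 1)
    rw [Function.iterate_succ_apply'] at this
    exact (Order.lt_succ _).trans_le ((le_max_left _ _).trans this)
  have hδ : δ < κ.ord := Ordinal.nfp_lt_ord (by rwa [hκ.cof_ord])
    (fun i hi => max_lt (hκlim.succ_lt hi) (hh i hi)) hκlim.bot_lt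
  refine ⟨δ, hδ, ?_, fun j hj => ?_⟩
  · refine Ordinal.isSuccLimit_iff.2 ⟨(hlt 0).ne', Order.isSuccPrelimit_of_succ_lt fun j hj => ?_⟩
    obtain ⟨n, hn⟩ := Ordinal.lt_nfp_iff.1 hj
    exact (Order.succ_le_of_lt hn).trans_lt (hlt n)
  · obtain ⟨n, hn⟩ := Ordinal.lt_nfp_iff.1 hj
    refine ⟨f^[n] 0, hlt n, hn.le, (le_max_right _ _).trans_lt (b := f (f^[n] 0)) ?_⟩
    simpa only [Function.iterate_succ_apply'] using hlt (n + 1)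

/-- A weak form of the pressing down lemma. -/
theorem exists_reflecting_ordinal {κ : Cardinal.{w}} (hκ : κ.IsRegular) (hκ' : ℵ₀ < κ)
    {X : Type w} (G : Ordinal.{w} → Set X) (hmono : ∀ i j, i ≤ j → j < κ.ord → G i ⊆ G j)
    (hcard : ∀ i < κ.ord, #(G i) < κ)
    (hcont : ∀ i < κ.ord, Order.IsSuccLimit i → ∀ x ∈ G i, ∃ j < i, x ∈ G j)
    (P : X → Ordinal.{w} → Prop) :
    ∃ δ < κ.ord, ∀ x ∈ G δ, P x δ → ∃ j < δ, P x j := by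
  let F : X → Ordinal.{w} := fun x => sInf {i | i < κ.ord ∧ P x i}
  have hF : ∀ x, F x < κ.ord := by
    intro x
    rcases {i | i < κ.ord ∧ P x i}.eq_empty_or_nonempty with h | h
    · simp only [F, h, Ordinal.sInf_empty]
      exact (isSuccLimit_ord hκ'.le).bot_lt
    · exact (csInf_mem h).1
  obtain ⟨δ, hδ, hδlim, hcl⟩ := exists_isSuccLimit_closed hκ hκ' (h := fun i => ⨆ x : G i, F x)
    fun i hi => Ordinal.iSup_lt_of_lt_cof (by rw [hκ.cof_ord]; exact hcard i hi) fun x => hF x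
  refine ⟨δ, hδ, fun x hx hP => ?_⟩
  obtain ⟨j, hj, hxj⟩ := hcont δ hδ hδlim x hx
  obtain ⟨i, hi, hji, hiδ⟩ := hcl j hj
  have hxi : F x ≤ ⨆ x : G i, F x :=
    Ordinal.le_iSup (fun x : G i => F x) ⟨x, hmono j i hji (hi.trans hδ) hxj⟩
  exact ⟨F x, hxi.trans_lt hiδ, (csInf_mem (s := {i | i < κ.ord ∧ P x i}) ⟨δ, hδ, hP⟩).2⟩

end Reflection

section Chain

variable {L : FirstOrder.Language.{u, v}}

theorem aleph0_le_theoryCard (T : L.Theory) : ℵ₀ ≤ theoryCard T :=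
  le_max_left _ _

theorem mk_formula_le (T : L.Theory) (α : Type) [Countable α] : #(L.Formula α) ≤ theoryCard T := by
  have hinj : #(L.Formula α) ≤ #(Σ n, L.BoundedFormula α n) :=
    Cardinal.mk_le_of_injective (f := fun φ : L.Formula α => (⟨0, φ⟩ : Σ n, L.BoundedFormula α n))
      fun φ ψ h => eq_of_heq (Sigma.mk.inj h).2
  refine hinj.trans (BoundedFormula.card_le.trans (max_le (le_max_left _ _) ?_))
  refine Cardinal.add_le_of_le (le_max_left _ _) (le_trans ?_ (le_max_left _ _)) ?_
  · exact Cardinal.lift_le_aleph0.2 Cardinal.mk_le_aleph0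
  · rw [Cardinal.lift_uzero]
    exact le_max_right _ _

theorem mk_sigma_le {ι : Type w'} {F : ι → Type w} {ν : Cardinal.{max w' w}} (hν : ℵ₀ ≤ ν)
    (hι : Cardinal.lift.{w} #ι ≤ ν) (hF : ∀ i, Cardinal.lift.{w'} #(F i) ≤ ν) :
    #(Σ i, F i) ≤ ν := by
  rw [Cardinal.mk_sigma]
  exact (Cardinal.sum_le_lift_mk_mul_iSup_lift _).trans
    ((mul_le_mul' hι (ciSup_le' hF)).trans (Cardinal.mul_eq_self hν).le)

variable {U : Type (max u v w)}

theorem mk_formula_with_params_le (T : L.Theory) {S : Type (max u v)} (hS : #S ≤ theoryCard T)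
    (β : S → Type) [∀ s, Countable (β s)] {ν : Cardinal.{max u v w}}
    (hTν : Cardinal.lift.{w} (theoryCard T) ≤ ν) {A : Set U} (hA : #A ≤ ν) :
    #{x : Σ s, Σ t, L.Formula (β s ⊕ Fin t) × (Fin t → U) | ∀ i, x.2.2.2 i ∈ A} ≤ ν := by
  have hν : ℵ₀ ≤ ν := (Cardinal.aleph0_le_lift.2 (aleph0_le_theoryCard T)).trans hTν
  let Y := Σ s, Σ t, L.Formula (β s ⊕ Fin t) × (Fin t → A)
  suffices hY : #Y ≤ ν by
    refine (Cardinal.mk_le_of_surjective (f := fun y : Y =>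
      ⟨⟨y.1, y.2.1, y.2.2.1, fun i => y.2.2.2 i⟩, fun i => (y.2.2.2 i).2⟩) ?_).trans hY
    rintro ⟨⟨s, t, χ, e⟩, he⟩
    exact ⟨⟨s, t, χ, fun i => ⟨e i, he i⟩⟩, rfl⟩
  have htuple : ∀ t, #(Fin t → A) ≤ ν := fun t => by
    rw [Cardinal.mk_arrow, Cardinal.mk_fin, Cardinal.lift_natCast, Cardinal.lift_id',
      Cardinal.power_natCast]
    exact (pow_le_pow_left' hA t).trans (Cardinal.power_nat_le hν)
  have hSν : Cardinal.lift.{max u v w} #S ≤ ν := by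
    rw [Cardinal.lift_umax.{max u v, w}]
    exact (Cardinal.lift_le.2 hS).trans hTν
  refine mk_sigma_le hν hSν fun s => ?_
  rw [Cardinal.lift_id'.{max u v, max u v w}]
  refine mk_sigma_le hν (by simpa using hν) fun t => ?_
  rw [Cardinal.lift_id'.{0, max u v w}, Cardinal.mk_prod, Cardinal.lift_id'.{max u v, max u v w},
    Cardinal.lift_umax.{max u v, w}]
  exact (mul_le_mul' ((Cardinal.lift_le.2 (mk_formula_le T _)).trans hTν) (htuple t)).trans
    (Cardinal.mul_eq_self hν).le

variable [L.Structure U] [Nonempty U]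

/-- A pressing down argument: along a continuous chain of regular length `κ > |T|`, every condition
over the model `N δ` satisfied by `b δ` is already satisfied by some earlier `b j` of the same
shape, so `tp(b δ / N δ)` is finitely satisfiable in the set of these earlier tuples. -/
theorem exists_coheir_of_chain {T : L.Theory} {κ : Cardinal.{max u v w}}
    (hκ : κ.IsRegular) (hTκ : Cardinal.lift.{w} (theoryCard T) < κ)
    {N : Ordinal.{max u v w} → L.ElementarySubstructure U}
    (hN : ∀ i j, i ≤ j → j < κ.ord → N i ≤ N j)
    (hlim : ∀ i < κ.ord, Order.IsSuccLimit i → (N i : Set U) = ⋃ j < i, (N j : Set U))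
    (hcard : ∀ i < κ.ord, #(N i) < κ) {S : Type (max u v)} (hS : #S ≤ theoryCard T)
    {β : S → Type} [∀ s, Countable (β s)] (s : Ordinal.{max u v w} → S)
    (b : ∀ i, β (s i) → U) :
    ∃ δ < κ.ord, ∃ D : Ultrafilter (β (s δ) → U),
      RealizesOver (N δ : Set U) (limitType L D) (b δ) ∧
      {b' | ∃ j < δ, (⟨s j, b j⟩ : Σ s, β s → U) = ⟨s δ, b'⟩} ∈ D := by
  let X := Σ s, Σ t, L.Formula (β s ⊕ Fin t) × (Fin t → U)
  let P : X → Ordinal.{max u v w} → Prop :=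
    fun x j => ∃ b', (⟨s j, b j⟩ : Σ s, β s → U) = ⟨x.1, b'⟩ ∧
      x.2.2.1.Realize (Sum.elim b' x.2.2.2)
  obtain ⟨δ, hδ, hP⟩ : ∃ δ < κ.ord,
      ∀ x : X, (∀ l, x.2.2.2 l ∈ N δ) → P x δ → ∃ j < δ, P x j := by
    refine exists_reflecting_ordinal hκ
      ((Cardinal.aleph0_le_lift.2 (aleph0_le_theoryCard T)).trans_lt hTκ)
      (fun i => {x : X | ∀ l, x.2.2.2 l ∈ (N i : Set U)})
      (fun i j hij hj x hx l => hN i j hij hj (hx l)) (fun i hi => (mk_formula_with_params_le T hS β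
        (le_max_left _ _) (le_max_right _ #(N i))).trans_lt (max_lt hTκ (hcard i hi)))
      (fun i hi hilim x hx => ?_) P
    have hx' : ∀ l, ∃ j < i, x.2.2.2 l ∈ N j := fun l => by
      simpa only [Set.mem_iUnion₂, exists_prop, SetLike.mem_coe] using
        (hlim i hi hilim).subset (hx l)
    choose f hf hf' using hx'
    have hj : Finset.univ.sup f < i := (Finset.sup_lt_iff hilim.bot_lt).2 fun l _ => hf l
    exact ⟨_, hj, fun l => hN _ _ (Finset.le_sup (Finset.mem_univ l)) (hj.trans hi) (hf' l)⟩
  obtain ⟨D, hD, hb⟩ : ∃ D : Ultrafilter (β (s δ) → U),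
      ↑D ≤ Filter.principal {b' | ∃ j < δ, (⟨s j, b j⟩ : Σ s, β s → U) = ⟨s δ, b'⟩} ∧
      RealizesOver (N δ : Set U) (limitType L D) (b δ) :=
    exists_ultrafilter_le_realizesOver fun k χ e he hχ => by
      obtain ⟨j, hj, b', hb', hχ'⟩ := hP ⟨s δ, k, χ, e⟩ he ⟨b δ, rfl, hχ⟩
      exact Filter.frequently_principal.2 ⟨b', ⟨j, hj, hb'⟩, hχ'⟩
  exact ⟨δ, hδ, D, hb, hD (Filter.mem_principal_self _)⟩

theorem not_hasKimForkingChain {T : L.Theory} (hT : NSOP1 T) [U ⊨ T] {κ : Cardinal.{max u v w}}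
    (hκ : κ.IsRegular) (hTκ : Cardinal.lift.{w} (theoryCard T) < κ)
    (hU : IsSaturated L U κ) : ¬ HasKimForkingChain L U κ := by
  classical
  rintro ⟨n, N, m, k, φ, c, d, hN, hlim, hcard, hd, hc, hfork, hcon⟩
  let S : Type (max u v) := Σ p : ℕ × ℕ, L.Formula (Fin n ⊕ (Fin p.1 ⊕ Fin p.2))
  have hS : #S ≤ theoryCard T := mk_sigma_le (aleph0_le_theoryCard T)
    (by simpa using aleph0_le_theoryCard T) fun p => by simpa using mk_formula_le T _
  obtain ⟨δ, hδ, D, hD, hZ⟩ := exists_coheir_of_chain hκ hTκ hN hlim hcard hS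
    (β := fun s => Fin s.1.1 ⊕ Fin s.1.2) (fun i => ⟨(m i, k i), φ i⟩)
    fun i => Sum.elim (c i) (d i)
  have hmem : ∀ j < δ, ∀ t, Sum.elim (c j) (d j) t ∈ N δ := fun j hj => Sum.rec
    (fun t => hN _ _ (Order.add_one_le_of_lt hj) hδ (hc j (hj.trans hδ) t))
    fun t => hN _ _ hj.le hδ (hd j (hj.trans hδ) t)
  have hκ' : ℵ₀ < κ := (Cardinal.aleph0_le_lift.2 (aleph0_le_theoryCard T)).trans_lt hTκ
  refine (hfork δ hδ).not_consistent hT hU hκ' (hcard δ hδ) ?_ hD hZ fun F => ?_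
  · filter_upwards [hZ] with b' ⟨j, hj, hb'⟩
    exact (congrArg (fun y => ∀ t, y.2 t ∈ N δ) hb').mp (hmem j hj)
  · choose j hj hj' using fun b' : {b' | ∃ j < δ, _} => id b'.2
    obtain ⟨x, hx⟩ := hcon (F.image fun b' => ⟨j b', (hj b').trans hδ⟩)
    exact ⟨x, fun b' hb' => (congrArg (fun y => y.1.2.Realize (Sum.elim x y.2)) (hj' b')).mp
      (hx _ (Finset.mem_image_of_mem _ hb'))⟩

end Chain

section Hull

variable {L : FirstOrder.Language.{u, v}}

/-- The image of an elementary substructure under an elementary embedding. -/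
def mapElementary {M : Type w} [L.Structure M] {U : Type w'} [L.Structure U] (g : M ↪ₑ[L] U)
    (S : L.ElementarySubstructure M) : L.ElementarySubstructure U where
  toSubstructure := S.toSubstructure.map g.toEmbedding.toHom
  isElementary' := by
    intro n φ x
    let f : S ≃[L] S.toSubstructure.map g.toEmbedding.toHom :=
      g.toEmbedding.substructureEquivMap S.toSubstructure
    obtain ⟨y, rfl⟩ : ∃ y : Fin n → S, f ∘ y = x :=
      ⟨f.symm ∘ x, funext fun i => f.apply_symm_apply (x i)⟩
    exact ((g.comp S.subtype).map_formula φ y).trans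
      (f.toElementaryEmbedding.map_formula φ y).symm

variable {M : Type w} [L.Structure M] [(L.sum L.skolem₁).Structure M]

variable (L M) in
/-- The function symbols of `L.skolem₁` are interpreted by Skolem functions. -/
def IsSkolem : Prop :=
  ∀ (n : ℕ) (φ : L.BoundedFormula Empty (n + 1)) (x : Fin n → M) (a : M),
    φ.Realize default (Fin.snoc x a : Fin (n + 1) → M) →
      φ.Realize default (Fin.snoc x (Structure.funMap
        ((LHom.sumInr : L.skolem₁ →ᴸ L.sum L.skolem₁).onFunction (n := n) φ) x) : Fin (n + 1) → M)

variable [(LHom.sumInl : L →ᴸ L.sum L.skolem₁).IsExpansionOn M]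

/-- The Skolem hull of a set. -/
def skolemHull (h : IsSkolem L M) (s : Set M) : L.ElementarySubstructure M :=
  ((LHom.sumInl : L →ᴸ L.sum L.skolem₁).substructureReduct
    (Substructure.closure (L.sum L.skolem₁) s)).toElementarySubstructure fun n φ x a ha =>
      ⟨⟨_, (Substructure.closure (L.sum L.skolem₁) s).fun_mem
        ((LHom.sumInr : L.skolem₁ →ᴸ L.sum L.skolem₁).onFunction (n := n) φ)
          (fun i => (x i : M)) fun i => (x i).2⟩, h n φ _ a ha⟩

theorem subset_skolemHull (h : IsSkolem L M) (s : Set M) : s ⊆ skolemHull h s :=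
  Substructure.subset_closure

theorem skolemHull_mono (h : IsSkolem L M) {s t : Set M} (hst : s ⊆ t) :
    skolemHull h s ≤ skolemHull h t :=
  fun _ hx => Substructure.closure_mono hst hx

theorem exists_mem_skolemHull (h : IsSkolem L M) {s : Ordinal.{w'} → Set M} (hs : Monotone s)
    {i : Ordinal.{w'}} (hi : Order.IsSuccLimit i) (hsi : ∀ x ∈ s i, ∃ j < i, x ∈ s j) {x : M}
    (hx : x ∈ skolemHull h (s i)) : ∃ j < i, x ∈ skolemHull h (s j) := by
  refine Substructure.closure_induction (L := L.sum L.skolem₁)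
    (p := fun x => ∃ j < i, x ∈ skolemHull h (s j)) hx (fun x hx => ?_) fun {n} f x hx => ?_
  · obtain ⟨j, hj, hxj⟩ := hsi x hx
    exact ⟨j, hj, subset_skolemHull h _ hxj⟩
  · choose k hk hk' using hx
    refine ⟨Finset.univ.sup k, (Finset.sup_lt_iff hi.bot_lt).2 fun t _ => hk t, ?_⟩
    exact (Substructure.closure (L.sum L.skolem₁) (s (Finset.univ.sup k))).fun_mem f x fun t =>
      skolemHull_mono h (hs (Finset.le_sup (Finset.mem_univ t))) (hk' t)

/-- The chain of images of Skolem hulls of initial segments of a sequence of sets. -/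
def hullChain {U : Type*} [L.Structure U] (g : M ↪ₑ[L] U) (h : IsSkolem L M) (B : Set M)
    (A : Ordinal.{w'} → Set M) (i : Ordinal.{w'}) : L.ElementarySubstructure U :=
  mapElementary g (skolemHull h (B ∪ ⋃ j < i, A j))

variable {U : Type*} [L.Structure U] (g : M ↪ₑ[L] U) (h : IsSkolem L M) (B : Set M)
    (A : Ordinal.{w'} → Set M)

theorem hullChain_mono {i j : Ordinal.{w'}} (hij : i ≤ j) :
    hullChain g h B A i ≤ hullChain g h B A j :=
  Set.image_mono (skolemHull_mono h (Set.union_subset_union_right B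
    (Set.biUnion_subset_biUnion_left fun _ hk => lt_of_lt_of_le hk hij)))

theorem hullChain_limit {i : Ordinal.{w'}} (hi : Order.IsSuccLimit i) :
    (hullChain g h B A i : Set U) = ⋃ j < i, (hullChain g h B A j : Set U) := by
  apply Set.Subset.antisymm
  · rintro _ ⟨x, hx, rfl⟩
    have hunion : ∀ x ∈ B ∪ ⋃ j < i, A j, ∃ j < i, x ∈ B ∪ ⋃ k < j, A k := by
      rintro x (hx | hx)
      · exact ⟨0, hi.bot_lt, Or.inl hx⟩
      · obtain ⟨j, hj, hxj⟩ := Set.mem_iUnion₂.1 hx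
        exact ⟨_, hi.succ_lt hj, Or.inr (Set.mem_iUnion₂.2 ⟨j, Order.lt_succ j, hxj⟩)⟩
    obtain ⟨j, hj, hxj⟩ := exists_mem_skolemHull h (s := fun i => B ∪ ⋃ j < i, A j)
      (fun i j hij => Set.union_subset_union_right B
        (Set.biUnion_subset_biUnion_left fun _ hk => lt_of_lt_of_le hk hij)) hi hunion hx
    exact Set.mem_iUnion₂.2 ⟨j, hj, x, hxj, rfl⟩
  · exact Set.iUnion₂_subset fun j hj => hullChain_mono g h B A hj.le

theorem mem_hullChain_succ {i : Ordinal.{w'}} {x : M} (hx : x ∈ A i) :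
    g x ∈ hullChain g h B A (i + 1) :=
  ⟨x, subset_skolemHull h _ (Or.inr (Set.mem_iUnion₂.2 ⟨i, lt_add_one i, hx⟩)), rfl⟩

end Hull

section HullCard

theorem mk_union_biUnion_le {M : Type w} {B : Set M} {A : Ordinal.{w} → Set M} (hB : B.Countable)
    (hA : ∀ i, (A i).Countable) {i : Ordinal.{w}} {c : Cardinal.{w}} (hc : ℵ₀ ≤ c)
    (hi : i.card ≤ c) : #(B ∪ ⋃ j < i, A j : Set M) ≤ c :=
  (Cardinal.mk_union_le _ _).trans (Cardinal.add_le_of_le hc (hB.le_aleph0.trans hc)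
    (Cardinal.mk_biUnion_le_of_le hi hc A fun j _ => (hA j).le_aleph0.trans hc))

variable {L : FirstOrder.Language.{u, v}} {M : Type (max u v w)} [L.Structure M]
  [(L.sum L.skolem₁).Structure M] [(LHom.sumInl : L →ᴸ L.sum L.skolem₁).IsExpansionOn M]

theorem mk_skolemHull_le (T : L.Theory) (h : IsSkolem L M) {s : Set M}
    {c : Cardinal.{max u v w}} (hc : Cardinal.lift.{w} (theoryCard T) ≤ c) (hs : #s ≤ c) :
    #(skolemHull h s) ≤ c := by
  have hc₀ : ℵ₀ ≤ c := (Cardinal.aleph0_le_lift.2 (aleph0_le_theoryCard T)).trans hc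
  have hcl := Substructure.lift_card_closure_le (L := L.sum L.skolem₁) (s := s)
  rw [Cardinal.lift_id'.{max u v, max u v w}, Cardinal.lift_id'.{max u v, max u v w}] at hcl
  refine hcl.trans (max_le hc₀ (Cardinal.add_le_of_le hc₀ hs ?_))
  rw [Cardinal.lift_umax.{max u v, w}]
  exact (Cardinal.lift_le.2 card_functions_sum_skolem₁_le).trans hc

theorem mk_hullChain_lt (T : L.Theory) {U : Type (max u v w)} [L.Structure U] (g : M ↪ₑ[L] U)
    (h : IsSkolem L M) {B : Set M} {A : Ordinal.{max u v w} → Set M} (hB : B.Countable)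
    (hA : ∀ i, (A i).Countable) {κ : Cardinal.{max u v w}}
    (hκ : Cardinal.lift.{w} (theoryCard T) < κ)
    {i : Ordinal.{max u v w}} (hi : i < κ.ord) : #(hullChain g h B A i) < κ := by
  let c := max i.card (Cardinal.lift.{w} (theoryCard T))
  have hc : ℵ₀ ≤ c :=
    (Cardinal.aleph0_le_lift.2 (aleph0_le_theoryCard T)).trans (le_max_right _ _)
  have hhull : #(skolemHull h (B ∪ ⋃ j < i, A j)) ≤ c :=
    mk_skolemHull_le T h (le_max_right _ _) (mk_union_biUnion_le hB hA hc (le_max_left _ _))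
  exact (Cardinal.mk_image_le.trans hhull).trans_lt (max_lt (Cardinal.lt_ord.1 hi) hκ)

end HullCard

section HullChain

variable {L : FirstOrder.Language.{u, v}}

theorem KimForks.of_imp {U : Type w} [L.Structure U] {A : Set U} {n : ℕ} {β γ : Type}
    {θ : L.Formula (Fin n ⊕ β)} {b : β → U} {φ : L.Formula (Fin n ⊕ γ)} {c : γ → U}
    (h : KimForks A θ b)
    (himp : ∀ x : Fin n → U, φ.Realize (Sum.elim x c) → θ.Realize (Sum.elim x b)) :
    KimForks A φ c := by
  obtain ⟨k, m, ψ, d, hψ, hdiv⟩ := h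
  exact ⟨k, m, ψ, d, fun x hx => hψ x (himp x hx), hdiv⟩

theorem hasKimForkingChain_of_hullChain (T : L.Theory) {M U : Type (max u v w)} [L.Structure M]
    [L.Structure U] [(L.sum L.skolem₁).Structure M]
    [(LHom.sumInl : L →ᴸ L.sum L.skolem₁).IsExpansionOn M] (g : M ↪ₑ[L] U) (h : IsSkolem L M)
    {B : Set M} (hB : B.Countable) {A : Ordinal.{max u v w} → Set M} (hA : ∀ i, (A i).Countable)
    {κ : Cardinal.{max u v w}} (hκ : Cardinal.lift.{w} (theoryCard T) < κ) {n : ℕ}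
    {m : Ordinal.{max u v w} → ℕ} (φ : ∀ i, L.Formula (Fin n ⊕ Fin (m i)))
    (c : ∀ i, Fin (m i) → M) (hc : ∀ i t, c i t ∈ A i)
    (hfork : ∀ i < κ.ord, KimForks (hullChain g h B A i : Set U) (φ i) (g ∘ c i))
    (hcon : Consistent fun (i : Set.Iio κ.ord) (x : Fin n → M) =>
      (φ i).Realize (Sum.elim x (c i))) : HasKimForkingChain L U κ := by
  have hreal : ∀ i (x : Fin n → U), ((φ i).relabel (Sum.map id Sum.inl) :
      L.Formula (Fin n ⊕ (Fin (m i) ⊕ Fin 0))).Realize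
        (Sum.elim x (Sum.elim (g ∘ c i) Fin.elim0)) ↔ (φ i).Realize (Sum.elim x (g ∘ c i)) :=
    fun i x => by
      rw [Formula.realize_relabel, Sum.elim_comp_map, Sum.elim_comp_inl, Function.comp_id]
  refine ⟨n, hullChain g h B A, m, fun _ => 0, fun i => (φ i).relabel (Sum.map id Sum.inl),
    fun i => g ∘ c i, fun _ => Fin.elim0, fun i j hij _ => hullChain_mono g h B A hij,
    fun i _ hi => hullChain_limit g h B A hi, fun i hi => mk_hullChain_lt T g h hB hA hκ hi,
    fun _ _ t => t.elim0, fun i _ t => mem_hullChain_succ g h B A (hc i t),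
    fun i hi => (hfork i hi).of_imp fun x => (hreal i x).1, fun s => ?_⟩
  obtain ⟨x, hx⟩ := hcon s
  refine ⟨g ∘ x, fun i hi => (hreal i _).2 ?_⟩
  rw [← Sum.comp_elim]
  exact (g.map_formula _ _).2 (hx i hi)

end HullChain

section SmallBase

variable {L : FirstOrder.Language.{u, v}}

theorem isSkolem_of_nonempty {M : Type w} [L.Structure M] [Nonempty M] : IsSkolem L M :=
  fun n φ x a h => Classical.epsilon_spec (p := fun a => φ.Realize default
    (Fin.snoc x a : Fin (n + 1) → M)) ⟨a, h⟩

theorem not_typeKimForks_self {U : Type w} [L.Structure U] (M : L.ElementarySubstructure U) {n : ℕ}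
    (p : (L.elementaryDiagram M).CompleteType (Fin n)) : ¬ TypeKimForks (M : Set U) p := by
  rintro ⟨k, θ, m, l, φ, b, hθ, hφ, K, r, ψ, c, himp, hdiv⟩
  obtain ⟨a, ha⟩ := exists_realize_of_has (ι := Unit) (φ := fun _ => θ) (e := fun _ => m)
    fun _ => hθ
  obtain ⟨i, hi⟩ : ∃ i, (ψ i).Realize (Sum.elim (M.subtype ∘ a) (c i)) := by
    refine himp _ (hφ _ ?_)
    change θ.Realize (Sum.elim (M.subtype ∘ a) (M.subtype ∘ m))
    rw [← Sum.comp_elim]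
    exact (M.subtype.map_formula θ _).2 (ha ())
  obtain ⟨q, -, hqc, d, hd, hcon⟩ := hdiv i
  have haM : ∀ t, (M.subtype ∘ a) t ∈ (M : Set U) := fun t => (a t).2
  have ha : Has q ((ψ i).relabel Sum.swap) (M.subtype ∘ a) := by
    rwa [hqc.has_iff _ haM, Formula.realize_relabel, Sum.elim_swap]
  refine hcon fun s => ⟨M.subtype ∘ a, fun j _ => ?_⟩
  rwa [(hd j).has_iff _ fun t => Or.inl (haM t), Formula.realize_relabel, Sum.elim_swap] at ha

theorem TypeKimForks.exists_kimForks {U : Type w} [L.Structure U] {A : Set U}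
    {M : L.ElementarySubstructure U} {n : ℕ} {p : (L.elementaryDiagram M).CompleteType (Fin n)}
    (h : TypeKimForks A p) : ∃ (k : ℕ) (θ : L.Formula (Fin n ⊕ Fin k)) (m : Fin k → M),
      Has p θ m ∧ KimForks A θ (M.subtype ∘ m) := by
  obtain ⟨k, θ, m, l, φ, b, hθ, hφ, hfork⟩ := h
  exact ⟨k, θ, m, hθ, hfork.of_imp hφ⟩

theorem exists_kimForks_hullChain {T : L.Theory} {U : Type (max u v w)} [L.Structure U]
    {M : L.ElementarySubstructure U} [(L.sum L.skolem₁).Structure M]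
    [(LHom.sumInl : L →ᴸ L.sum L.skolem₁).IsExpansionOn M] (hsk : IsSkolem L M) {n : ℕ}
    {p : (L.elementaryDiagram M).CompleteType (Fin n)}
    (hp : ∀ M' : L.ElementarySubstructure U, M' ≤ M →
      #M' ≤ Cardinal.lift.{w} (theoryCard T) → TypeKimForks (M' : Set U) p) :
    ∃ (m : Ordinal.{max u v w} → ℕ) (φ : ∀ i, L.Formula (Fin n ⊕ Fin (m i)))
      (c : ∀ i, Fin (m i) → M),
      ∀ i < (Order.succ (Cardinal.lift.{w} (theoryCard T))).ord, Has p (φ i) (c i) ∧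
        KimForks (hullChain M.subtype hsk ∅ (fun j => Set.range (c j)) i : Set U) (φ i)
          (M.subtype ∘ c i) := by
  let ν : Cardinal.{max u v w} := Cardinal.lift.{w} (theoryCard T)
  have hpick : ∀ S : Set M, ∃ d : Σ k : ℕ, L.Formula (Fin n ⊕ Fin k) × (Fin k → M), #S ≤ ν →
      Has p d.2.1 d.2.2 ∧ KimForks (mapElementary M.subtype (skolemHull hsk S) : Set U) d.2.1
        (M.subtype ∘ d.2.2) := fun S => by
    by_cases hS : #S ≤ ν
    · have hle : mapElementary M.subtype (skolemHull hsk S) ≤ M := by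
        rintro _ ⟨x, -, rfl⟩
        exact x.2
      obtain ⟨k, θ, m, hθ⟩ := (hp _ hle
        (Cardinal.mk_image_le.trans (mk_skolemHull_le T hsk le_rfl hS))).exists_kimForks
      exact ⟨⟨k, θ, m⟩, fun _ => hθ⟩
    · exact ⟨⟨0, ⊤, Fin.elim0⟩, fun h => (hS h).elim⟩
  choose pick hpick using hpick
  obtain ⟨d, hd⟩ : ∃ d : Ordinal.{max u v w} → Σ k : ℕ, L.Formula (Fin n ⊕ Fin k) × (Fin k → M),
      ∀ i, d i = pick (∅ ∪ ⋃ j < i, Set.range (d j).2.2) :=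
    ⟨WellFounded.fix Ordinal.lt_wf fun i d =>
      pick (∅ ∪ ⋃ (j) (h : j < i), Set.range (d j h).2.2), fun i => WellFounded.fix_eq _ _ _⟩
  refine ⟨fun i => (d i).1, fun i => (d i).2.1, fun i => (d i).2.2, fun i hi => ?_⟩
  have := hpick (∅ ∪ ⋃ j < i, Set.range (d j).2.2) (mk_union_biUnion_le Set.countable_empty
    (fun j => Set.countable_range _) (Cardinal.aleph0_le_lift.2 (aleph0_le_theoryCard T))
      (Order.lt_succ_iff.1 (Cardinal.lt_ord.1 hi)))
  rwa [← hd i] at this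

theorem exists_not_typeKimForks {T : L.Theory} (hT : NSOP1 T) {U : Type (max u v w)}
    [L.Structure U] [Nonempty U] [U ⊨ T] (M : L.ElementarySubstructure U)
    (hU : IsSaturated L U (Order.succ #M)) {n : ℕ}
    (p : (L.elementaryDiagram M).CompleteType (Fin n)) :
    ∃ M' : L.ElementarySubstructure U, M' ≤ M ∧ #M' ≤ Cardinal.lift.{w} (theoryCard T) ∧
      ¬ TypeKimForks (M' : Set U) p := by
  rcases le_or_gt #M (Cardinal.lift.{w} (theoryCard T)) with hM | hM
  · exact ⟨M, le_rfl, hM, not_typeKimForks_self M p⟩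
  by_contra! hp
  obtain ⟨m, φ, c, hφ⟩ := exists_kimForks_hullChain isSkolem_of_nonempty hp
  refine not_hasKimForkingChain hT
    (Cardinal.isRegular_succ (Cardinal.aleph0_le_lift.2 (aleph0_le_theoryCard T)))
    (Order.lt_succ _) (hU.mono (Order.succ_le_succ hM.le))
    (hasKimForkingChain_of_hullChain T M.subtype isSkolem_of_nonempty Set.countable_empty
      (fun i => Set.countable_range (c i)) (Order.lt_succ _) φ c (fun i => Set.mem_range_self)
      (fun i hi => (hφ i hi).2) fun s => ?_)
  obtain ⟨x, hx⟩ := exists_realize_of_has (ι := Fin s.card)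
    (φ := fun i => φ (s.equivFin.symm i).1) fun i => (hφ _ (s.equivFin.symm i).1.2).1
  refine ⟨x, fun i hi => ?_⟩
  obtain ⟨j, rfl⟩ : ∃ j, (s.equivFin.symm j).1 = i := ⟨s.equivFin ⟨i, hi⟩, by simp⟩
  exact hx j

end SmallBase

section WitnessTasks

variable (L : FirstOrder.Language.{u, v}) (N : Type w) (K : Type w)

/-- Names for the elements of a saturated elementary extension of `N`: the elements of `N`, and
witnesses for sets of formulas over `K`-indexed families of names. -/
inductive ElementName : Type (max u v w)
  | base : N → ElementName
  | wit : (K → ElementName) → (n : ℕ) → Set (L.Formula (Fin n ⊕ K)) → Fin n → ElementName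

/-- A set of formulas over a `K`-indexed family of names, to be realized by the tuple
`WitnessTask.wit` of new names. -/
structure WitnessTask where
  /-- The parameters. -/
  param : K → ElementName L N K
  /-- The number of variables. -/
  arity : ℕ
  /-- The formulas to be realized. -/
  formulas : Set (L.Formula (Fin arity ⊕ K))

/-- Every finite subset of `Γ` has a realization. -/
def FinitelySatisfiable {L : FirstOrder.Language.{u, v}} {α : Type w'}
    (Γ : Set (L.Formula α)) : Prop :=
  ∀ s : Finset (L.Formula α), (s : Set (L.Formula α)) ⊆ Γ →
    ∃ (M : Type (max u v w')) (_ : L.Structure M) (_ : Nonempty M) (v : α → M), ∀ φ ∈ s, φ.Realize v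

variable {L N K}

namespace WitnessTask

/-- The names of the realization of a task. -/
def wit (τ : WitnessTask L N K) : Fin τ.arity → ElementName L N K :=
  ElementName.wit τ.param τ.arity τ.formulas

/-- The formulas expressing that a task is fulfilled. -/
def demand (τ : WitnessTask L N K) : Set (L.Formula (ElementName L N K)) :=
  (fun φ => φ.relabel (Sum.elim τ.wit τ.param)) '' τ.formulas

theorem realize_demand_iff {τ : WitnessTask L N K} {W : Type*} [L.Structure W]
    {v : ElementName L N K → W} : (∀ φ ∈ τ.demand, φ.Realize v) ↔
      ∀ φ ∈ τ.formulas, φ.Realize (Sum.elim (v ∘ τ.wit) (v ∘ τ.param)) := by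
  simp only [demand, Set.forall_mem_image, Formula.realize_relabel, Sum.comp_elim]

/-- The task `τ'` has a witness of `τ` among its parameters. -/
def Precedes (τ τ' : WitnessTask L N K) : Prop := ∃ k t, τ'.param k = τ.wit t

theorem wellFounded_precedes : WellFounded (Precedes (L := L) (N := N) (K := K)) := by
  have hacc : ∀ (x : ElementName L N K) (τ : WitnessTask L N K) t, x = τ.wit t →
      Acc Precedes τ := fun x => by
    induction x with
    | base => intro τ t h; cases h
    | wit f n Γ t ih =>
      rintro ⟨f', n', Γ'⟩ t' h
      obtain ⟨rfl, -⟩ := ElementName.wit.inj h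
      exact Acc.intro _ fun τ ⟨k, s, hs⟩ => ih k τ s hs
  exact ⟨fun τ => Acc.intro _ fun τ' ⟨k, t, h⟩ => hacc _ τ' t h⟩

theorem eq_of_wit_eq {τ τ' : WitnessTask L N K} {t : Fin τ.arity} {t' : Fin τ'.arity}
    (h : τ.wit t = τ'.wit t') : τ = τ' := by
  obtain ⟨f, n, Γ⟩ := τ
  obtain ⟨f', n', Γ'⟩ := τ'
  obtain ⟨rfl, rfl, hΓ, -⟩ := ElementName.wit.inj h
  obtain rfl := eq_of_heq hΓ
  rfl

theorem wit_injective (τ : WitnessTask L N K) : Function.Injective τ.wit :=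
  fun _ _ h => eq_of_heq (ElementName.wit.inj h).2.2.2

end WitnessTask

end WitnessTasks

section TaskModel

variable {L : FirstOrder.Language.{u, v}} {N : Type (max u v w)} {K : Type (max u v w)}
  [L.Structure N]

variable (L N K) in
/-- The elementary diagram of `N`, as a set of formulas in the names of its elements. -/
def diagramFormulas : Set (L.Formula (ElementName L N K)) :=
  (fun φ : L.Formula N => φ.relabel ElementName.base) '' {φ | φ.Realize id}

theorem realize_diagramFormulas_iff {W : Type*} [L.Structure W] {v : ElementName L N K → W} :
    (∀ φ ∈ diagramFormulas L N K, φ.Realize v) ↔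
      ∀ φ : L.Formula N, φ.Realize id → φ.Realize (v ∘ ElementName.base) := by
  simp only [diagramFormulas, Set.forall_mem_image, Formula.realize_relabel, Set.mem_ofPred_eq]

namespace WitnessTask

variable (lt : WitnessTask L N K → WitnessTask L N K → Prop) [IsWellOrder _ lt]

/-- The tasks accepted by the recursion along the well-order `lt` which accepts a task when its
demand is consistent with the elementary diagram of `N` and the demands accepted so far. -/
def Accepted : WitnessTask L N K → Prop :=
  IsWellFounded.fix lt fun τ G => FinitelySatisfiable (diagramFormulas L N K ∪
    (⋃ (τ') (h : lt τ' τ) (_ : G τ' h), τ'.demand) ∪ τ.demand)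

/-- The formulas which have to be consistent for `τ` to be accepted. -/
def stage (τ : WitnessTask L N K) : Set (L.Formula (ElementName L N K)) :=
  diagramFormulas L N K ∪ (⋃ (τ') (_ : lt τ' τ) (_ : Accepted lt τ'), τ'.demand) ∪ τ.demand

theorem accepted_iff {τ : WitnessTask L N K} :
    Accepted lt τ ↔ FinitelySatisfiable (stage lt τ) := by
  rw [Accepted, IsWellFounded.fix_eq]
  rfl

theorem stage_subset_stage {σ τ : WitnessTask L N K} (hσ : Accepted lt σ) (h : lt σ τ) :
    stage lt σ ⊆ stage lt τ := by
  refine fun φ hφ => Or.inl ?_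
  rcases hφ with (hφ | hφ) | hφ
  · exact Or.inl hφ
  · obtain ⟨ρ, hρ, hφ⟩ := Set.mem_iUnion₂.1 hφ
    exact Or.inr (Set.mem_iUnion₂.2 ⟨ρ, _root_.trans (r := lt) hρ h, hφ⟩)
  · exact Or.inr (Set.mem_iUnion₂.2 ⟨σ, h, Set.mem_iUnion.2 ⟨hσ, hφ⟩⟩)

/-- The elementary diagram of `N` together with all accepted demands. -/
def acceptedFormulas : Set (L.Formula (ElementName L N K)) :=
  diagramFormulas L N K ∪ ⋃ τ ∈ {τ | Accepted lt τ}, τ.demand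

theorem finitelySatisfiable_diagramFormulas [Nonempty N] :
    FinitelySatisfiable (diagramFormulas L N K) := by
  let v : ElementName L N K → N := fun x =>
    ElementName.rec (fun y => y) (fun _ _ _ _ _ => Classical.arbitrary N) x
  have hv : v ∘ ElementName.base = id := rfl
  exact fun s hs => ⟨N, inferInstance, inferInstance, v, fun φ hφ =>
    (realize_diagramFormulas_iff (v := v)).2 (fun _ h => by rwa [hv]) φ (hs hφ)⟩

theorem finitelySatisfiable_acceptedFormulas [Nonempty N] :
    FinitelySatisfiable (acceptedFormulas lt) := by
  intro s hs
  rcases {τ | Accepted lt τ}.eq_empty_or_nonempty with hempty | hne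
  · rw [acceptedFormulas, hempty, Set.biUnion_empty, Set.union_empty] at hs
    exact finitelySatisfiable_diagramFormulas s hs
  · have hdir : DirectedOn (fun σ τ => stage lt σ ⊆ stage lt τ) {τ | Accepted lt τ} :=
      fun σ hσ τ hτ => by
        rcases trichotomous_of lt σ τ with h | rfl | h
        · exact ⟨τ, hτ, stage_subset_stage lt hσ h, subset_rfl⟩
        · exact ⟨σ, hσ, subset_rfl, subset_rfl⟩
        · exact ⟨σ, hσ, subset_rfl, stage_subset_stage lt hτ h⟩
    obtain ⟨σ, hσ⟩ := hne
    have hsub : acceptedFormulas lt ⊆ ⋃ τ ∈ {τ | Accepted lt τ}, stage lt τ :=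
      Set.union_subset (fun φ hφ => Set.mem_biUnion hσ (Or.inl (Or.inl hφ)))
        (Set.iUnion₂_mono fun τ _ => Set.subset_union_right)
    obtain ⟨τ, hτ, h⟩ :=
      hdir.exists_mem_subset_of_finset_subset_biUnion ⟨σ, hσ⟩ (hs.trans hsub)
    exact (accepted_iff lt).1 hτ s h

/-- The witnesses of `τ` may be reinterpreted at will, since no task up to `τ` mentions them. -/
theorem accepted_of_realize (hle : Precedes ≤ lt) {W : Type (max u v w)} [L.Structure W]
    [Nonempty W] {v : ElementName L N K → W} (hv : ∀ φ ∈ acceptedFormulas lt, φ.Realize v)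
    {τ : WitnessTask L N K}
    (hτ : ∀ s : Finset (L.Formula (Fin τ.arity ⊕ K)), (s : Set _) ⊆ τ.formulas →
      ∃ x : Fin τ.arity → W, ∀ φ ∈ s, φ.Realize (Sum.elim x (v ∘ τ.param))) :
    Accepted lt τ := by
  classical
  refine (accepted_iff lt).2 fun s hs => ?_
  obtain ⟨t, ht, hst⟩ := Finset.subset_set_image_iff.1
    (fun φ hφ => (Finset.mem_filter.1 hφ).2 : (↑(s.filter (· ∈ τ.demand)) : Set _) ⊆ τ.demand)
  obtain ⟨x, hx⟩ := hτ t ht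
  let v' : ElementName L N K → W := Function.extend τ.wit x v
  have hparam : ∀ σ, ¬ lt τ σ → v' ∘ σ.param = v ∘ σ.param := fun σ hσ =>
    funext fun k => Function.extend_apply' _ _ _ fun ⟨t, ht⟩ => hσ (hle _ _ ⟨k, t, ht.symm⟩)
  have hwit : ∀ σ, lt σ τ → v' ∘ σ.wit = v ∘ σ.wit := fun σ hσ =>
    funext fun k => Function.extend_apply' _ _ _ fun ⟨t, ht⟩ => by
      rw [eq_of_wit_eq ht] at hσ
      exact irrefl _ hσ
  have hbase : v' ∘ ElementName.base = v ∘ ElementName.base :=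
    funext fun y => Function.extend_apply' _ _ _ fun ⟨t, ht⟩ => by cases ht
  refine ⟨W, inferInstance, inferInstance, v', fun φ hφ => ?_⟩
  rcases hs hφ with (h | h) | h
  · refine realize_diagramFormulas_iff.2 ?_ φ h
    rw [hbase]
    exact realize_diagramFormulas_iff.1 fun ψ hψ => hv ψ (Or.inl hψ)
  · obtain ⟨σ, hσ, h⟩ := Set.mem_iUnion₂.1 h
    obtain ⟨hσ', h⟩ := Set.mem_iUnion.1 h
    refine realize_demand_iff.2 ?_ φ h
    rw [hwit σ hσ, hparam σ fun h' => irrefl σ (_root_.trans (r := lt) hσ h')]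
    exact realize_demand_iff.1 fun ψ hψ => hv ψ (Or.inr (Set.mem_biUnion hσ' hψ))
  · obtain ⟨ψ, hψ, rfl⟩ := Finset.mem_image.1 (hst ▸ Finset.mem_filter.2 ⟨hφ, h⟩)
    rw [Formula.realize_relabel, Sum.comp_elim, hparam τ (irrefl τ),
      (funext fun t => τ.wit_injective.extend_apply x v t : v' ∘ τ.wit = x)]
    exact hx ψ hψ

end WitnessTask

theorem exists_task_model [Nonempty N] :
    ∃ (W : Type (max u v w)) (_ : L.Structure W) (_ : Nonempty W) (v : ElementName L N K → W),
      (∀ φ : L.Formula N, φ.Realize id → φ.Realize (v ∘ ElementName.base)) ∧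
      ∀ τ : WitnessTask L N K,
        (∀ s : Finset (L.Formula (Fin τ.arity ⊕ K)), (s : Set _) ⊆ τ.formulas →
          ∃ x : Fin τ.arity → W, ∀ φ ∈ s, φ.Realize (Sum.elim x (v ∘ τ.param))) →
        ∀ φ ∈ τ.formulas, φ.Realize (Sum.elim (v ∘ τ.wit) (v ∘ τ.param)) := by
  have : IsWellFounded (WitnessTask L N K) WitnessTask.Precedes :=
    ⟨WitnessTask.wellFounded_precedes⟩
  obtain ⟨lt, hle, _⟩ :=
    IsWellFounded.exists_well_order_ge (WitnessTask.Precedes (L := L) (N := N) (K := K))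
  obtain ⟨W, _, _, v, hv⟩ :=
    exists_realize_of_finite _ (WitnessTask.finitelySatisfiable_acceptedFormulas lt)
  exact ⟨W, inferInstance, inferInstance, v,
    realize_diagramFormulas_iff.1 fun φ hφ => hv φ (Or.inl hφ),
    fun τ hτ => WitnessTask.realize_demand_iff.1 fun φ hφ => hv φ (Or.inr
      (Set.mem_biUnion (WitnessTask.accepted_of_realize lt hle hv hτ) hφ))⟩

end TaskModel

section SaturatedExtension

variable {L : FirstOrder.Language.{u, v}} {W : Type w} [L.Structure W]

variable (L) in
/-- Every set of formulas in finitely many variables with at most `κ` parameters from `R` which is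
finitely satisfiable in the ambient structure is realized by a tuple from `R`. -/
def SaturatedIn (R : Set W) (κ : Cardinal.{w}) : Prop :=
  ∀ (δ : Type w) (e : δ → W), #δ ≤ κ → (∀ d, e d ∈ R) → ∀ (n : ℕ) (Γ : Set (L.Formula (Fin n ⊕ δ))),
    (∀ s : Finset (L.Formula (Fin n ⊕ δ)), (s : Set _) ⊆ Γ →
      ∃ x : Fin n → W, ∀ φ ∈ s, φ.Realize (Sum.elim x e)) →
    ∃ b : Fin n → W, (∀ t, b t ∈ R) ∧ ∀ φ ∈ Γ, φ.Realize (Sum.elim b e)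

theorem exists_saturatedIn (N : Type (max u v w)) [L.Structure N] [Nonempty N]
    (κ : Cardinal.{max u v w}) :
    ∃ (W : Type (max u v w)) (_ : L.Structure W) (_ : Nonempty W) (R : Set W) (g : N → R),
      (∀ φ : L.Formula N, φ.Realize id → φ.Realize fun a => (g a : W)) ∧ SaturatedIn L R κ := by
  obtain ⟨W, _, _, v, hdiag, hwit⟩ := exists_task_model (L := L) (N := N) (K := κ.out)
  refine ⟨W, inferInstance, inferInstance, Set.range v, fun a => ⟨v (.base a), _, rfl⟩, hdiag,
    fun δ e hδ he n Γ hΓ => ?_⟩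
  choose y hy using he
  obtain ⟨i⟩ : Nonempty (δ ↪ κ.out) := by rwa [← Cardinal.le_def, Cardinal.mk_out]
  let f : κ.out → ElementName L N κ.out :=
    Function.extend i y fun _ => .base (Classical.arbitrary N)
  have hf : v ∘ f ∘ i = e := funext fun t =>
    (congrArg v (i.injective.extend_apply y (fun _ => .base (Classical.arbitrary N)) t)).trans
      (hy t)
  have hrel : ∀ (φ : L.Formula (Fin n ⊕ δ)) (x : Fin n → W),
      (φ.relabel (Sum.map id i)).Realize (Sum.elim x (v ∘ f)) ↔ φ.Realize (Sum.elim x e) :=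
    fun φ x => by
      rw [Formula.realize_relabel, Sum.elim_comp_map, Function.comp_assoc, hf, Function.comp_id]
  let τ : WitnessTask L N κ.out := ⟨f, n, (fun φ => φ.relabel (Sum.map id i)) '' Γ⟩
  have hτ := hwit τ fun s hs => by
    classical
    obtain ⟨t, ht, rfl⟩ := Finset.subset_set_image_iff.1 hs
    obtain ⟨x, hx⟩ := hΓ t ht
    exact ⟨x, Finset.forall_mem_image.2 fun φ hφ => (hrel φ x).2 (hx φ hφ)⟩
  exact ⟨v ∘ τ.wit, fun t => ⟨_, rfl⟩, fun φ hφ => (hrel φ _).1 (hτ _ ⟨φ, hφ, rfl⟩)⟩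

/-- The formula obtained by turning the constants from `A` into variables. -/
noncomputable def constantsToVars {A : Type*} {n : ℕ} (φ : L[[A]].Formula (Fin n)) :
    L.Formula (Fin n ⊕ A) :=
  Formula.relabel Sum.swap (BoundedFormula.constantsVarsEquiv φ : L.Formula (A ⊕ Fin n))

theorem realize_constantsToVars {A : Set W} {n : ℕ} (φ : L[[A]].Formula (Fin n)) (x : Fin n → W) :
    (constantsToVars φ).Realize (Sum.elim x (↑)) ↔ φ.Realize x := by
  rw [constantsToVars, Formula.realize_relabel, Sum.elim_swap]
  exact BoundedFormula.realize_constantsVarsEquiv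

variable {R : Set W} {κ : Cardinal.{w}}

theorem SaturatedIn.meetsDefinable (hR : SaturatedIn L R κ) (hκ : ℵ₀ ≤ κ) :
    L.MeetsDefinable R := by
  rintro D ⟨y, hy⟩ ⟨φ, hφ⟩
  have hD : ∀ x : Fin 1 → W, x 0 ∈ D ↔ φ.Realize x := fun x => Set.ext_iff.1 hφ x
  let ψ : L.Formula (Fin 1 ⊕ R) := constantsToVars φ
  let χ : L.Formula (Fin 1 ⊕ ULift.{w} (Fin (support ψ).card)) :=
    (supportFormula ψ).relabel (Sum.map id ULift.up)
  let e : ULift.{w} (Fin (support ψ).card) → R := fun t => supportMap ψ t.down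
  have hχ : ∀ x : Fin 1 → W, χ.Realize (Sum.elim x fun t => (e t : W)) ↔ x 0 ∈ D := fun x => by
    rw [Formula.realize_relabel, Sum.elim_comp_map, Function.comp_id, hD,
      ← realize_constantsToVars]
    exact realize_supportFormula ψ x (↑)
  obtain ⟨b, hbR, hb⟩ := hR _ (fun t => (e t : W)) ((Cardinal.lt_aleph0_of_finite _).le.trans hκ)
    (fun t => (e t).2) 1 {χ}
    fun s hs => ⟨fun _ => y, fun θ hθ => (hs hθ : θ = χ) ▸ (hχ _).2 hy⟩
  exact ⟨b 0, (hχ b).1 (hb χ rfl), hbR 0⟩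

theorem SaturatedIn.isSaturated {S : L.ElementarySubstructure W}
    (hS : SaturatedIn L (S : Set W) κ) : IsSaturated L S (Order.succ κ) := by
  intro A hA n Γ hΓ
  have hrel : ∀ (φ : L[[A]].Formula (Fin n)) (x : Fin n → S),
      (constantsToVars φ).Realize (Sum.elim (S.subtype ∘ x) fun a : A => ((a : S) : W)) ↔
        φ.Realize x := fun φ x => by
    rw [← realize_constantsToVars φ x, ← S.subtype.map_formula, Sum.comp_elim]
    rfl
  obtain ⟨b, hbS, hb⟩ := hS A (fun a => ((a : S) : W)) (Order.lt_succ_iff.1 hA)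
    (fun a => (a : S).2) n (constantsToVars '' Γ) fun s hs => by
      classical
      obtain ⟨t, ht, rfl⟩ := Finset.subset_set_image_iff.1 hs
      obtain ⟨x, hx⟩ := hΓ t ht
      exact ⟨S.subtype ∘ x, Finset.forall_mem_image.2 fun φ hφ => (hrel φ x).2 (hx φ hφ)⟩
  exact ⟨fun t => ⟨b t, hbS t⟩, fun φ hφ => (hrel φ _).1 (hb _ ⟨φ, hφ, rfl⟩)⟩

theorem exists_isSaturated (N : Type (max u v w)) [L.Structure N] [Nonempty N]
    {κ : Cardinal.{max u v w}} (hκ : ℵ₀ ≤ κ) :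
    ∃ (U : Type (max u v w)) (_ : L.Structure U) (_ : Nonempty U) (_ : N ↪ₑ[L] U),
      IsSaturated L U (Order.succ κ) := by
  obtain ⟨W, _, _, R, g, hg, hR⟩ := exists_saturatedIn (L := L) N κ
  let U : L.ElementarySubstructure W := (hR.meetsDefinable hκ).toElementarySubstructure
  have hUR : (U : Set W) = R := (hR.meetsDefinable hκ).closure_eq_self
  have hgU : ∀ a, (g a : W) ∈ U := fun a => hUR.superset (g a).2
  have helem : ∀ {n : ℕ} (φ : L.Formula (Fin n)) (x : Fin n → N), φ.Realize x →
      φ.Realize fun t => (g (x t) : W) := fun φ x hφ => by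
    have := hg (φ.relabel x) (by rwa [Formula.realize_relabel])
    rwa [Formula.realize_relabel] at this
  refine ⟨U, inferInstance, inferInstance, ⟨fun a => ⟨g a, hgU a⟩, fun n φ x => ?_⟩,
    (hUR.symm ▸ hR : SaturatedIn L (U : Set W) κ).isSaturated⟩
  rw [← U.subtype.map_formula]
  exact ⟨fun h => by_contra fun hn => helem φ.not x (Formula.realize_not.2 hn) h, helem φ x⟩

end SaturatedExtension

section SOPArrays

variable {L : FirstOrder.Language.{u, v}} {N : Type w'} {I : Type w} {β : Type} {n : ℕ}

/-- The tuple at the position `p` of the array `v`, which has two tuples in each column `i : I`. -/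
def entry (v : I × Bool × β → N) (p : I × Bool) : β → N :=
  fun t => v (p.1, p.2, t)

/-- The elements in the columns before the column `i` of an array. -/
def past [LT I] (v : I × Bool × β → N) (i : I) : Set N :=
  v '' {y | y.1 < i}

/-- The formula `∃ x, φ(x; y) ∧ φ(x; y')`. -/
noncomputable def compatible (φ : L.Formula (Fin n ⊕ β)) : L.Formula (β ⊕ β) :=
  (commonSolution fun _ : Bool => φ).relabel fun q => bif q.1 then Sum.inl q.2 else Sum.inr q.2

/-- The formulas stating that an array is as in `IsSOPArray`. -/
def sopArrayFormulas (φ : L.Formula (Fin n ⊕ β)) (I : Type w) : Set (L.Formula (I × Bool × β)) :=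
  {θ | (∃ s : Finset I, θ = (commonSolution fun _ : s => φ).relabel
      fun q => (q.1.1, false, q.2)) ∨
    ∃ i j, i ≠ j ∧ θ = ((compatible φ).relabel
      (Sum.elim (fun t => (i, true, t)) fun t => (j, true, t))).not}

/-- The formula stating that the entries `p` and `p'` of an array agree on `χ(y; e)`. -/
noncomputable def agreeFormula {δ : Type} (χ : L.Formula (β ⊕ δ)) (e : δ → I × Bool × β)
    (p p' : I × Bool) : L.Formula (I × Bool × β) :=
  (χ.relabel (Sum.elim (entry id p) e)).iff (χ.relabel (Sum.elim (entry id p') e))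

/-- The formulas stating that an array is as in `IsPastUniform`. -/
def agreeFormulas [LT I] (r : I → I → Prop) : Set (L.Formula (I × Bool × β)) :=
  {θ | ∃ (k : ℕ) (χ : L.Formula (β ⊕ Fin k)) (e : Fin k → I × Bool × β) (p p' : I × Bool),
    (∀ s, (e s).1 < p.1) ∧ r p.1 p'.1 ∧ θ = agreeFormula χ e p p'}

variable [L.Structure N] {v : I × Bool × β → N}

/-- The instances of `φ` at the first entries of the columns are consistent, while those at the
second entries are pairwise inconsistent. -/
structure IsSOPArray (φ : L.Formula (Fin n ⊕ β)) (v : I × Bool × β → N) : Prop where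
  consistent : Consistent fun i x => φ.Realize (Sum.elim x (entry v (i, false)))
  inconsistent : Pairwise fun i j => ¬∃ x : Fin n → N,
    φ.Realize (Sum.elim x (entry v (i, true))) ∧ φ.Realize (Sum.elim x (entry v (j, true)))

variable (L) in
/-- Any two entries of the array in columns `i` and `j` with `r i j` have the same type over what
comes before the column `i`. -/
def IsPastUniform [LT I] (r : I → I → Prop) (v : I × Bool × β → N) : Prop :=
  ∀ p p' : I × Bool, r p.1 p'.1 → EquivOver (L := L) (past v p.1) (entry v p) (entry v p')

theorem realize_compatible (φ : L.Formula (Fin n ⊕ β)) (d d' : β → N) :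
    (compatible φ).Realize (Sum.elim d d') ↔
      ∃ x : Fin n → N, φ.Realize (Sum.elim x d) ∧ φ.Realize (Sum.elim x d') := by
  have hd : (Sum.elim d d' ∘ fun q : Σ _ : Bool, β => bif q.1 then Sum.inl q.2 else Sum.inr q.2) =
      joint fun b => bif b then d else d' := by
    funext ⟨b, t⟩
    cases b <;> rfl
  rw [compatible, Formula.realize_relabel, hd, realize_commonSolution]
  simp only [Bool.forall_bool, cond_false, cond_true, and_comm]

theorem forall_mem_sopArrayFormulas {φ : L.Formula (Fin n ⊕ β)}
    {P : L.Formula (I × Bool × β) → Prop} :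
    (∀ θ ∈ sopArrayFormulas φ I, P θ) ↔
      (∀ s : Finset I, P ((commonSolution fun _ : s => φ).relabel fun q => (q.1.1, false, q.2))) ∧
      ∀ i j, i ≠ j → P ((compatible φ).relabel
        (Sum.elim (fun t => (i, true, t)) fun t => (j, true, t))).not := by
  constructor
  · exact fun h => ⟨fun s => h _ (Or.inl ⟨s, rfl⟩), fun i j hij => h _ (Or.inr ⟨i, j, hij, rfl⟩)⟩
  · rintro ⟨h, h'⟩ θ (⟨s, rfl⟩ | ⟨i, j, hij, rfl⟩)
    exacts [h s, h' i j hij]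

theorem realize_relabel_commonSolution (φ : L.Formula (Fin n ⊕ β)) (s : Finset I) :
    ((commonSolution fun _ : s => φ).relabel fun q => (q.1.1, false, q.2)).Realize v ↔
      ∃ x : Fin n → N, ∀ i ∈ s, φ.Realize (Sum.elim x (entry v (i, false))) := by
  rw [Formula.realize_relabel]
  refine (realize_commonSolution _ fun (i : s) => entry v (i.1, false)).trans ?_
  simp only [Subtype.forall]

theorem realize_relabel_compatible (φ : L.Formula (Fin n ⊕ β)) (i j : I) :
    ((compatible φ).relabel (Sum.elim (fun t => (i, true, t)) fun t => (j, true, t))).Realize v ↔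
      ∃ x : Fin n → N, φ.Realize (Sum.elim x (entry v (i, true))) ∧
        φ.Realize (Sum.elim x (entry v (j, true))) := by
  rw [Formula.realize_relabel, Sum.comp_elim]
  exact realize_compatible φ _ _

theorem isSOPArray_iff_realize {φ : L.Formula (Fin n ⊕ β)} :
    IsSOPArray φ v ↔ ∀ θ ∈ sopArrayFormulas φ I, θ.Realize v := by
  rw [forall_mem_sopArrayFormulas]
  simp only [Formula.realize_not, realize_relabel_commonSolution, realize_relabel_compatible]
  exact ⟨fun h => ⟨h.1, h.2⟩, fun h => ⟨h.1, h.2⟩⟩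

theorem realize_agreeFormula {δ : Type} (χ : L.Formula (β ⊕ δ)) (e : δ → I × Bool × β)
    (p p' : I × Bool) :
    (agreeFormula χ e p p').Realize v ↔
      (χ.Realize (Sum.elim (entry v p) (v ∘ e)) ↔ χ.Realize (Sum.elim (entry v p') (v ∘ e))) := by
  rw [agreeFormula, Formula.realize_iff, Formula.realize_relabel, Formula.realize_relabel,
    Sum.comp_elim, Sum.comp_elim]
  rfl

theorem isPastUniform_iff_realize [LT I] {r : I → I → Prop} :
    IsPastUniform L r v ↔ ∀ θ ∈ agreeFormulas r, (θ : L.Formula _).Realize v := by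
  constructor
  · rintro h _ ⟨k, χ, e, p, p', he, hp, rfl⟩
    exact (realize_agreeFormula χ e p p').2 (h p p' hp k χ _ fun s => ⟨_, he s, rfl⟩)
  · intro h p p' hp k χ d hd
    choose e he hed using hd
    obtain rfl : v ∘ e = d := funext hed
    exact (realize_agreeFormula χ e p p').1 (h _ ⟨k, χ, e, p, p', he, hp, rfl⟩)

end SOPArrays

section GenericFilter

variable {I : Type w} [LinearOrder I] {D : Filter ℕ}

/-- The filter on maps `r : I → ℕ` corresponding to the choice of the values `r j` one after the
other, in the order of `I`, each generic for `D` relative to the previous ones (an iterated product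
of copies of `D`). -/
def genericFilter (I : Type w) [LinearOrder I] (D : Filter ℕ) : Filter (I → ℕ) :=
  Filter.generate {s | ∃ j, DependsOn (· ∈ s) (Set.Iic j) ∧
    ∀ r, ∀ᶠ k in D, Function.update r j k ∈ s}

theorem eventually_genericFilter {P : (I → ℕ) → Prop} {j : I} (hP : DependsOn P (Set.Iic j))
    (h : ∀ r, ∀ᶠ k in D, P (Function.update r j k)) : ∀ᶠ r in genericFilter I D, P r :=
  Filter.mem_generate_of_mem ⟨j, hP, h⟩

instance [D.NeBot] : (genericFilter I D).NeBot := by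
  classical
  refine Filter.generate_neBot_iff.2 fun t ht htfin => ?_
  have : Fintype t := htfin.fintype
  choose j hdep hev using fun s : t => ht s.2
  suffices H : ∀ F : Finset I, ∃ r : I → ℕ, ∀ s, j s ∈ F → r ∈ s.1 by
    obtain ⟨r, hr⟩ := H (Finset.univ.image j)
    exact ⟨r, fun s hs => hr ⟨s, hs⟩ (Finset.mem_image_of_mem j (Finset.mem_univ _))⟩
  intro F
  induction F using Finset.induction_on_max with
  | empty => exact ⟨0, by simp⟩
  | insert i F hi ih =>
    obtain ⟨r, hr⟩ := ih
    have hstep : ∀ᶠ k in D, ∀ s, j s = i → Function.update r i k ∈ s.1 :=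
      Filter.eventually_all.2 fun s => Filter.eventually_imp_distrib_left.2 fun h => h ▸ hev s r
    obtain ⟨k, hk⟩ := hstep.exists
    refine ⟨Function.update r i k, fun s hsF => ?_⟩
    rcases Finset.mem_insert.1 hsF with h | h
    · exact hk s h
    · have heq : Function.update r i k ∈ s.1 ↔ r ∈ s.1 := iff_of_eq <| hdep s fun l hl =>
        Function.update_of_ne (hl.trans_lt (hi _ h)).ne _ _
      exact heq.2 (hr s h)

theorem eventually_genericFilter_lt (hD : D ≤ Filter.atTop) {i j : I} (hij : i < j) :
    ∀ᶠ r in genericFilter I D, r i < r j := by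
  refine eventually_genericFilter (j := j) (fun r r' h => ?_) fun r => ?_
  · rw [h i hij.le, h j le_rfl]
  · filter_upwards [hD (Filter.eventually_gt_atTop (r i))] with k hk
    rwa [Function.update_self, Function.update_of_ne hij.ne]

end GenericFilter

section IndexedArrays

variable {L : FirstOrder.Language.{u, v}} {N : Type w'} [L.Structure N] {I : Type w}
  [LinearOrder I] {β : Type} {n : ℕ} {D : Filter ℕ} {v : ℕ × Bool × β → N}

theorem IsSOPArray.eventually_realize {φ : L.Formula (Fin n ⊕ β)} (h : IsSOPArray φ v)
    (hD : D ≤ Filter.atTop) {θ : L.Formula (I × Bool × β)} (hθ : θ ∈ sopArrayFormulas φ I) :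
    ∀ᶠ r in genericFilter I D, θ.Realize (v ∘ Prod.map r id) := by
  classical
  suffices H : ∀ θ ∈ sopArrayFormulas φ I, ∀ᶠ r in genericFilter I D,
    θ.Realize (v ∘ Prod.map r id) from H θ hθ
  refine forall_mem_sopArrayFormulas.2 ⟨fun s => Filter.Eventually.of_forall fun r => ?_,
    fun i j hij => ?_⟩
  · obtain ⟨x, hx⟩ := h.consistent (s.image r)
    exact (realize_relabel_commonSolution φ s).2
      ⟨x, fun i hi => hx _ (Finset.mem_image_of_mem r hi)⟩
  · have hne : ∀ᶠ r in genericFilter I D, r i ≠ r j := by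
      rcases hij.lt_or_gt with hlt | hlt
      · exact (eventually_genericFilter_lt hD hlt).mono fun r hr => hr.ne
      · exact (eventually_genericFilter_lt hD hlt).mono fun r hr => hr.ne'
    filter_upwards [hne] with r hr
    rw [Formula.realize_not, realize_relabel_compatible]
    exact h.inconsistent hr

theorem IsPastUniform.eventually_realize_entry_iff (h : IsPastUniform L (· = ·) v)
    {D : Ultrafilter ℕ} (hD : (D : Filter ℕ) ≤ Filter.atTop) {k : ℕ} (χ : L.Formula (β ⊕ Fin k))
    {e : Fin k → I × Bool × β} {p : I × Bool} (he : ∀ s, (e s).1 < p.1) :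
    ∀ᶠ r in genericFilter I D,
      (χ.Realize (Sum.elim (entry (v ∘ Prod.map r id) p) (v ∘ Prod.map r id ∘ e)) ↔
        ∀ᶠ i in D, χ.Realize (Sum.elim (entry v (i, true)) (v ∘ Prod.map r id ∘ e))) := by
  have hlim : ∀ᶠ r in genericFilter I D,
      (χ.Realize (Sum.elim (entry v (r p.1, true)) (v ∘ Prod.map r id ∘ e)) ↔
        ∀ᶠ i in D, χ.Realize (Sum.elim (entry v (i, true)) (v ∘ Prod.map r id ∘ e))) := by
    refine eventually_genericFilter (j := p.1) (fun r r' hr => ?_) fun r => ?_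
    · have hre : Prod.map r id ∘ e = Prod.map r' id ∘ e :=
        funext fun s => Prod.ext (hr _ (he s).le) rfl
      rw [hre, hr p.1 le_rfl]
    · have hre : ∀ i, Prod.map (Function.update r p.1 i) id ∘ e = Prod.map r id ∘ e := fun i =>
        funext fun s => Prod.ext (Function.update_of_ne (he s).ne _ _) rfl
      simp only [hre, Function.update_self]
      by_cases hc : ∀ᶠ i in D, χ.Realize (Sum.elim (entry v (i, true)) (v ∘ Prod.map r id ∘ e))
      · simp only [hc, iff_true]
      · simpa only [hc, iff_false] using Ultrafilter.eventually_not.2 hc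
  have hlt : ∀ᶠ r in genericFilter I (D : Filter ℕ), ∀ s, r (e s).1 < r p.1 :=
    Filter.eventually_all.2 fun s => eventually_genericFilter_lt hD (he s)
  filter_upwards [hlim, hlt] with r hr hr'
  refine Iff.trans ?_ hr
  exact h (r p.1, p.2) (r p.1, true) rfl k χ _ fun s => ⟨_, hr' s, rfl⟩

theorem IsPastUniform.eventually_realize (h : IsPastUniform L (· = ·) v)
    {D : Ultrafilter ℕ} (hD : (D : Filter ℕ) ≤ Filter.atTop) {θ : L.Formula (I × Bool × β)}
    (hθ : θ ∈ agreeFormulas fun i j : I => i ≤ j) :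
    ∀ᶠ r in genericFilter I D, θ.Realize (v ∘ Prod.map r id) := by
  obtain ⟨k, χ, e, p, p', he, hp, rfl⟩ := hθ
  filter_upwards [h.eventually_realize_entry_iff hD χ he,
    h.eventually_realize_entry_iff hD χ fun s => (he s).trans_le hp] with r hr hr'
  exact (realize_agreeFormula χ e p p').2 (hr.trans hr'.symm)

theorem exists_indexed_array [Nonempty N] (T : L.Theory) [N ⊨ T] {φ : L.Formula (Fin n ⊕ β)}
    (hφ : IsSOPArray φ v) (hv : IsPastUniform L (· = ·) v) (I : Type w) [LinearOrder I] :
    ∃ (M : Type (max u v w)) (_ : L.Structure M) (_ : Nonempty M) (w : I × Bool × β → M),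
      M ⊨ T ∧ IsSOPArray φ w ∧ IsPastUniform L (· ≤ ·) w := by
  have hev : ∀ θ ∈ sopArrayFormulas φ I ∪ agreeFormulas (· ≤ ·),
      ∀ᶠ r in genericFilter I (Filter.hyperfilter ℕ), θ.Realize (v ∘ Prod.map r id) :=
    fun θ hθ => hθ.elim (hφ.eventually_realize Nat.hyperfilter_le_atTop)
      (hv.eventually_realize Nat.hyperfilter_le_atTop)
  obtain ⟨M, _, _, w, hM, hw⟩ := exists_model_of_finite T _ fun s hs => by
    obtain ⟨r, hr⟩ := ((Filter.eventually_all_finset s).2 fun θ hθ => hev θ (hs hθ)).exists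
    exact ⟨N, inferInstance, inferInstance, _, inferInstance, hr⟩
  exact ⟨M, inferInstance, inferInstance, w, hM,
    isSOPArray_iff_realize.2 fun θ hθ => hw θ (Or.inl hθ),
    isPastUniform_iff_realize.2 fun θ hθ => hw θ (Or.inr hθ)⟩

end IndexedArrays

section TreeArrays

variable {β : Type} {N : Type w} {a : List Bool → β → N}

/-- The node `η ⌢ 0^k ⌢ 1` of the binary tree. -/
def spur (η : List Bool) (k : ℕ) : List Bool :=
  η ++ List.replicate k false ++ [true]

theorem prefix_spur (η : List Bool) (k : ℕ) : η <+: spur η k :=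
  ⟨List.replicate k false ++ [true], (List.append_assoc _ _ _).symm⟩

theorem append_replicate_append_false_prefix_spur (η : List Bool) {k l : ℕ} (h : k < l) :
    (η ++ List.replicate k false ++ [false]) <+: spur η l := by
  obtain ⟨d, rfl⟩ := Nat.exists_eq_add_of_lt h
  refine ⟨List.replicate d false ++ [true], ?_⟩
  simp only [spur, add_assoc, add_comm d 1, List.replicate_add, List.replicate_one,
    List.append_assoc]

/-- The array `v` of tuples from the tree `a` follows the sequence of nodes `η`, where `η (j + 1)`
is a spur of `η j` and also gives the first entry of the column `j`, while the second entry of that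
column comes from a shorter spur of `η j`. -/
structure FollowsTree (a : List Bool → β → N) (v : ℕ × Bool × β → N) (η : ℕ → List Bool)
    (f g : ℕ → ℕ) : Prop where
  lt : ∀ j, f j < g j
  succ_eq : ∀ j, η (j + 1) = spur (η j) (g j)
  entry_false : ∀ j, entry v (j, false) = a (spur (η j) (g j))
  entry_true : ∀ j, entry v (j, true) = a (spur (η j) (f j))

theorem exists_followsTree (a : List Bool → β → N)
    {Q : List Bool → (ℕ × Bool × β → N) → ℕ → ℕ → Prop}
    (hQ : ∀ η v, ∃ k l, k < l ∧ Q η v k l) :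
    ∃ v η f g, FollowsTree a v η f g ∧
      ∀ j, ∃ w, (∀ x : ℕ × Bool × β, x.1 < j → w x = v x) ∧ Q (η j) w (f j) (g j) := by
  choose f g hfg hQ using hQ
  let st : ℕ → List Bool × (ℕ × Bool × β → N) := Nat.rec ([], fun x => a [] x.2.2) fun j q =>
    (spur q.1 (g q.1 q.2), fun x => if x.1 = j then
      a (spur q.1 (bif x.2.1 then f q.1 q.2 else g q.1 q.2)) x.2.2 else q.2 x)
  have hst : ∀ j x, (st (j + 1)).2 x = if x.1 = j then a (spur (st j).1
      (bif x.2.1 then f (st j).1 (st j).2 else g (st j).1 (st j).2)) x.2.2 else (st j).2 x :=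
    fun _ _ => rfl
  let v : ℕ × Bool × β → N := fun x => (st (x.1 + 1)).2 x
  have hv : ∀ j x, x.1 < j → (st j).2 x = v x := fun j x hx => by
    induction j, hx using Nat.le_induction with
    | base => rfl
    | succ j hj ih => rw [hst, if_neg (Nat.ne_of_lt hj), ih]
  have hentry : ∀ j b, entry v (j, b) =
      a (spur (st j).1 (bif b then f (st j).1 (st j).2 else g (st j).1 (st j).2)) :=
    fun j b => funext fun t => (hst j (j, b, t)).trans (if_pos rfl)
  exact ⟨v, fun j => (st j).1, fun j => f (st j).1 (st j).2, fun j => g (st j).1 (st j).2,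
    ⟨fun j => hfg _ _, fun j => rfl, fun j => hentry j false, fun j => hentry j true⟩,
    fun j => ⟨(st j).2, hv j, hQ _ _⟩⟩

variable {v : ℕ × Bool × β → N} {η : ℕ → List Bool} {f g : ℕ → ℕ}

theorem FollowsTree.prefix_of_le (h : FollowsTree a v η f g) {i j : ℕ} (hij : i ≤ j) :
    η i <+: η j := by
  induction j, hij using Nat.le_induction with
  | base => exact List.prefix_rfl
  | succ j _ ih => exact ih.trans (h.succ_eq j ▸ prefix_spur _ _)

theorem FollowsTree.le_length (h : FollowsTree a v η f g) (j : ℕ) : j ≤ (η j).length := by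
  induction j with
  | zero => exact Nat.zero_le _
  | succ j ih =>
    rw [h.succ_eq, spur, List.length_append, List.length_append, List.length_singleton]
    omega

theorem FollowsTree.exists_branch (h : FollowsTree a v η f g) :
    ∃ ξ : ℕ → Bool, ∀ i, η i = (List.range (η i).length).map ξ := by
  refine ⟨fun k => (η (k + 1))[k]'(h.le_length (k + 1)), fun i => ?_⟩
  refine List.ext_getElem (by rw [List.length_map, List.length_range]) fun k h1 h2 => ?_
  rw [List.getElem_map, List.getElem_range]
  rcases le_total i (k + 1) with h' | h'
  · exact (h.prefix_of_le h').getElem h1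
  · exact ((h.prefix_of_le h').getElem (h.le_length (k + 1))).symm

variable {L : FirstOrder.Language.{u, v}} [L.Structure N] {n : ℕ} {φ : L.Formula (Fin n ⊕ β)}

theorem FollowsTree.consistent (h : FollowsTree a v η f g)
    (hcon : ∀ ξ : ℕ → Bool, Consistent fun (k : ℕ) (x : Fin n → N) =>
      φ.Realize (Sum.elim x (a ((List.range k).map ξ)))) :
    Consistent fun i (x : Fin n → N) => φ.Realize (Sum.elim x (entry v (i, false))) := by
  classical
  intro s
  obtain ⟨ξ, hξ⟩ := h.exists_branch
  obtain ⟨x, hx⟩ := hcon ξ (s.image fun i => (η (i + 1)).length)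
  refine ⟨x, fun i hi => ?_⟩
  have hxi : φ.Realize (Sum.elim x (a ((List.range (η (i + 1)).length).map ξ))) :=
    hx _ (Finset.mem_image_of_mem _ hi)
  rwa [← hξ, h.succ_eq, ← h.entry_false] at hxi

theorem FollowsTree.not_exists_of_lt (h : FollowsTree a v η f g)
    (hinc : ∀ η ν : List Bool, (η ++ [false]) <+: ν →
      ¬∃ x : Fin n → N, φ.Realize (Sum.elim x (a ν)) ∧ φ.Realize (Sum.elim x (a (η ++ [true]))))
    {i j : ℕ} (hij : i < j) :
    ¬∃ x : Fin n → N, φ.Realize (Sum.elim x (entry v (j, true))) ∧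
      φ.Realize (Sum.elim x (entry v (i, true))) := by
  rw [h.entry_true, h.entry_true]
  refine hinc (η i ++ List.replicate (f i) false) _ ?_
  calc η i ++ List.replicate (f i) false ++ [false]
      <+: η (i + 1) := h.succ_eq i ▸ append_replicate_append_false_prefix_spur _ (h.lt i)
    _ <+: η j := h.prefix_of_le hij
    _ <+: spur (η j) (f j) := prefix_spur _ _

theorem FollowsTree.isSOPArray (h : FollowsTree a v η f g)
    (hcon : ∀ ξ : ℕ → Bool, Consistent fun (k : ℕ) (x : Fin n → N) =>
      φ.Realize (Sum.elim x (a ((List.range k).map ξ))))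
    (hinc : ∀ η ν : List Bool, (η ++ [false]) <+: ν →
      ¬∃ x : Fin n → N, φ.Realize (Sum.elim x (a ν)) ∧
        φ.Realize (Sum.elim x (a (η ++ [true])))) :
    IsSOPArray φ v := by
  refine ⟨h.consistent hcon, fun i j hij => ?_⟩
  rcases hij.lt_or_gt with hlt | hlt
  · exact fun ⟨x, hx, hx'⟩ => h.not_exists_of_lt hinc hlt ⟨x, hx', hx⟩
  · exact h.not_exists_of_lt hinc hlt

/-- Among infinitely many spurs of a node, two agree on a given finite set of formulas over what
has been built so far. -/
theorem exists_isSOPArray_realize {m : ℕ} {φ : L.Formula (Fin n ⊕ Fin m)} (h : FormulaSOP1 N φ)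
    (s : Finset (L.Formula (ℕ × Bool × Fin m)))
    (hs : (s : Set (L.Formula (ℕ × Bool × Fin m))) ⊆ agreeFormulas (· = ·)) :
    ∃ v : ℕ × Bool × Fin m → N, IsSOPArray φ v ∧ ∀ θ ∈ s, θ.Realize v := by
  obtain ⟨a, hcon, hinc⟩ := h
  choose k χ e p p' he hp hθ using fun θ : s => hs θ.2
  have hpig : ∀ (η : List Bool) (v : ℕ × Bool × Fin m → N), ∃ i j : ℕ, i < j ∧ ∀ θ : s,
      ((χ θ).Realize (Sum.elim (a (spur η i)) (v ∘ e θ)) ↔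
        (χ θ).Realize (Sum.elim (a (spur η j)) (v ∘ e θ))) := fun η v => by
    obtain ⟨i, j, hij, heq⟩ := Finite.exists_ne_map_eq_of_infinite fun (i : ℕ) (θ : s) =>
      (χ θ).Realize (Sum.elim (a (spur η i)) (v ∘ e θ))
    rcases hij.lt_or_gt with hlt | hlt
    · exact ⟨i, j, hlt, fun θ => iff_of_eq (congrFun heq θ)⟩
    · exact ⟨j, i, hlt, fun θ => iff_of_eq (congrFun heq θ).symm⟩
  obtain ⟨v, η, f, g, hv, hQ⟩ := exists_followsTree a hpig
  refine ⟨v, hv.isSOPArray hcon hinc, fun θ hθs => ?_⟩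
  lift θ to s using hθs
  obtain ⟨w, hw, hagree⟩ := hQ (p θ).1
  have hwe : w ∘ e θ = v ∘ e θ := funext fun t => hw _ (he θ t)
  have hcol : ∀ b, (χ θ).Realize (Sum.elim (entry v ((p θ).1, b)) (v ∘ e θ)) ↔
      (χ θ).Realize (Sum.elim (entry v ((p θ).1, true)) (v ∘ e θ)) := by
    rintro (_ | _)
    · rw [hv.entry_true, hv.entry_false, ← hwe]
      exact (hagree θ).symm
    · rfl
  have hp' : p' θ = ((p θ).1, (p' θ).2) := Prod.ext (hp θ).symm rfl
  rw [hθ θ, realize_agreeFormula, hp']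
  exact (hcol _).trans (hcol _).symm

theorem exists_array [Nonempty N] (T : L.Theory) [N ⊨ T] {m : ℕ}
    {φ : L.Formula (Fin n ⊕ Fin m)} (h : FormulaSOP1 N φ) :
    ∃ (M : Type (max u v)) (_ : L.Structure M) (_ : Nonempty M) (v : ℕ × Bool × Fin m → M),
      M ⊨ T ∧ IsSOPArray φ v ∧ IsPastUniform L (· = ·) v := by
  classical
  obtain ⟨M, _, _, v, hM, hv⟩ := exists_model_of_finite T
    (sopArrayFormulas φ ℕ ∪ agreeFormulas (· = ·)) fun s hs => by
      obtain ⟨v, hv, hvs⟩ := exists_isSOPArray_realize h {θ ∈ s | θ ∈ agreeFormulas (· = ·)}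
        fun θ hθ => (Finset.mem_filter.1 hθ).2
      exact ⟨N, inferInstance, inferInstance, v, inferInstance, fun θ hθ => (hs hθ).elim
        (isSOPArray_iff_realize.1 hv θ) fun hθ' => hvs θ (Finset.mem_filter.2 ⟨hθ, hθ'⟩)⟩
  exact ⟨M, inferInstance, inferInstance, v, hM,
    isSOPArray_iff_realize.2 fun θ hθ => hv θ (Or.inl hθ),
    isPastUniform_iff_realize.2 fun θ hθ => hv θ (Or.inr hθ)⟩

end TreeArrays

section ArrayDivides

variable {L : FirstOrder.Language.{u, v}} {U : Type w} [L.Structure U] [Nonempty U] {β : Type}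

theorem IsMorley.eventually_eventually {A : Set U} {D : Ultrafilter (β → U)}
    (hD : ∀ᶠ b : β → U in D, ∀ i, b i ∈ A)
    {b : ℕ → β → U} (hb : IsMorley A (limitType L D) b) {χ : L.Formula (β ⊕ β)}
    (hχ : χ.Realize (Sum.elim (b 1) (b 0))) :
    ∀ᶠ d : β → U in D, ∀ᶠ d' : β → U in D, χ.Realize (Sum.elim d d') := by
  rw [← (hb 1).has_iff χ fun t => Or.inr (Set.mem_iUnion₂.2 ⟨0, one_pos, t, rfl⟩),
    has_limitType] at hχ
  filter_upwards [hχ, hD] with d hd hdA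
  rw [← Sum.elim_swap, ← Formula.realize_relabel,
    ← (hb 0).has_iff _ fun t => Or.inl (hdA t), has_limitType] at hd
  simpa only [Formula.realize_relabel, Sum.elim_swap] using hd

variable {M : Type w'} [L.Structure M] {I : Type*} [LinearOrder I]
  {v : I × Bool × β → M} {z : I} (g : M ↪ₑ[L] U)

theorem IsSOPArray.not_consistent {n : ℕ} {φ : L.Formula (Fin n ⊕ β)} (hv : IsSOPArray φ v)
    [NoMaxOrder (Set.Iio z)] {D : Ultrafilter (Set.Iio z)}
    (hD : ↑D ≤ (Filter.atTop : Filter (Set.Iio z))) {A : Set U}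
    (hA : ∀ᶠ b : β → U in D.map (fun p => g ∘ entry v (p.1, true)), ∀ i, b i ∈ A) {b : ℕ → β → U}
    (hb : IsMorley A (limitType L (D.map fun p => g ∘ entry v (p.1, true))) b) :
    ¬Consistent fun i (x : Fin n → U) => φ.Realize (Sum.elim x (b i)) := by
  intro hcon
  obtain ⟨x, hx⟩ := hcon {0, 1}
  have h10 : (compatible φ).Realize (Sum.elim (b 1) (b 0)) :=
    (realize_compatible φ _ _).2 ⟨x, hx 1 (by simp), hx 0 (by simp)⟩
  obtain ⟨p, hp⟩ := (Filter.eventually_map.1 (hb.eventually_eventually hA h10)).exists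
  obtain ⟨p', hpp', hlt⟩ :=
    ((Filter.eventually_map.1 hp).and (hD (Filter.eventually_gt_atTop p))).exists
  rw [← Sum.comp_elim, g.map_formula, realize_compatible] at hpp'
  exact hv.inconsistent (Subtype.coe_injective.ne (ne_of_lt hlt)) hpp'

variable [(L.sum L.skolem₁).Structure M]
  [(LHom.sumInl : L →ᴸ L.sum L.skolem₁).IsExpansionOn M]

theorem exists_formula_over_generators (h : IsSkolem L M) {S : Set M} {γ δ : Type*}
    (χ : L.Formula (γ ⊕ δ)) {e : δ → M} (he : ∀ i, e i ∈ skolemHull h S) :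
    ∃ χ' : (L.sum L.skolem₁).Formula (γ ⊕ S), ∀ d : γ → M,
      χ'.Realize (Sum.elim d Subtype.val) ↔ χ.Realize (Sum.elim d e) := by
  choose t ht using fun i => Substructure.mem_closure_iff_exists_term.1 (he i)
  refine ⟨((LHom.sumInl : L →ᴸ L.sum L.skolem₁).onFormula χ).subst
    (Sum.elim (fun b => Term.var (Sum.inl b)) fun i => (t i).relabel Sum.inr), fun d => ?_⟩
  rw [← LHom.realize_onFormula (LHom.sumInl : L →ᴸ L.sum L.skolem₁) χ, Formula.Realize,
    BoundedFormula.realize_subst, ← Formula.Realize]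
  refine iff_of_eq (congrArg _ (funext ?_))
  rintro (b | i)
  · rfl
  · simp only [Sum.elim_inr, Term.realize_relabel, Sum.elim_comp_inr, ht]

variable (h : IsSkolem L M)

theorem entry_mem_skolemHull_past {p : I × Bool} (hp : p.1 < z) (t : β) :
    entry v p t ∈ skolemHull h (past v z) :=
  subset_skolemHull h _ ⟨(p.1, p.2, t), hp, rfl⟩

theorem IsPastUniform.realizesOver_entry (hv : IsPastUniform (L.sum L.skolem₁) (· ≤ ·) v)
    [NoMaxOrder (Set.Iio z)] {D : Ultrafilter (Set.Iio z)}
    (hD : ↑D ≤ (Filter.atTop : Filter (Set.Iio z))) :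
    RealizesOver (mapElementary g (skolemHull h (past v z)) : Set U)
      (limitType L (D.map fun p => g ∘ entry v (p.1, true))) (g ∘ entry v (z, false)) := by
  refine realizesOver_limitType fun k χ a ha hχ => ?_
  choose e he hea using ha
  obtain rfl : g ∘ e = a := funext hea
  obtain ⟨χ', hχ'⟩ := exists_formula_over_generators h χ he
  have hreal : ∀ d : β → M, χ.Realize (Sum.elim (g ∘ d) (g ∘ e)) ↔
      (supportFormula χ').Realize (Sum.elim d (Subtype.val ∘ supportMap χ')) := fun d => by
    rw [realize_supportFormula, hχ', ← g.map_formula, Sum.comp_elim]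
  choose y hy hyval using fun i => (supportMap χ' i).2
  have hlt : ∀ᶠ p : Set.Iio z in D, ∀ i, (y i).1 < p.1 := Filter.eventually_all.2 fun i =>
    hD (Filter.eventually_gt_atTop (⟨(y i).1, hy i⟩ : Set.Iio z))
  rw [Ultrafilter.coe_map, Filter.eventually_map]
  filter_upwards [hlt] with p hp
  rw [hreal] at hχ ⊢
  exact ((hv (p.1, true) (z, false) (le_of_lt p.2)).realize_iff _
    fun i => ⟨y i, hp i, hyval i⟩).2 hχ

theorem kimDivides_of_array [Finite β] {μ : Cardinal.{w}} (hU : IsSaturated L U μ) (hμ : ℵ₀ ≤ μ)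
    {n : ℕ} {φ : L.Formula (Fin n ⊕ β)} (hφ : IsSOPArray φ v)
    (hv : IsPastUniform (L.sum L.skolem₁) (· ≤ ·) v) (hz : Order.IsSuccLimit z)
    (hcard : #(mapElementary g (skolemHull h (past v z))) < μ) :
    KimDivides (mapElementary g (skolemHull h (past v z)) : Set U) φ (g ∘ entry v (z, false)) := by
  have := hz.nonempty_Iio.to_subtype
  have := hz.isSuccPrelimit.noMaxOrder_Iio
  have hD := Ultrafilter.of_le (Filter.atTop : Filter (Set.Iio z))
  let D := (Ultrafilter.of (Filter.atTop : Filter (Set.Iio z))).map fun p =>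
    g ∘ entry v (p.1, true)
  have hmem : ∀ᶠ b : β → U in D, ∀ i, b i ∈ (mapElementary g (skolemHull h (past v z)) : Set U) :=
    Filter.eventually_map.2 (Filter.Eventually.of_forall fun p : Set.Iio z => fun t =>
      Set.mem_image_of_mem g (entry_mem_skolemHull_past h p.2 t))
  obtain ⟨b, hb⟩ := exists_realizesAlong hU hμ hcard fun _ => limitType L D
  exact ⟨limitType L D, isInvariant_limitType hmem, hv.realizesOver_entry g h hD, b, hb,
    hφ.not_consistent g hD hmem hb⟩

end ArrayDivides

section SkolemSentence

variable {L : FirstOrder.Language.{u, v}}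

/-- The sentence stating that the Skolem function for `φ` is a Skolem function. -/
noncomputable def skolemSentence {n : ℕ} (φ : L.BoundedFormula Empty (n + 1)) :
    (L.sum L.skolem₁).Sentence :=
  (((LHom.sumInl : L →ᴸ L.sum L.skolem₁).onBoundedFormula φ).ex.imp
    ((Term.bdEqual (Term.var (Sum.inr (Fin.last n)))
      (Term.func ((LHom.sumInr : L.skolem₁ →ᴸ L.sum L.skolem₁).onFunction (n := n) φ)
        fun i => Term.var (Sum.inr i.castSucc))) ⊓
      (LHom.sumInl : L →ᴸ L.sum L.skolem₁).onBoundedFormula φ).ex).alls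

theorem realize_skolemSentence {M : Type w} [L.Structure M] [(L.sum L.skolem₁).Structure M]
    [(LHom.sumInl : L →ᴸ L.sum L.skolem₁).IsExpansionOn M] {n : ℕ}
    (φ : L.BoundedFormula Empty (n + 1)) : M ⊨ skolemSentence φ ↔ ∀ (x : Fin n → M) (a : M),
      φ.Realize default (Fin.snoc x a : Fin (n + 1) → M) →
        φ.Realize default (Fin.snoc x (Structure.funMap ((LHom.sumInr : L.skolem₁ →ᴸ
          L.sum L.skolem₁).onFunction (n := n) φ) x) : Fin (n + 1) → M) := by
  rw [skolemSentence, Sentence.Realize, BoundedFormula.realize_alls]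
  simp [LHom.realize_onBoundedFormula]

end SkolemSentence

section Blocks

variable {M K : Type*} {β : Type}

/-- The elements of the array `v` in the columns `(k, l)` with `l : ℕ`. -/
def arrayBlock (v : (K ×ₗ ℕ) × Bool × β → M) (k : K) : Set M :=
  Set.range fun y : ℕ × Bool × β => v (toLex (k, y.1), y.2)

theorem past_toLex_zero [LinearOrder K] (v : (K ×ₗ ℕ) × Bool × β → M) (k : K) :
    past v (toLex (k, 0)) = ⋃ k' < k, arrayBlock v k' := by
  have hlt : ∀ (k' : K) (l : ℕ), toLex (k', l) < toLex (k, 0) ↔ k' < k := fun k' l => by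
    simp only [Prod.Lex.toLex_lt_toLex, Nat.not_lt_zero, and_false, or_false]
  ext x
  simp only [past, arrayBlock, Set.mem_image, Set.mem_ofPred_eq, Set.mem_iUnion₂, Set.mem_range]
  constructor
  · rintro ⟨⟨p, y⟩, hp, rfl⟩
    exact ⟨(ofLex p).1, (hlt _ (ofLex p).2).1 hp, ((ofLex p).2, y), rfl⟩
  · rintro ⟨k', hk', y, rfl⟩
    exact ⟨(toLex (k', y.1), y.2), (hlt _ _).2 hk', rfl⟩

theorem isSuccLimit_toLex_zero [LinearOrder K] {k : K} (hk : ¬IsMin k) :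
    Order.IsSuccLimit (toLex (k, 0) : K ×ₗ ℕ) := by
  obtain ⟨k', hk'⟩ := not_isMin_iff.1 hk
  refine ⟨fun hmin => hmin.not_lt (Prod.Lex.toLex_lt_toLex.2 (Or.inl hk') : toLex (k', 0) < _),
    fun p hp => ?_⟩
  have hpk : (ofLex p).1 < k := by
    simpa only [Nat.not_lt_zero, and_false, or_false] using
      (Prod.Lex.toLex_lt_toLex (x := ofLex p) (y := (k, 0))).1 hp.lt
  exact hp.2 (c := toLex ((ofLex p).1, (ofLex p).2 + 1))
    (Prod.Lex.lt_iff.2 (Or.inr ⟨rfl, Nat.lt_succ_self _⟩))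
    (Prod.Lex.toLex_lt_toLex.2 (Or.inl hpk))

/-- The ordinals below `κ.ord`, with an additional element `⊥` below all of them, as the blocks of
an array. The value at an ordinal `i ≥ κ.ord` is `⊥`. -/
noncomputable def position (κ : Cardinal.{w}) (i : Ordinal.{w}) : WithBot κ.ord.ToType :=
  if h : i < κ.ord then (Ordinal.ToType.mk ⟨i, h⟩ : κ.ord.ToType) else ⊥

variable {κ : Cardinal.{w}} {i : Ordinal.{w}}

theorem position_of_lt (hi : i < κ.ord) :
    position κ i = (Ordinal.ToType.mk ⟨i, hi⟩ : κ.ord.ToType) :=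
  dif_pos hi

theorem lt_position_iff (hi : i < κ.ord) {x : WithBot κ.ord.ToType} :
    x < position κ i ↔ x = ⊥ ∨ ∃ j < i, x = position κ j := by
  rw [position_of_lt hi]
  induction x with
  | bot => simp only [WithBot.bot_lt_coe, true_or]
  | coe y =>
    obtain ⟨⟨j, hj⟩, rfl⟩ := Ordinal.ToType.mk.surjective y
    simp only [WithBot.coe_lt_coe, OrderIso.lt_iff_lt, WithBot.coe_ne_bot, false_or]
    refine ⟨fun h => ⟨j, h, (position_of_lt hj).symm⟩, ?_⟩
    rintro ⟨j', hj', heq⟩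
    rw [position_of_lt (hj'.trans hi), WithBot.coe_inj] at heq
    rw [Ordinal.ToType.mk.injective heq]
    exact hj'

theorem biUnion_lt_position (hi : i < κ.ord) (s : WithBot κ.ord.ToType → Set M) :
    ⋃ x < position κ i, s x = s ⊥ ∪ ⋃ j < i, s (position κ j) := by
  ext a
  simp only [lt_position_iff hi, Set.mem_iUnion₂, Set.mem_union]
  constructor
  · rintro ⟨x, rfl | ⟨j, hj, rfl⟩, ha⟩
    exacts [Or.inl ha, Or.inr ⟨j, hj, ha⟩]
  · rintro (ha | ⟨j, hj, ha⟩)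
    exacts [⟨⊥, Or.inl rfl, ha⟩, ⟨_, Or.inr ⟨j, hj, rfl⟩, ha⟩]

end Blocks

section ChainOfSOP1

variable {L : FirstOrder.Language.{u, v}}

theorem exists_skolem_array {T : L.Theory} (h : SOP1 T) (I : Type w) [LinearOrder I] :
    ∃ (n m : ℕ) (φ : L.Formula (Fin n ⊕ Fin m)) (M : Type (max u v w)) (_ : L.Structure M)
      (_ : (L.sum L.skolem₁).Structure M)
      (_ : (LHom.sumInl : L →ᴸ L.sum L.skolem₁).IsExpansionOn M) (_ : Nonempty M)
      (v : I × Bool × Fin m → M), M ⊨ T ∧ IsSkolem L M ∧ IsSOPArray φ v ∧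
        IsPastUniform (L.sum L.skolem₁) (· ≤ ·) v := by
  obtain ⟨N, n, m, φ, hφ⟩ := h
  let T' := (L.sum L.skolem₁).completeTheory N
  have hφ' : FormulaSOP1 N ((LHom.sumInl : L →ᴸ L.sum L.skolem₁).onFormula φ) := by
    simpa only [FormulaSOP1, LHom.realize_onFormula] using hφ
  obtain ⟨N', _, _, v', hN', hv', hvu'⟩ := exists_array T' hφ'
  obtain ⟨M, _, _, v, hM, hv, hvu⟩ := exists_indexed_array T' hv' hvu' I
  let _ : L.Structure M := (LHom.sumInl : L →ᴸ L.sum L.skolem₁).reduct M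
  have hexp : (LHom.sumInl : L →ᴸ L.sum L.skolem₁).IsExpansionOn M := inferInstance
  have hsentence : ∀ σ : (L.sum L.skolem₁).Sentence, N ⊨ σ → M ⊨ σ := fun σ hσ =>
    Theory.realize_sentence_of_mem T' hσ
  refine ⟨n, m, φ, M, inferInstance, inferInstance, hexp, inferInstance, v, ?_, ?_, ?_, hvu⟩
  · exact (Theory.model_iff T).2 fun σ hσ => (LHom.realize_onSentence M LHom.sumInl σ).1
      (hsentence _ ((LHom.realize_onSentence N LHom.sumInl σ).2
        (Theory.realize_sentence_of_mem T hσ)))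
  · exact fun k ψ => (realize_skolemSentence ψ).1
      (hsentence _ ((realize_skolemSentence ψ).2 (isSkolem_of_nonempty k ψ)))
  · exact ⟨by simpa only [LHom.realize_onFormula] using hv.consistent,
      by simpa only [LHom.realize_onFormula] using hv.inconsistent⟩

theorem hasKimForkingChain_of_array (T : L.Theory) {M U : Type (max u v w)} [L.Structure M]
    [L.Structure U] [Nonempty U] [(L.sum L.skolem₁).Structure M]
    [(LHom.sumInl : L →ᴸ L.sum L.skolem₁).IsExpansionOn M] (g : M ↪ₑ[L] U) (h : IsSkolem L M)
    {κ : Cardinal.{max u v w}} (hκ : Cardinal.lift.{w} (theoryCard T) < κ)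
    (hU : IsSaturated L U κ) {n m : ℕ} {φ : L.Formula (Fin n ⊕ Fin m)}
    {v : (WithBot κ.ord.ToType ×ₗ ℕ) × Bool × Fin m → M} (hφ : IsSOPArray φ v)
    (hv : IsPastUniform (L.sum L.skolem₁) (· ≤ ·) v) : HasKimForkingChain L U κ := by
  classical
  have hκ₀ : ℵ₀ ≤ κ := (Cardinal.aleph0_le_lift.2 (aleph0_le_theoryCard T)).trans hκ.le
  let z : Ordinal.{max u v w} → WithBot κ.ord.ToType ×ₗ ℕ := fun i => toLex (position κ i, 0)
  have hpast : ∀ i < κ.ord,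
      past v (z i) = arrayBlock v ⊥ ∪ ⋃ j < i, arrayBlock v (position κ j) := fun i hi =>
    (past_toLex_zero v _).trans (biUnion_lt_position hi _)
  have hB : (arrayBlock v ⊥).Countable := Set.countable_range _
  have hA : ∀ j, (arrayBlock v (position κ j)).Countable := fun j => Set.countable_range _
  refine hasKimForkingChain_of_hullChain T g h hB hA hκ (fun _ => φ)
    (fun i => entry v (z i, false)) (fun i t => ⟨(0, false, t), rfl⟩) (fun i hi => ?_) fun s => ?_
  · have hcard := mk_hullChain_lt T g h hB hA hκ hi
    have hz : Order.IsSuccLimit (z i) := isSuccLimit_toLex_zero fun hmin =>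
      hmin.not_lt ((lt_position_iff hi).2 (Or.inl rfl))
    rw [hullChain, ← hpast i hi] at hcard ⊢
    exact ⟨1, fun _ => m, fun _ => φ, fun _ => g ∘ entry v (z i, false), fun x hx => ⟨0, hx⟩,
      fun _ => kimDivides_of_array g h hU hκ₀ hφ hv hz hcard⟩
  · obtain ⟨x, hx⟩ := hφ.consistent (s.image fun i : Set.Iio κ.ord => z i)
    exact ⟨x, fun i hi => hx _ (Finset.mem_image_of_mem _ hi)⟩

theorem exists_hasKimForkingChain {T : L.Theory} (h : SOP1 T) {κ : Cardinal.{max u v w}}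
    (hκ : Cardinal.lift.{w} (theoryCard T) < κ) :
    ∃ (U : Type (max u v w)) (_ : L.Structure U) (_ : Nonempty U) (_ : U ⊨ T),
      IsSaturated L U (Order.succ κ) ∧ HasKimForkingChain L U κ := by
  obtain ⟨n, m, φ, M, _, _, _, _, v, hM, hsk, hφ, hv⟩ :=
    exists_skolem_array h (WithBot κ.ord.ToType ×ₗ ℕ)
  obtain ⟨U, _, _, g, hU⟩ := exists_isSaturated (L := L) M
    ((Cardinal.aleph0_le_lift.2 (aleph0_le_theoryCard T)).trans hκ.le)
  exact ⟨U, inferInstance, inferInstance, (g.theory_model_iff T).1 hM, hU,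
    hasKimForkingChain_of_array T g hsk hκ (hU.mono (Order.le_succ κ)) hφ hv⟩

end ChainOfSOP1

end KimIndependence

theorem theorem4p5_general {L : FirstOrder.Language.{u, v}} (T : L.Theory) :
    (KimIndependence.NSOP1 T →
      ∀ (U : Type (max u v w)) [L.Structure U] [Nonempty U] [U ⊨ T]
        (M : L.ElementarySubstructure U),
        KimIndependence.IsSaturated L U (Order.succ #M) →
        ∀ (n : ℕ) (p : (L.elementaryDiagram M).CompleteType (Fin n)),
          ∃ M' : L.ElementarySubstructure U, M' ≤ M ∧
            #M' ≤ Cardinal.lift.{w} (KimIndependence.theoryCard T) ∧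
            ¬ KimIndependence.TypeKimForks (M' : Set U) p) ∧
    ((∃ κ : Cardinal.{max u v w}, Cardinal.lift.{w} (KimIndependence.theoryCard T) < κ ∧
        ∀ (U : Type (max u v w)) [L.Structure U] [Nonempty U] [U ⊨ T],
          KimIndependence.IsSaturated L U (Order.succ κ) →
            ¬ KimIndependence.HasKimForkingChain L U κ) ↔
      KimIndependence.NSOP1 T) := by
  refine ⟨fun hT U _ _ _ M hU n p => KimIndependence.exists_not_typeKimForks hT M hU p,
    fun ⟨κ, hκ, hchain⟩ hsop => ?_, fun hT => ?_⟩
  · obtain ⟨U, _, _, _, hU, hforks⟩ := KimIndependence.exists_hasKimForkingChain hsop hκ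
    exact hchain U hU hforks
  · have hT₀ : ℵ₀ ≤ Cardinal.lift.{w} (KimIndependence.theoryCard T) :=
      Cardinal.aleph0_le_lift.2 (KimIndependence.aleph0_le_theoryCard T)
    exact ⟨_, Order.lt_succ _, fun U _ _ _ hU => KimIndependence.not_hasKimForkingChain hT
      (Cardinal.isRegular_succ hT₀) (Order.lt_succ _) (hU.mono (Order.le_succ _))⟩

theorem theorem4p5 {L : FirstOrder.Language.{u, v}} (T : L.Theory) (hT : T.IsComplete) :
    (KimIndependence.NSOP1 T →
      ∀ (U : Type (max u v w)) [L.Structure U] [Nonempty U] [U ⊨ T]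
        (M : L.ElementarySubstructure U),
        KimIndependence.IsSaturated L U (Order.succ #M) →
        ∀ (n : ℕ) (p : (L.elementaryDiagram M).CompleteType (Fin n)),
          ∃ M' : L.ElementarySubstructure U, M' ≤ M ∧
            #M' ≤ Cardinal.lift.{w} ((2 : Cardinal) ^ KimIndependence.theoryCard T) ∧
            ¬ KimIndependence.TypeKimForks (M' : Set U) p) ∧
    ((∃ κ : Cardinal.{max u v w}, Cardinal.lift.{w} (KimIndependence.theoryCard T) < κ ∧
        ∀ (U : Type (max u v w)) [L.Structure U] [Nonempty U] [U ⊨ T],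
          KimIndependence.IsSaturated L U (Order.succ κ) →
            ¬ KimIndependence.HasKimForkingChain L U κ) ↔
      KimIndependence.NSOP1 T) := by
  obtain ⟨hlocal, hchain⟩ := theorem4p5_general T
  refine ⟨fun h U _ _ _ M hU n p => ?_, hchain⟩
  obtain ⟨M', hM', hcard, hp⟩ := hlocal h U M hU n p
  exact ⟨M', hM', hcard.trans (Cardinal.lift_le.2 (Cardinal.cantor _).le), hp⟩
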